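/- **Setting.** Let $(X,\Sigma,\mu)$ be a probability space, let $1\le p<\infty$, and let $L^p(\mu)$ be the complex $L^p$ space. A *doubly stochastic operator* on $L^p(\mu)$ is a bounded linear operator $T:L^p(\mu)\to L^p(\mu)$ such that $Tf\ge 0$ whenever $f\ge 0$, $T\mathbf 1=\mathbf 1$, and $\int Tf\,d\mu=\int f\,d\mu$ for all $f$. *Nullity.* For a finite collection $\mathcal F=\{f_1,\dots,f_r\}$ of measurable functions $X\to[0,1]$ let $\mathcal A_{\mathcal F}$ be the join of the partitions $\{A_{f_i},(X\times[0,1])\setminus A_{f_i}\}$ of $X\times[0,1]$, where $A_f=\{(x,t):t\le f(x)\}$, and let $H(\mathcal F)=-\sum_{A\in\mathcal A_{\mathcal F}}(\mu\times\lambda)(A)\log(\mu\times\lambda)(A)$, with $\lambda$ the Lebesgue measure on $[0,1]$. For a sequence $A=(t_k)_{k\ge1}$ put $$h_A(T,\mathcal F)=\limsup_{n\to\infty}\tfrac1n H\Big(\bigcup_{k=1}^n T^{t_k}\mathcal F\Big),\qquad h_A(T)=\sup_{\mathcal F}h_A(T,\mathcal F),$$ where the union stands for concatenation of collections and $T^{k}\mathcal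 F=\{T^{k}f:f\in\mathcal F\}$. The operator $T$ is *null* if $h_A(T)=0$ for every sequence $A=\{t_1<t_2<\dots\}$ of positive integers. *Discrete spectrum.* $T$ has discrete spectrum on a closed $T$-invariant subspace $V$ if $V$ is the closed linear span of $\{v\in V:\exists\lambda\in\mathbb C,\ |\lambda|=1,\ Tv=\lambda v\}$. *JdLG-decomposition.* The Jacobs–de Leeuw–Glicksberg decomposition associated with $T$ is $L^p(\mu)=E_{\mathrm{rev}}\oplus E_{\mathrm{aws}}$, where the $T$-invariant subspaces $E_{\mathrm{rev}}$ and $E_{\mathrm{aws}}$ are the range and the kernel of the unique minimal idempotent of the closure of $\{I,T,T^2,\dots\}$ in the weak operator topology. *NF-decomposition.* For $p=2$, a closed subspace $W$ reduces $T$ if $W$ and $W^\perp$ are $T$-invariant, and an operator on a Hilbert space is completely non-unitary if there is no nonzero reducing subspace on which it is unitary. The Nagy–Foiaş decomposition is the orthogonal decomposition $L^2(\mu)=H_{\mathrm{uni}}\oplus H_{\mathrm{cnu}}$ into subspaces reducing $T$ such that $T|_{H_{\mathrm{uni}}}$ is unitary and $T|_{H_{\mathrm{cnu}}}$ is completely non-unitary.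 **Theorem.** Let $T:L^p(\mu)\to L^p(\mu)$ be doubly stochastic, $1\le p<\infty$. The following conditions are equivalent: 1. $T$ is null; 2. $L^p(\mu)=V\oplus W$ for some closed $T$-invariant subspaces $V,W$ such that $T$ has discrete spectrum on $V$ and $\lim_{n\to\infty}\|T^nf\|_p=0$ for every $f\in W$; 3. if $E_{\mathrm{rev}}\oplus E_{\mathrm{aws}}$ is the JdLG-decomposition of $L^p(\mu)$ associated with $T$, then $\lim_{n\to\infty}\|T^nf\|_p=0$ for every $f\in E_{\mathrm{aws}}$. If $p=2$, then each of these conditions is equivalent to: 4. if $H_{\mathrm{uni}}\oplus H_{\mathrm{cnu}}$ is the NF-decomposition of $L^2(\mu)$ with respect to $T$, then $T$ has discrete spectrum on $H_{\mathrm{uni}}$ and $\lim_{n\to\infty}\|T^nf\|_2=0$ for every $f\in H_{\mathrm{cnu}}$. -/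

import Mathlib

open MeasureTheory Filter Topology Set
open scoped ENNReal

namespace NullOperators

noncomputable section

/-! ### Doubly stochastic operators on `L^p(μ)` -/

/-- A doubly stochastic (Markov) operator on the complex space `L^p(μ)`: it is positive, fixes the
constant function `1` and preserves the integral. -/
structure IsDoublyStochastic {X : Type*} [MeasurableSpace X] {μ : Measure X}
    [IsProbabilityMeasure μ] {p : ℝ≥0∞} [Fact (1 ≤ p)]
    (T : Lp ℂ p μ →L[ℂ] Lp ℂ p μ) : Prop where
  positive : ∀ f : Lp ℂ p μ, (∀ᵐ x ∂μ, 0 ≤ (f x).re ∧ (f x).im = 0) →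
    ∀ᵐ x ∂μ, 0 ≤ (T f x).re ∧ (T f x).im = 0
  map_one : T (Lp.const p μ (1 : ℂ)) = Lp.const p μ (1 : ℂ)
  integral_map : ∀ f : Lp ℂ p μ, ∫ x, T f x ∂μ = ∫ x, f x ∂μ

/-! ### Entropy of collections of functions and sequence entropy -/

/-- The set `A_f` of points of `X × [0,1]` that lie on or below the graph of `f`. -/
def subgraph {X : Type*} (f : X → ℝ) : Set (X × unitInterval) :=
  {q | (q.2 : ℝ) ≤ f q.1}

/-- The atom, indexed by `s`, of the join of the partitions `{A_f, (A_f)ᶜ}` over the members `f` of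
the collection `F`: the points that lie in `A_{F i}` exactly for `i ∈ s`. -/
def cell {X ι : Type*} (F : ι → X → ℝ) (s : Finset ι) : Set (X × unitInterval) :=
  {q | ∀ i, q ∈ subgraph (F i) ↔ i ∈ s}

/-- The entropy `H(F)` of a finite collection `F`, that is, the Shannon entropy of the join of the
partitions `{A_f, (A_f)ᶜ}` with respect to the product of `μ` and Lebesgue measure on `[0,1]`
(distinct `s` have disjoint cells, and an empty cell contributes `0`). -/
def collectionEntropy {X : Type*} [MeasurableSpace X] (μ : Measure X) {ι : Type*} [Fintype ι]
    (F : ι → X → ℝ) : ℝ :=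
  ∑ s : Finset ι, Real.negMulLog ((μ.prod (volume : Measure unitInterval)).real (cell F s))

/-- A measurable function `X → [0,1]`. -/
abbrev UnitFun (X : Type*) [MeasurableSpace X] : Type _ :=
  {f : X → unitInterval // Measurable f}

lemma UnitFun.memLp {X : Type*} [MeasurableSpace X] (μ : Measure X) [IsProbabilityMeasure μ]
    (p : ℝ≥0∞) (f : UnitFun X) : MemLp (fun x => (((f.1 x : unitInterval) : ℝ) : ℂ)) p μ := by
  refine MemLp.of_bound ?_ 1 (ae_of_all _ fun x => ?_)
  · exact (Complex.measurable_ofReal.comp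
      (measurable_subtype_coe.comp f.2)).aestronglyMeasurable
  · rw [Complex.norm_real, Real.norm_eq_abs, abs_of_nonneg (f.1 x).2.1]
    exact (f.1 x).2.2

/-- The class in `L^p(μ)` of a measurable function `X → [0,1]`. -/
def UnitFun.toLp {X : Type*} [MeasurableSpace X] (μ : Measure X) [IsProbabilityMeasure μ]
    (p : ℝ≥0∞) (f : UnitFun X) : Lp ℂ p μ :=
  (f.memLp μ p).toLp

/-- The concatenation `T^{a 0} F ∨ T^{a 1} F ∨ … ∨ T^{a (n-1)} F`. The functions `T^k f` are given
through representatives of their classes; entropy does not see the choice. -/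
def iterateCollection {X : Type*} [MeasurableSpace X] {μ : Measure X} [IsProbabilityMeasure μ]
    {p : ℝ≥0∞} [Fact (1 ≤ p)] (T : Lp ℂ p μ →L[ℂ] Lp ℂ p μ) (a : ℕ → ℕ) {r : ℕ}
    (F : Fin r → UnitFun X) (n : ℕ) : Fin n × Fin r → X → ℝ :=
  fun k x => ((T ^ a k.1) ((F k.2).toLp μ p) x).re

/-- The sequence entropy `h_A(T, F)` of `T` with respect to the collection `F` along `a`. -/
def seqEntropyOf {X : Type*} [MeasurableSpace X] {μ : Measure X} [IsProbabilityMeasure μ]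
    {p : ℝ≥0∞} [Fact (1 ≤ p)] (T : Lp ℂ p μ →L[ℂ] Lp ℂ p μ) (a : ℕ → ℕ) {r : ℕ}
    (F : Fin r → UnitFun X) : EReal :=
  limsup (fun n : ℕ =>
    ((1 / (n : ℝ) * collectionEntropy μ (iterateCollection T a F n) : ℝ) : EReal)) atTop

/-- The sequence entropy `h_A(T)` of `T` along `a`: the supremum over all finite collections. -/
def seqEntropy {X : Type*} [MeasurableSpace X] {μ : Measure X} [IsProbabilityMeasure μ]
    {p : ℝ≥0∞} [Fact (1 ≤ p)] (T : Lp ℂ p μ →L[ℂ] Lp ℂ p μ) (a : ℕ → ℕ) : EReal :=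
  ⨆ (r : ℕ) (F : Fin r → UnitFun X), seqEntropyOf T a F

/-- `T` is null: its sequence entropy vanishes along all increasing sequences of positive
integers. -/
def IsNull {X : Type*} [MeasurableSpace X] {μ : Measure X} [IsProbabilityMeasure μ]
    {p : ℝ≥0∞} [Fact (1 ≤ p)] (T : Lp ℂ p μ →L[ℂ] Lp ℂ p μ) : Prop :=
  ∀ a : ℕ → ℕ, StrictMono a → (∀ n, 0 < a n) → seqEntropy T a = 0

/-! ### Discrete spectrum -/

/-- `S` has discrete spectrum on `E`: the eigenvectors with unimodular eigenvalues are linearly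
dense. -/
def HasDiscreteSpectrum {E : Type*} [NormedAddCommGroup E] [NormedSpace ℂ E] (S : E →L[ℂ] E) :
    Prop :=
  (Submodule.span ℂ {v : E | ∃ l : ℂ, ‖l‖ = 1 ∧ S v = l • v}).topologicalClosure = ⊤

/-- The subspace `V` is invariant and the restriction of `T` to `V` has discrete spectrum. -/
def HasDiscreteSpectrumOn {E : Type*} [NormedAddCommGroup E] [NormedSpace ℂ E] (T : E →L[ℂ] E)
    (V : Submodule ℂ E) : Prop :=
  ∃ h : MapsTo T V V, HasDiscreteSpectrum (T.restrict h)

/-- All orbits starting in `W` converge to `0` in norm. -/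
def StableOn {E : Type*} [NormedAddCommGroup E] [NormedSpace ℂ E] (T : E →L[ℂ] E)
    (W : Submodule ℂ E) : Prop :=
  ∀ f ∈ W, Tendsto (fun n : ℕ => ‖(T ^ n) f‖) atTop (𝓝 0)

/-! ### The Jacobs–de Leeuw–Glicksberg decomposition -/

/-- The closure of `{I, T, T², …}` in the weak operator topology. -/
def wotSemigroup {E : Type*} [NormedAddCommGroup E] [NormedSpace ℂ E] (T : E →L[ℂ] E) :
    Set (E →WOT[ℂ] E) :=
  closure (range fun n : ℕ => ContinuousLinearMapWOT.ofCLM (T ^ n))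

/-- `Q` is a minimal idempotent of `S`, for the order `P ≤ Q ↔ P Q = Q P = P` of idempotents. -/
def IsMinimalIdempotent {R : Type*} [Mul R] (S : Set R) (Q : R) : Prop :=
  Q ∈ S ∧ Q * Q = Q ∧ ∀ P ∈ S, P * P = P → P * Q = P → Q * P = P → P = Q

/-- `E = V ⊕ W` is the JdLG-decomposition associated with `T`: `V` (the reversible part) and `W`
(the almost weakly stable part) are invariant complementary subspaces, namely the range and the
kernel of the unique minimal idempotent of the weak operator closure of `{I, T, T², …}`. -/
structure IsJdLGDecomposition {E : Type*} [NormedAddCommGroup E] [NormedSpace ℂ E]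
    (T : E →L[ℂ] E) (V W : Submodule ℂ E) : Prop where
  isCompl : IsCompl V W
  mapsTo_rev : MapsTo T V V
  mapsTo_aws : MapsTo T W W
  exists_idempotent : ∃ Q : E →L[ℂ] E,
    IsMinimalIdempotent (wotSemigroup T) (ContinuousLinearMapWOT.ofCLM Q) ∧
    (∀ Q', IsMinimalIdempotent (wotSemigroup T) Q' → Q' = ContinuousLinearMapWOT.ofCLM Q) ∧
    V = LinearMap.range (Q : E →ₗ[ℂ] E) ∧ W = LinearMap.ker (Q : E →ₗ[ℂ] E)

/-! ### The Nagy–Foiaş decomposition -/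

/-- The closed subspace `U` reduces `T`: both `U` and its orthogonal complement are invariant. -/
structure Reduces {H : Type*} [NormedAddCommGroup H] [InnerProductSpace ℂ H] (T : H →L[ℂ] H)
    (U : Submodule ℂ H) : Prop where
  isClosed : IsClosed (U : Set H)
  mapsTo : MapsTo T U U
  mapsTo_orthogonal : MapsTo T Uᗮ Uᗮ

/-- `S` is unitary: a surjective linear isometry. -/
def IsUnitaryOperator {H : Type*} [NormedAddCommGroup H] [InnerProductSpace ℂ H]
    (S : H →L[ℂ] H) : Prop :=
  Isometry S ∧ Function.Surjective S

/-- `S` is completely non-unitary: it is not unitary on any nonzero reducing subspace. -/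
def IsCompletelyNonUnitary {H : Type*} [NormedAddCommGroup H] [InnerProductSpace ℂ H]
    (S : H →L[ℂ] H) : Prop :=
  ∀ (U : Submodule ℂ H) (hU : Reduces S U), IsUnitaryOperator (S.restrict hU.mapsTo) → U = ⊥

/-- `H = U ⊕ C` is the NF-decomposition with respect to `T`: an orthogonal sum of two reducing
subspaces such that `T` is unitary on `U` and completely non-unitary on `C`. -/
structure IsNFDecomposition {H : Type*} [NormedAddCommGroup H] [InnerProductSpace ℂ H]
    (T : H →L[ℂ] H) (U C : Submodule ℂ H) : Prop where
  isCompl : IsCompl U C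
  isOrtho : U ⟂ C
  reduces_unitary : Reduces T U
  reduces_cnu : Reduces T C
  unitary : IsUnitaryOperator (T.restrict reduces_unitary.mapsTo)
  completelyNonUnitary : IsCompletelyNonUnitary (T.restrict reduces_cnu.mapsTo)

/-! ### The conditions of the theorem -/

/-- `E` is the direct sum of closed invariant subspaces `V` and `W` such that `T` has discrete
spectrum on `V` and `T^n f → 0` for every `f` in `W`. -/
def SplitsDiscreteStable {E : Type*} [NormedAddCommGroup E] [NormedSpace ℂ E]
    (T : E →L[ℂ] E) : Prop :=
  ∃ V W : Submodule ℂ E, IsCompl V W ∧ IsClosed (V : Set E) ∧ IsClosed (W : Set E) ∧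
    MapsTo T W W ∧ HasDiscreteSpectrumOn T V ∧ StableOn T W

/-- `T^n f → 0` for every `f` in the almost weakly stable part of the JdLG-decomposition. -/
def StableOnJdLG {E : Type*} [NormedAddCommGroup E] [NormedSpace ℂ E] (T : E →L[ℂ] E) : Prop :=
  ∀ V W : Submodule ℂ E, IsJdLGDecomposition T V W → StableOn T W

/-- `T` has discrete spectrum on the unitary part of the NF-decomposition, and `T^n f → 0` for every
`f` in its completely non-unitary part. -/
def DiscreteStableOnNF {H : Type*} [NormedAddCommGroup H] [InnerProductSpace ℂ H]
    (T : H →L[ℂ] H) : Prop :=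
  ∀ U C : Submodule ℂ H, IsNFDecomposition T U C → HasDiscreteSpectrumOn T U ∧ StableOn T C

end

end NullOperators

namespace NullOperators

open scoped InnerProductSpace

section Hilbert

variable {H : Type*} [NormedAddCommGroup H] [InnerProductSpace ℂ H] [CompleteSpace H]

/-- A norm bounded family of operators on a Hilbert space has a weak operator limit along every
ultrafilter. -/
lemma exists_tendsto_inner_of_bounded {ι : Type*} (U : Ultrafilter ι) (f : ι → H →L[ℂ] H) (C : ℝ)
    (hf : ∀ i, ‖f i‖ ≤ C) :
    ∃ A : H →L[ℂ] H, ∀ x y, Tendsto (fun i => ⟪f i x, y⟫_ℂ) U (𝓝 ⟪A x, y⟫_ℂ) := by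
  have hbd : ∀ i x y, ‖⟪f i x, y⟫_ℂ‖ ≤ C * ‖x‖ * ‖y‖ := fun i x y =>
    (norm_inner_le_norm _ _).trans (mul_le_mul_of_nonneg_right
      ((f i).le_of_opNorm_le (hf i) x) (norm_nonneg y))
  have hex : ∀ x y, ∃ c : ℂ, ‖c‖ ≤ C * ‖x‖ * ‖y‖ ∧
      Tendsto (fun i => ⟪f i x, y⟫_ℂ) U (𝓝 c) := by
    intro x y
    obtain ⟨c, hc, hc'⟩ := (isCompact_closedBall (0 : ℂ) (C * ‖x‖ * ‖y‖)).ultrafilter_le_nhds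
      (U.map fun i => ⟪f i x, y⟫_ℂ) (by
        rw [le_principal_iff]
        exact mem_map.2 (Eventually.of_forall fun i => by simpa using hbd i x y))
    exact ⟨c, by simpa using hc, hc'⟩
  choose c hc hlim using hex
  let B : H →ₗ⋆[ℂ] H →ₗ[ℂ] ℂ := LinearMap.mk₂'ₛₗ (starRingEnd ℂ) (RingHom.id ℂ) c
    (fun x x' y => tendsto_nhds_unique (hlim _ _) (by
      simpa [inner_add_left] using (hlim x y).add (hlim x' y)))
    (fun a x y => tendsto_nhds_unique (hlim _ _) (by
      simpa [inner_smul_left, mul_comm] using (hlim x y).const_mul (starRingEnd ℂ a)))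
    (fun x y y' => tendsto_nhds_unique (hlim _ _) (by
      simpa [inner_add_right] using (hlim x y).add (hlim x y')))
    (fun a x y => tendsto_nhds_unique (hlim _ _) (by
      simpa [inner_smul_right] using (hlim x y).const_mul a))
  refine ⟨InnerProductSpace.continuousLinearMapOfBilin (B.mkContinuous₂ C hc), fun x y => ?_⟩
  rw [InnerProductSpace.continuousLinearMapOfBilin_apply]
  exact hlim x y

/-- The operator `y ↦ N⁻¹ ∑_{n < N} ⟪x n, y⟫ x n`. -/
noncomputable def averageRankOne (x : ℕ → H) (N : ℕ) : H →L[ℂ] H :=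
  (N : ℂ)⁻¹ • ∑ n ∈ Finset.range N, (innerSL ℂ (x n)).smulRight (x n)

omit [CompleteSpace H] in
lemma inner_averageRankOne_self (x : ℕ → H) (N : ℕ) (y : H) :
    ⟪averageRankOne x N y, y⟫_ℂ =
      (((N : ℝ)⁻¹ * ∑ n ∈ Finset.range N, ‖⟪x n, y⟫_ℂ‖ ^ 2 : ℝ) : ℂ) := by
  simp only [averageRankOne, smul_apply, sum_apply,
    ContinuousLinearMap.smulRight_apply, innerSL_apply_apply, inner_smul_left, sum_inner]
  push_cast
  congr 1
  · simp
  · refine Finset.sum_congr rfl fun n _ => ?_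
    rw [mul_comm, ← Complex.mul_conj']

lemma norm_averageRankOne_le {x : ℕ → H} {C : ℝ} (hx : ∀ n, ‖x n‖ ≤ C) (N : ℕ) :
    ‖averageRankOne x N‖ ≤ C ^ 2 := by
  have hsum : ‖∑ n ∈ Finset.range N, (innerSL ℂ (x n)).smulRight (x n)‖ ≤ N * C ^ 2 := by
    refine (norm_sum_le_of_le _ (fun n _ => ?_ : ∀ n ∈ Finset.range N, _ ≤ C ^ 2)).trans (by simp)
    rw [ContinuousLinearMap.norm_smulRight_apply, innerSL_apply_norm, sq]
    exact mul_le_mul (hx n) (hx n) (norm_nonneg _) ((norm_nonneg _).trans (hx n))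
  rw [averageRankOne, norm_smul, norm_inv, Complex.norm_natCast]
  rcases N.eq_zero_or_pos with rfl | hN
  · simp [sq_nonneg]
  · rw [inv_mul_le_iff₀ (by positivity)]
    exact hsum

/-- The weak limit of averages of the rank one operators attached to a bounded sequence. -/
lemma exists_limit_averageRankOne (U : Ultrafilter ℕ) {x : ℕ → H} {C : ℝ} (hx : ∀ n, ‖x n‖ ≤ C) :
    ∃ A : H →L[ℂ] H, A.IsPositive ∧ ∀ y,
      Tendsto (fun N : ℕ => (N : ℝ)⁻¹ * ∑ n ∈ Finset.range N, ‖⟪x n, y⟫_ℂ‖ ^ 2) U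
        (𝓝 (RCLike.re ⟪A y, y⟫_ℂ)) := by
  obtain ⟨A, hA⟩ := exists_tendsto_inner_of_bounded U _ _ (norm_averageRankOne_le hx)
  have hre : ∀ y, Tendsto (fun N : ℕ => (N : ℝ)⁻¹ * ∑ n ∈ Finset.range N, ‖⟪x n, y⟫_ℂ‖ ^ 2) U
        (𝓝 (RCLike.re ⟪A y, y⟫_ℂ)) := by
    intro y
    have := (Complex.continuous_re.tendsto _).comp (hA y y)
    refine this.congr fun N => ?_
    simp only [Function.comp_apply, inner_averageRankOne_self, Complex.ofReal_re]
  refine ⟨A, ?_, hre⟩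
  rw [ContinuousLinearMap.isPositive_iff_complex]
  intro y
  constructor
  · have h2 := (Complex.continuous_ofReal.tendsto _).comp (hre y)
    refine tendsto_nhds_unique h2 ((hA y y).congr fun N => ?_)
    rw [inner_averageRankOne_self]
    rfl
  · exact ge_of_tendsto' (hre y) fun N => by positivity

omit [CompleteSpace H] in
lemma norm_sq_apply_le_of_isPositive {A : H →L[ℂ] H} (hA : A.IsPositive) (z : H) :
    ‖A z‖ ^ 2 ≤ ‖A‖ * RCLike.re ⟪A z, z⟫_ℂ := by
  rcases (norm_nonneg A).eq_or_lt with h0 | h0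
  · have : A = 0 := norm_eq_zero.mp h0.symm
    simp [this]
  have key := hA.re_inner_nonneg_left ((‖A‖ : ℂ) • z - A z)
  have h1 : RCLike.re ⟪A (A z), A z⟫_ℂ ≤ ‖A‖ * ‖A z‖ ^ 2 := by
    refine (RCLike.re_le_norm _).trans ((norm_inner_le_norm _ _).trans ?_)
    have := A.le_opNorm (A z)
    nlinarith [norm_nonneg (A z)]
  have h2 : ⟪A (A z), z⟫_ℂ = ((‖A z‖ ^ 2 : ℝ) : ℂ) := by
    rw [show ⟪A (A z), z⟫_ℂ = ⟪A z, A z⟫_ℂ from hA.isSymmetric (A z) z, inner_self_eq_norm_sq_to_K]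
    push_cast
    rfl
  have h3 : ⟪A z, A z⟫_ℂ = ((‖A z‖ ^ 2 : ℝ) : ℂ) := by
    rw [inner_self_eq_norm_sq_to_K]
    push_cast
    rfl
  rw [map_sub, map_smul, inner_sub_left, inner_sub_right, inner_sub_right, inner_smul_left,
    inner_smul_left, inner_smul_right, inner_smul_right, h2, h3, Complex.conj_ofReal] at key
  simp only [RCLike.re_to_complex, Complex.sub_re, Complex.re_ofReal_mul, Complex.ofReal_re]
    at key h1 ⊢
  by_contra hlt
  push Not at hlt
  nlinarith

/-- A positive operator whose diagonal sums over finite orthonormal families are bounded is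
compact. -/
lemma isCompactOperator_of_sum_inner_le {A : H →L[ℂ] H} (hA : A.IsPositive) (C : ℝ)
    (hC : ∀ (m : ℕ) (v : Fin m → H), Orthonormal ℂ v →
      ∑ i, RCLike.re ⟪A (v i), v i⟫_ℂ ≤ C) : IsCompactOperator A := by
  let S : Set ℝ := {t | ∃ (m : ℕ) (v : Fin m → H), Orthonormal ℂ v ∧
    t = ∑ i, RCLike.re ⟪A (v i), v i⟫_ℂ}
  have hS : BddAbove S := ⟨C, by rintro _ ⟨m, v, hv, rfl⟩; exact hC m v hv⟩
  have hne : S.Nonempty := ⟨_, 0, Fin.elim0, ⟨fun i => i.elim0, fun i => i.elim0⟩, rfl⟩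
  change A ∈ {f : H →L[ℂ] H | IsCompactOperator f}
  rw [← (isClosed_setOfPred_isCompactOperator (σ₁₂ := RingHom.id ℂ)).closure_eq,
    Metric.mem_closure_iff]
  intro ε hε
  set η : ℝ := ε ^ 2 / (4 * (‖A‖ + 1)) with hη
  have hη0 : 0 < η := by positivity
  obtain ⟨_, ⟨m, v, hv, rfl⟩, hlt⟩ := exists_lt_of_lt_csSup hne (sub_lt_self (sSup S) hη0)
  let M : Submodule ℂ H := Submodule.span ℂ (range v)
  have hMfin : FiniteDimensional ℂ M := FiniteDimensional.span_of_finite ℂ (finite_range v)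
  have hunit : ∀ z ∈ Mᗮ, ‖z‖ = 1 → RCLike.re ⟪A z, z⟫_ℂ ≤ η := by
    intro z hz hz1
    have hort : ∀ i, ⟪v i, z⟫_ℂ = 0 := fun i =>
      (Submodule.mem_orthogonal M z).1 hz _ (Submodule.subset_span ⟨i, rfl⟩)
    have hcons : Orthonormal ℂ (Fin.cons z v : Fin (m + 1) → H) := by
      constructor
      · intro i
        refine Fin.cases ?_ (fun j => ?_) i
        · simpa using hz1
        · simpa using hv.1 j
      · intro i j
        refine Fin.cases ?_ (fun i => ?_) i <;> refine Fin.cases ?_ (fun j => ?_) j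
        · simp
        · intro _
          simp only [Fin.cons_zero, Fin.cons_succ]
          rw [← inner_conj_symm, hort, map_zero]
        · intro _
          simpa using hort i
        · intro hij
          simp only [Fin.cons_succ]
          exact hv.2 fun h => hij (by rw [h])
    have := le_csSup hS ⟨m + 1, Fin.cons z v, hcons, rfl⟩
    rw [Fin.sum_univ_succ] at this
    simp only [Fin.cons_zero, Fin.cons_succ] at this
    linarith
  have hnorm : ∀ z ∈ Mᗮ, ‖A z‖ ≤ ε / 2 * ‖z‖ := by
    intro z hz
    rcases eq_or_ne z 0 with rfl | hz0
    · simp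
    have hzn : 0 < ‖z‖ := norm_pos_iff.2 hz0
    set w : H := ((‖z‖⁻¹ : ℝ) : ℂ) • z with hw
    have hw1 : ‖w‖ = 1 := by
      rw [hw, norm_smul, Complex.norm_real, Real.norm_eq_abs, abs_of_pos (by positivity)]
      field_simp
    have h1 := norm_sq_apply_le_of_isPositive hA w
    have h2 := hunit w (Submodule.smul_mem _ _ hz) hw1
    have h3 : ‖A w‖ ^ 2 ≤ (ε / 2) ^ 2 := by
      calc ‖A w‖ ^ 2 ≤ ‖A‖ * η := h1.trans (mul_le_mul_of_nonneg_left h2 (norm_nonneg _))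
        _ ≤ (‖A‖ + 1) * η := by nlinarith
        _ = (ε / 2) ^ 2 := by rw [hη]; field_simp; ring
    have h4 : ‖A w‖ ≤ ε / 2 := abs_le_of_sq_le_sq' h3 (by positivity) |>.2
    rw [hw, map_smul, norm_smul, Complex.norm_real, Real.norm_eq_abs,
      abs_of_pos (by positivity), inv_mul_le_iff₀ hzn] at h4
    linarith
  refine ⟨A ∘L M.starProjection, ?_, ?_⟩
  · have h1 : IsCompactOperator (id : M → M) := isCompactOperator_id
    exact (h1.comp_clm M.orthogonalProjectionOnto).clm_comp (A ∘L M.subtypeL)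
  · rw [dist_eq_norm]
    refine lt_of_le_of_lt (ContinuousLinearMap.opNorm_le_bound _ (by positivity) fun z => ?_)
      (half_lt_self hε)
    have hz : z - M.starProjection z ∈ Mᗮ := Submodule.sub_starProjection_mem_orthogonal z
    have h1 := hnorm _ hz
    have h2 : ‖z - M.starProjection z‖ ≤ ‖z‖ := by
      rw [← Submodule.starProjection_orthogonal_val]
      exact Submodule.norm_starProjection_apply_le _ _
    rw [sub_apply, ContinuousLinearMap.comp_apply, ← map_sub]
    exact h1.trans (mul_le_mul_of_nonneg_left h2 (by positivity))

/-- The norm of a nonzero compact positive operator is an eigenvalue. -/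
lemma hasEigenvalue_norm_of_isPositive {A : H →L[ℂ] H} (hA : A.IsPositive)
    (hcomp : IsCompactOperator A) (h0 : A ≠ 0) :
    Module.End.HasEigenvalue (A : Module.End ℂ H) (‖A‖ : ℂ) := by
  have hnt : Nontrivial H := by
    obtain ⟨z, hz⟩ : ∃ z, A z ≠ 0 := by
      by_contra! h
      exact h0 (ContinuousLinearMap.ext h)
    exact ⟨z, 0, fun h => hz (by rw [h, map_zero])⟩
  obtain ⟨k, hk, hk'⟩ := spectrum.exists_nnnorm_eq_spectralRadius (A : H →L[ℂ] H)
  rw [hA.isSelfAdjoint.spectralRadius_eq_nnnorm, ENNReal.coe_inj] at hk'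
  have hnorm : ‖k‖ = ‖A‖ := congrArg NNReal.toReal hk'
  have hk0 : k ≠ 0 := norm_ne_zero_iff.1 (hnorm ▸ norm_ne_zero_iff.2 h0)
  have hev := (hcomp.hasEigenvalue_iff_mem_spectrum hk0).2 hk
  obtain ⟨v, hv⟩ := hev.exists_hasEigenvector
  have hAv : A v = k • v := hv.apply_eq_smul
  obtain ⟨h1, h2⟩ := (ContinuousLinearMap.isPositive_iff_complex A).1 hA v
  have hvn : ‖v‖ ≠ 0 := norm_ne_zero_iff.2 hv.2
  set r := RCLike.re ⟪A v, v⟫_ℂ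
  have h3 : starRingEnd ℂ k = ((r / ‖v‖ ^ 2 : ℝ) : ℂ) := by
    rw [hAv, inner_smul_left, inner_self_eq_norm_sq_to_K] at h1
    push_cast
    rw [eq_div_iff (by exact_mod_cast pow_ne_zero 2 hvn)]
    exact h1.symm
  have h4 : k = ((r / ‖v‖ ^ 2 : ℝ) : ℂ) := by
    rw [← Complex.conj_conj k, h3, Complex.conj_ofReal]
  have h5 : k = (‖A‖ : ℂ) := by
    rw [← hnorm, h4, Complex.norm_real, Real.norm_eq_abs, abs_of_nonneg (by positivity)]
  rwa [h5] at hev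

/-- A unimodular eigenvector of the adjoint of a contraction is an eigenvector of the
contraction. -/
lemma apply_eq_of_adjoint_apply_eq {T : H →L[ℂ] H} (hT : ‖T‖ ≤ 1) {e : H} {c : ℂ} (hc : ‖c‖ = 1)
    (he : T.adjoint e = c • e) : T e = starRingEnd ℂ c • e := by
  have h1 : ‖T e - starRingEnd ℂ c • e‖ ^ 2 ≤ 0 := by
    have h2 : ⟪T e, starRingEnd ℂ c • e⟫_ℂ = ((‖e‖ ^ 2 : ℝ) : ℂ) := by
      rw [inner_smul_right, ← ContinuousLinearMap.adjoint_inner_right, he, inner_smul_right,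
        ← mul_assoc, Complex.conj_mul', hc, inner_self_eq_norm_sq_to_K]
      simp
    have h3 : ‖T e‖ ≤ ‖e‖ := by simpa using T.le_of_opNorm_le hT e
    rw [@norm_sub_sq ℂ, h2, norm_smul, RCLike.norm_conj, hc]
    simp only [RCLike.re_to_complex, Complex.ofReal_re]
    nlinarith [norm_nonneg (T e)]
  have h4 : ‖T e - starRingEnd ℂ c • e‖ = 0 := by
    have := sq_nonneg ‖T e - starRingEnd ℂ c • e‖
    exact pow_eq_zero_iff two_ne_zero |>.1 (le_antisymm h1 this)
  exact sub_eq_zero.1 (norm_eq_zero.1 h4)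

/-- The closed linear span of the eigenvectors with unimodular eigenvalues. -/
noncomputable def unimodularSpan {E : Type*} [NormedAddCommGroup E] [NormedSpace ℂ E]
    (T : E →L[ℂ] E) : Submodule ℂ E :=
  (Submodule.span ℂ {v : E | ∃ l : ℂ, ‖l‖ = 1 ∧ T v = l • v}).topologicalClosure

lemma mem_unimodularSpan {E : Type*} [NormedAddCommGroup E] [NormedSpace ℂ E]
    {T : E →L[ℂ] E} {v : E} {l : ℂ} (hl : ‖l‖ = 1) (hv : T v = l • v) : v ∈ unimodularSpan T :=
  Submodule.le_topologicalClosure _ (Submodule.subset_span ⟨l, hl, hv⟩)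

lemma isClosed_unimodularSpan {E : Type*} [NormedAddCommGroup E] [NormedSpace ℂ E]
    (T : E →L[ℂ] E) : IsClosed (unimodularSpan T : Set E) :=
  Submodule.isClosed_topologicalClosure _

lemma norm_pow_apply_le {E : Type*} [NormedAddCommGroup E] [NormedSpace ℂ E]
    {T : E →L[ℂ] E} (hT : ‖T‖ ≤ 1) (n : ℕ) (f : E) : ‖(T ^ n) f‖ ≤ ‖f‖ := by
  induction n with
  | zero => simp
  | succ n ih =>
    rw [pow_succ', mul_apply_eq_comp]
    exact (by simpa using T.le_of_opNorm_le hT ((T ^ n) f) : _ ≤ ‖(T ^ n) f‖).trans ih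

/-- A positive compact operator that dominates no unimodular eigenvector and is invariant under
`A ↦ T A T*` vanishes. -/
lemma eq_zero_of_invariant {T A : H →L[ℂ] H} (hT : ‖T‖ ≤ 1) (hA : A.IsPositive)
    (hcomp : IsCompactOperator A)
    (hinv : ∀ y, RCLike.re ⟪A (T.adjoint y), T.adjoint y⟫_ℂ = RCLike.re ⟪A y, y⟫_ℂ)
    (heig : ∀ (e : H) (c : ℂ), ‖c‖ = 1 → T.adjoint e = c • e → RCLike.re ⟪A e, e⟫_ℂ = 0) :
    A = 0 := by
  by_contra h0
  have hA0 : 0 < ‖A‖ := norm_pos_iff.2 h0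
  have hev := hasEigenvalue_norm_of_isPositive hA hcomp h0
  set E := Module.End.eigenspace (A : Module.End ℂ H) (‖A‖ : ℂ) with hE
  have hfin : FiniteDimensional ℂ E :=
    ContinuousLinearMap.finite_dimensional_eigenspace hcomp _ (by exact_mod_cast hA0.ne')
  have hmem : ∀ y, y ∈ E ↔ A y = (‖A‖ : ℂ) • y := fun y => Module.End.mem_eigenspace_iff
  have hdiag : ∀ y ∈ E, RCLike.re ⟪A y, y⟫_ℂ = ‖A‖ * ‖y‖ ^ 2 := by
    intro y hy
    rw [(hmem y).1 hy, inner_smul_left, inner_self_eq_norm_sq_to_K, Complex.conj_ofReal]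
    simp [← Complex.ofReal_pow]
  have hle : ∀ y, RCLike.re ⟪A y, y⟫_ℂ ≤ ‖A‖ * ‖y‖ ^ 2 := by
    intro y
    refine (RCLike.re_le_norm _).trans ((norm_inner_le_norm _ _).trans ?_)
    nlinarith [A.le_opNorm y, norm_nonneg y]
  have hcon : ∀ y, ‖T.adjoint y‖ ≤ ‖y‖ := fun y => by
    have : ‖T.adjoint‖ ≤ 1 := by rwa [LinearIsometryEquiv.norm_map]
    simpa using (T.adjoint).le_of_opNorm_le this y
  have hiso : ∀ y ∈ E, ‖T.adjoint y‖ = ‖y‖ := by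
    intro y hy
    refine le_antisymm (hcon y) ?_
    have h1 := hle (T.adjoint y)
    rw [hinv, hdiag y hy] at h1
    exact abs_le_of_sq_le_sq' (le_of_mul_le_mul_left h1 hA0) (norm_nonneg _) |>.2
  have hmaps : ∀ y ∈ E, T.adjoint y ∈ E := by
    intro y hy
    rw [hmem]
    set z := T.adjoint y
    have h1 : RCLike.re ⟪A z, z⟫_ℂ = ‖A‖ * ‖z‖ ^ 2 := by rw [hinv, hdiag y hy, hiso y hy]
    have h2 := norm_sq_apply_le_of_isPositive hA z
    have h3 : ‖A z - (‖A‖ : ℂ) • z‖ ^ 2 ≤ 0 := by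
      rw [@norm_sub_sq ℂ, inner_smul_right, norm_smul, Complex.norm_real, norm_norm]
      simp only [RCLike.re_to_complex, Complex.re_ofReal_mul] at h1 h2 ⊢
      rw [h1] at h2 ⊢
      nlinarith
    have h4 : ‖A z - (‖A‖ : ℂ) • z‖ = 0 :=
      pow_eq_zero_iff two_ne_zero |>.1 (le_antisymm h3 (sq_nonneg _))
    exact sub_eq_zero.1 (norm_eq_zero.1 h4)
  have hnt : Nontrivial E := (Submodule.nontrivial_iff_ne_bot).2 hev
  obtain ⟨c, hc⟩ := Module.End.exists_eigenvalue
    ((T.adjoint : H →ₗ[ℂ] H).restrict hmaps : Module.End ℂ E)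
  obtain ⟨e, he⟩ := hc.exists_hasEigenvector
  have he1 : T.adjoint (e : H) = c • (e : H) := congrArg Subtype.val he.apply_eq_smul
  have he0 : ‖(e : H)‖ ≠ 0 := norm_ne_zero_iff.2 fun h => he.2 (Subtype.ext h)
  have hcn : ‖c‖ = 1 := by
    have := hiso e e.2
    rw [he1, norm_smul] at this
    exact mul_right_cancel₀ he0 (by rw [this, one_mul])
  have h5 := heig e c hcn he1
  rw [hdiag e e.2] at h5
  have : 0 < ‖A‖ * ‖(e : H)‖ ^ 2 := by positivity
  linarith

/-- A vector orthogonal to all unimodular eigenvectors of a contraction is weakly mixing. -/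
theorem tendsto_cesaro_inner_sq {T : H →L[ℂ] H} (hT : ‖T‖ ≤ 1) {f : H}
    (hf : f ∈ (unimodularSpan T)ᗮ) (g : H) :
    Tendsto (fun N : ℕ => (N : ℝ)⁻¹ * ∑ n ∈ Finset.range N, ‖⟪(T ^ n) f, g⟫_ℂ‖ ^ 2) atTop
      (𝓝 0) := by
  rw [tendsto_iff_ultrafilter]
  intro U hU
  have hbd : ∀ n, ‖(T ^ n) f‖ ≤ ‖f‖ := fun n => norm_pow_apply_le hT n f
  obtain ⟨A, hA, hlim⟩ := exists_limit_averageRankOne U hbd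
  suffices h : A = 0 by simpa [h] using hlim g
  have hle : ∀ y : H, ∀ n, ‖⟪(T ^ n) f, y⟫_ℂ‖ ^ 2 ≤ (‖f‖ * ‖y‖) ^ 2 := fun y n =>
    pow_le_pow_left₀ (norm_nonneg _) ((norm_inner_le_norm _ _).trans
      (mul_le_mul_of_nonneg_right (hbd n) (norm_nonneg y))) 2
  refine eq_zero_of_invariant hT hA ?_ ?_ ?_
  · refine isCompactOperator_of_sum_inner_le hA (‖f‖ ^ 2) fun m v hv => ?_
    refine le_of_tendsto' (tendsto_finsetSum Finset.univ fun i _ => hlim (v i)) fun N => ?_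
    rw [← Finset.mul_sum, Finset.sum_comm]
    rcases N.eq_zero_or_pos with rfl | hN
    · simp
    rw [inv_mul_le_iff₀ (by positivity)]
    refine (Finset.sum_le_card_nsmul _ _ (‖f‖ ^ 2) fun n _ => ?_).trans (by simp)
    have h1 := hv.sum_inner_products_le ((T ^ n) f) (s := Finset.univ)
    calc ∑ i, ‖⟪(T ^ n) f, v i⟫_ℂ‖ ^ 2 = ∑ i, ‖⟪v i, (T ^ n) f⟫_ℂ‖ ^ 2 := by
          simp_rw [norm_inner_symm]
      _ ≤ ‖(T ^ n) f‖ ^ 2 := h1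
      _ ≤ ‖f‖ ^ 2 := pow_le_pow_left₀ (norm_nonneg _) (hbd n) 2
  · intro y
    have hdiff : Tendsto (fun N : ℕ => (N : ℝ)⁻¹ * ((‖f‖ * ‖y‖) ^ 2)) U (𝓝 0) := by
      have := (tendsto_inv_atTop_nhds_zero_nat (𝕜 := ℝ)).mul_const ((‖f‖ * ‖y‖) ^ 2)
      rw [zero_mul] at this
      exact this.mono_left hU
    have h1 := (hlim (T.adjoint y)).sub (hlim y)
    refine sub_eq_zero.1 (tendsto_nhds_unique h1 (squeeze_zero_norm (fun N => ?_) hdiff))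
    have hshift : ∀ n, ⟪(T ^ n) f, T.adjoint y⟫_ℂ = ⟪(T ^ (n + 1)) f, y⟫_ℂ := fun n => by
      rw [ContinuousLinearMap.adjoint_inner_right, pow_succ', mul_apply_eq_comp]
    simp_rw [hshift]
    rw [← mul_sub, ← Finset.sum_sub_distrib,
      Finset.sum_range_sub (fun n => ‖⟪(T ^ n) f, y⟫_ℂ‖ ^ 2), norm_mul, norm_inv,
      Real.norm_natCast]
    refine mul_le_mul_of_nonneg_left ?_ (by positivity)
    rw [Real.norm_eq_abs, abs_le]
    constructor <;> nlinarith [hle y N, hle y 0, sq_nonneg ‖⟪(T ^ N) f, y⟫_ℂ‖,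
      sq_nonneg ‖⟪(T ^ 0) f, y⟫_ℂ‖]
  · intro e c hc he
    have hTe := apply_eq_of_adjoint_apply_eq hT hc he
    have hmem : e ∈ unimodularSpan T := mem_unimodularSpan (by rwa [RCLike.norm_conj]) hTe
    have hzero : ∀ n, ⟪(T ^ n) f, e⟫_ℂ = 0 := by
      intro n
      have h : ∀ n : ℕ, ⟪(T ^ n) f, e⟫_ℂ = c ^ n * ⟪f, e⟫_ℂ := by
        intro n
        induction n with
        | zero => simp
        | succ n ih =>
          rw [pow_succ', mul_apply_eq_comp, ← ContinuousLinearMap.adjoint_inner_right,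
            he, inner_smul_right, ih]
          ring
      rw [h, (Submodule.mem_orthogonal' _ f).1 hf e hmem, mul_zero]
    refine tendsto_nhds_unique (hlim e) ?_
    simp only [hzero]
    simp

end Hilbert

/-- The filter of sets containing `{n | x n < 1}` for some nonnegative sequence `x` with vanishing
Cesàro averages. -/
noncomputable def cesaroFilter : Filter ℕ where
  sets := {A | ∃ x : ℕ → ℝ, (∀ n, 0 ≤ x n) ∧
    Tendsto (fun N : ℕ => (N : ℝ)⁻¹ * ∑ n ∈ Finset.range N, x n) atTop (𝓝 0) ∧
    ∀ n, x n < 1 → n ∈ A}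
  univ_sets := ⟨fun _ => 0, by simp, by simp, by simp⟩
  sets_of_superset := by
    rintro A B ⟨x, h0, hx, hA⟩ hAB
    exact ⟨x, h0, hx, fun n hn => hAB (hA n hn)⟩
  inter_sets := by
    rintro A B ⟨x, hx0, hx, hA⟩ ⟨y, hy0, hy, hB⟩
    refine ⟨fun n => x n + y n, fun n => add_nonneg (hx0 n) (hy0 n), ?_, fun n hn =>
      ⟨hA n (by linarith [hy0 n]), hB n (by linarith [hx0 n])⟩⟩
    simpa [Finset.sum_add_distrib, mul_add] using hx.add hy

lemma mem_cesaroFilter {A : Set ℕ} : A ∈ cesaroFilter ↔ ∃ x : ℕ → ℝ, (∀ n, 0 ≤ x n) ∧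
    Tendsto (fun N : ℕ => (N : ℝ)⁻¹ * ∑ n ∈ Finset.range N, x n) atTop (𝓝 0) ∧
    ∀ n, x n < 1 → n ∈ A := Iff.rfl

instance : cesaroFilter.NeBot := by
  rw [neBot_iff, Ne, ← empty_mem_iff_bot, mem_cesaroFilter]
  rintro ⟨x, _, hx, h⟩
  have h1 : ∀ n, 1 ≤ x n := fun n => by
    by_contra hn
    exact h n (not_le.1 hn)
  obtain ⟨N, hN, hN0⟩ := ((hx.eventually_lt_const one_pos).and (eventually_gt_atTop 0)).exists
  have h2 : (N : ℝ) ≤ ∑ n ∈ Finset.range N, x n := by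
    simpa using Finset.card_nsmul_le_sum (Finset.range N) x 1 fun n _ => h1 n
  have hN0' : (0 : ℝ) < N := by exact_mod_cast hN0
  rw [inv_mul_lt_iff₀ hN0', mul_one] at hN
  linarith

lemma tendsto_cesaroFilter {x : ℕ → ℝ} (h0 : ∀ n, 0 ≤ x n)
    (hx : Tendsto (fun N : ℕ => (N : ℝ)⁻¹ * ∑ n ∈ Finset.range N, x n) atTop (𝓝 0)) :
    Tendsto x cesaroFilter (𝓝 0) := by
  rw [Metric.tendsto_nhds]
  intro ε hε
  refine mem_cesaroFilter.2 ⟨fun n => ε⁻¹ * x n, fun n => by have := h0 n; positivity, ?_,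
    fun n hn => ?_⟩
  · have := hx.const_mul ε⁻¹
    rw [mul_zero] at this
    refine this.congr fun N => ?_
    rw [← Finset.mul_sum]
    ring
  · rw [inv_mul_lt_iff₀ hε, mul_one] at hn
    simpa [abs_of_nonneg (h0 n)] using hn

lemma cesaroFilter_le_atTop : cesaroFilter ≤ atTop := by
  rw [atTop_basis.ge_iff]
  intro M _
  refine mem_cesaroFilter.2 ⟨fun n => if n < M then 1 else 0, fun n => by dsimp only; split_ifs <;> simp, ?_,
    fun n hn => ?_⟩
  · refine squeeze_zero (g := fun N : ℕ => (N : ℝ)⁻¹ * M) (fun N => ?_) (fun N => ?_) ?_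
    · exact mul_nonneg (by positivity) (Finset.sum_nonneg fun n _ => by split_ifs <;> simp)
    · refine mul_le_mul_of_nonneg_left ?_ (by positivity)
      rw [Finset.sum_ite, Finset.sum_const_zero, add_zero, Finset.sum_const, nsmul_one]
      have : (Finset.range N).filter (· < M) ⊆ Finset.range M := fun n hn => by
        simp only [Finset.mem_filter] at hn
        exact Finset.mem_range.2 hn.2
      exact_mod_cast (Finset.card_le_card this).trans (by simp)
    · simpa using (tendsto_inv_atTop_nhds_zero_nat (𝕜 := ℝ)).mul_const (M : ℝ)
  · by_contra h
    rw [mem_Ici, not_le] at h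
    simp [h] at hn

lemma tendsto_cesaro_shift {x : ℕ → ℝ} (h0 : ∀ n, 0 ≤ x n)
    (hx : Tendsto (fun N : ℕ => (N : ℝ)⁻¹ * ∑ n ∈ Finset.range N, x n) atTop (𝓝 0)) (m : ℕ) :
    Tendsto (fun N : ℕ => (N : ℝ)⁻¹ * ∑ n ∈ Finset.range N, x (n - m)) atTop (𝓝 0) := by
  have hle : ∀ N, ∑ n ∈ Finset.range N, x (n - m) ≤ m * x 0 + ∑ n ∈ Finset.range N, x n := by
    intro N
    rcases le_total N m with h | h
    · have : ∑ n ∈ Finset.range N, x (n - m) = N * x 0 := by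
        rw [Finset.sum_congr rfl fun n hn => by
          rw [Nat.sub_eq_zero_of_le ((Finset.mem_range.1 hn).le.trans h)]]
        simp
      have h2 : 0 ≤ ∑ n ∈ Finset.range N, x n := Finset.sum_nonneg fun n _ => h0 n
      have h3 : (N : ℝ) ≤ m := by exact_mod_cast h
      nlinarith [h0 0]
    · obtain ⟨k, rfl⟩ := Nat.exists_eq_add_of_le h
      rw [Finset.sum_range_add]
      have h1 : ∑ n ∈ Finset.range m, x (n - m) = m * x 0 := by
        rw [Finset.sum_congr rfl fun n hn => by
          rw [Nat.sub_eq_zero_of_le (Finset.mem_range.1 hn).le]]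
        simp
      have h2 : ∑ n ∈ Finset.range k, x (m + n - m) = ∑ n ∈ Finset.range k, x n := by simp
      rw [h1, h2]
      gcongr
      · exact fun n _ _ => h0 n
      · omega
  refine squeeze_zero (g := fun N : ℕ => (N : ℝ)⁻¹ * (m * x 0) +
    (N : ℝ)⁻¹ * ∑ n ∈ Finset.range N, x n) (fun N => ?_) (fun N => ?_) ?_
  · exact mul_nonneg (by positivity) (Finset.sum_nonneg fun n _ => h0 _)
  · rw [← mul_add]
    exact mul_le_mul_of_nonneg_left (hle N) (by positivity)
  · simpa using ((tendsto_inv_atTop_nhds_zero_nat (𝕜 := ℝ)).mul_const (m * x 0)).add hx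

/-- There is a filter along which the powers of every unimodular number tend to `1`, and so that
every nonnegative sequence with vanishing Cesàro averages tends to `0` along it. -/
lemma exists_filter_return : ∃ l : Filter ℕ, l.NeBot ∧
    (∀ c : ℂ, ‖c‖ = 1 → Tendsto (fun n => c ^ n) l (𝓝 1)) ∧
    ∀ x : ℕ → ℝ, (∀ n, 0 ≤ x n) →
      Tendsto (fun N : ℕ => (N : ℝ)⁻¹ * ∑ n ∈ Finset.range N, x n) atTop (𝓝 0) →
      Tendsto x l (𝓝 0) := by
  set U : Ultrafilter ℕ := Ultrafilter.of cesaroFilter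
  have hU : (U : Filter ℕ) ≤ cesaroFilter := Ultrafilter.of_le _
  refine ⟨(U : Filter ℕ).bind fun m => map (fun n => n - m) (U : Filter ℕ), ?_, ?_, ?_⟩
  · rw [neBot_iff, Ne, ← empty_mem_iff_bot, mem_bind']
    simp
  · intro c hc
    obtain ⟨d, -, hd⟩ := (isCompact_closedBall (0 : ℂ) 1).ultrafilter_le_nhds
      (U.map fun n => c ^ n) (le_principal_iff.2 (mem_map.2 (Eventually.of_forall fun n => by
        simp [hc])))
    rw [Metric.tendsto_nhds]
    intro ε hε
    have h1 : ∀ᶠ n in (U : Filter ℕ), dist (c ^ n) d < ε / 2 :=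
      hd (Metric.ball_mem_nhds d (half_pos hε))
    change ∀ᶠ m in (U : Filter ℕ), ∀ᶠ n in (U : Filter ℕ), dist (c ^ (n - m)) 1 < ε
    filter_upwards [h1] with m hm
    filter_upwards [h1, (hU.trans cesaroFilter_le_atTop) (eventually_ge_atTop m)] with n hn hmn
    have h2 : dist (c ^ (n - m)) 1 = dist (c ^ n) (c ^ m) := by
      have : c ^ n - c ^ m = c ^ m * (c ^ (n - m) - 1) := by
        rw [mul_sub, ← pow_add, Nat.add_sub_cancel' hmn, mul_one]
      rw [dist_eq_norm, dist_eq_norm, this, norm_mul, norm_pow, hc, one_pow, one_mul]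
    rw [h2]
    linarith [dist_triangle_right (c ^ n) (c ^ m) d]
  · intro x h0 hx
    rw [tendsto_def]
    intro s hs
    rw [mem_bind']
    refine Eventually.of_forall fun m => ?_
    exact ((tendsto_cesaroFilter (fun n => h0 (n - m)) (tendsto_cesaro_shift h0 hx m)).mono_left
      hU) hs

section Hilbert

variable {H : Type*} [NormedAddCommGroup H] [InnerProductSpace ℂ H] [CompleteSpace H]

instance (T : H →L[ℂ] H) : (unimodularSpan T).HasOrthogonalProjection :=
  have : CompleteSpace (unimodularSpan T) := (isClosed_unimodularSpan T).completeSpace_coe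
  inferInstance

/-- Along a suitable filter the powers of a Hilbert space contraction tend weakly to the orthogonal
projection onto the closed span of the unimodular eigenvectors. -/
theorem exists_filter_tendsto_starProjection {T : H →L[ℂ] H} (hT : ‖T‖ ≤ 1) :
    ∃ l : Filter ℕ, l.NeBot ∧ ∀ f g : H,
      Tendsto (fun n => ⟪(T ^ n) f, g⟫_ℂ) l (𝓝 ⟪(unimodularSpan T).starProjection f, g⟫_ℂ) := by
  obtain ⟨l, hl, hl1, hl2⟩ := exists_filter_return
  refine ⟨l, hl, fun f g => ?_⟩
  set K := unimodularSpan T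
  have hperp : ∀ f ∈ Kᗮ, Tendsto (fun n => ⟪(T ^ n) f, g⟫_ℂ) l (𝓝 0) := by
    intro f hf
    have h := hl2 _ (fun n => sq_nonneg _) (tendsto_cesaro_inner_sq hT hf g)
    rw [tendsto_zero_iff_norm_tendsto_zero]
    simpa [Real.sqrt_sq] using h.sqrt
  have hK : ∀ f ∈ K, Tendsto (fun n => ⟪(T ^ n) f, g⟫_ℂ) l (𝓝 ⟪f, g⟫_ℂ) := by
    intro f hf
    have hspan : ∀ f ∈ Submodule.span ℂ {v : H | ∃ l : ℂ, ‖l‖ = 1 ∧ T v = l • v},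
        Tendsto (fun n => (T ^ n) f) l (𝓝 f) := by
      intro f hf
      induction hf using Submodule.span_induction with
      | mem v hv =>
        obtain ⟨c, hc, hv⟩ := hv
        have : ∀ n : ℕ, (T ^ n) v = c ^ n • v := fun n => by
          induction n with
          | zero => simp
          | succ n ih => rw [pow_succ, mul_apply_eq_comp, hv, map_smul, ih, smul_smul, pow_succ']
        simp_rw [this]
        simpa using (hl1 c hc).smul_const v
      | zero => simp
      | add v w _ _ hv hw => simpa only [map_add] using hv.add hw
      | smul a v _ hv => simpa only [map_smul] using hv.const_smul a
    have hnorm : Tendsto (fun n => (T ^ n) f) l (𝓝 f) := by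
      rw [Metric.tendsto_nhds]
      intro ε hε
      obtain ⟨v, hv, hfv⟩ := Metric.mem_closure_iff.1 hf (ε / 3) (by positivity)
      filter_upwards [Metric.tendsto_nhds.1 (hspan v hv) (ε / 3) (by positivity)] with n hn
      have h1 : dist ((T ^ n) f) ((T ^ n) v) ≤ dist f v := by
        rw [dist_eq_norm, dist_eq_norm, ← map_sub]
        exact norm_pow_apply_le hT n _
      have := dist_triangle4 ((T ^ n) f) ((T ^ n) v) v f
      rw [dist_comm v f] at this
      linarith
    exact ((innerSL ℂ).flip g |>.continuous.tendsto f).comp hnorm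
  have hdec : f = K.starProjection f + (f - K.starProjection f) := by abel
  have h := (hK _ (K.starProjection_apply_mem f)).add
    (hperp _ (Submodule.sub_starProjection_mem_orthogonal f))
  rw [add_zero] at h
  refine h.congr fun n => ?_
  rw [← inner_add_left, ← map_add, ← hdec]

end Hilbert

section Banach

variable {E : Type*} [NormedAddCommGroup E] [NormedSpace ℂ E]

lemma mem_wotSemigroup_iff {T Q : E →L[ℂ] E} :
    ContinuousLinearMapWOT.ofCLM Q ∈ wotSemigroup T ↔ ∃ l : Filter ℕ, l.NeBot ∧
      ∀ (f : E) (φ : StrongDual ℂ E), Tendsto (fun n => φ ((T ^ n) f)) l (𝓝 (φ (Q f))) := by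
  constructor
  · intro h
    obtain ⟨u, hu, hu'⟩ := mem_closure_iff_ultrafilter.1 h
    refine ⟨comap (fun n : ℕ => ContinuousLinearMapWOT.ofCLM (T ^ n)) u,
      NeBot.comap_of_range_mem u.neBot hu, fun f φ => ?_⟩
    have h1 := (tendsto_comap (f := fun n : ℕ => ContinuousLinearMapWOT.ofCLM (T ^ n))
      (x := (u : Filter _))).mono_right hu'
    exact ContinuousLinearMapWOT.tendsto_iff_forall_dual_apply_tendsto.1 h1 f φ
  · rintro ⟨l, hl, h⟩
    exact mem_closure_of_tendsto
      (ContinuousLinearMapWOT.tendsto_iff_forall_dual_apply_tendsto.2 h)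
      (Eventually.of_forall fun n => mem_range_self n)

lemma eq_of_forall_dual_apply_eq {x y : E} (h : ∀ φ : StrongDual ℂ E, φ x = φ y) : x = y :=
  (SeparatingDual.eq_iff_forall_dual_eq (R := ℂ)).2 h

lemma pow_apply_of_apply_eq_smul {T : E →L[ℂ] E} {v : E} {c : ℂ} (hv : T v = c • v) (n : ℕ) :
    (T ^ n) v = c ^ n • v := by
  induction n with
  | zero => simp
  | succ n ih => rw [pow_succ, mul_apply_eq_comp, hv, map_smul, ih, smul_smul, pow_succ']

lemma idempotent_apply_eigenvector {T P : E →L[ℂ] E}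
    (hP : ContinuousLinearMapWOT.ofCLM P ∈ wotSemigroup T) (hPP : P * P = P) {v : E} {c : ℂ}
    (hc : ‖c‖ = 1) (hv : T v = c • v) : P v = v := by
  obtain ⟨l, hl, h⟩ := mem_wotSemigroup_iff.1 hP
  obtain ⟨d, hd, hd'⟩ := (isCompact_sphere (0 : ℂ) 1).ultrafilter_le_nhds
    ((Ultrafilter.of l).map fun n => c ^ n) (le_principal_iff.2 (mem_map.2
      (Eventually.of_forall fun n => by simp [hc])))
  have hPv : P v = d • v := by
    refine eq_of_forall_dual_apply_eq fun φ => ?_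
    refine tendsto_nhds_unique ((h v φ).mono_left (Ultrafilter.of_le l)) ?_
    simp_rw [pow_apply_of_apply_eq_smul hv, map_smul, smul_eq_mul]
    exact Tendsto.mul_const _ hd'
  have hd0 : d ≠ 0 := norm_ne_zero_iff.1 (by rw [mem_sphere_zero_iff_norm.1 hd]; exact one_ne_zero)
  have h1 : P (P v) = P v := by rw [← mul_apply_eq_comp, hPP]
  rw [hPv, map_smul, hPv] at h1
  rw [hPv]
  exact smul_right_injective E hd0 h1

lemma idempotent_apply_of_mem_unimodularSpan {T P : E →L[ℂ] E}
    (hP : ContinuousLinearMapWOT.ofCLM P ∈ wotSemigroup T) (hPP : P * P = P) {v : E}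
    (hv : v ∈ unimodularSpan T) : P v = v := by
  have hle : unimodularSpan T ≤ LinearMap.eqLocus (P : E →ₗ[ℂ] E) LinearMap.id :=
    Submodule.topologicalClosure_minimal _
      (Submodule.span_le.2 fun v ⟨c, hc, hv⟩ => idempotent_apply_eigenvector hP hPP hc hv)
      (isClosed_eq P.continuous continuous_id)
  exact hle hv

lemma commute_of_mem_wotSemigroup {T P R : E →L[ℂ] E}
    (hP : ContinuousLinearMapWOT.ofCLM P ∈ wotSemigroup T) (hR : Commute T R) : Commute P R := by
  obtain ⟨l, hl, h⟩ := mem_wotSemigroup_iff.1 hP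
  refine ContinuousLinearMap.ext fun f => eq_of_forall_dual_apply_eq fun φ => ?_
  refine tendsto_nhds_unique (h (R f) φ) ((h f (φ ∘L R)).congr fun n => ?_)
  have := congrArg (fun S : E →L[ℂ] E => φ (S f)) (hR.pow_left n).eq
  exact this.symm

lemma range_eq_unimodularSpan {T Q : E →L[ℂ] E}
    (hQ : ContinuousLinearMapWOT.ofCLM Q ∈ wotSemigroup T) (hQQ : Q * Q = Q)
    (hrange : ∀ f, Q f ∈ unimodularSpan T) :
    LinearMap.range (Q : E →ₗ[ℂ] E) = unimodularSpan T := by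
  refine le_antisymm ?_ fun v hv => ⟨v, idempotent_apply_of_mem_unimodularSpan hQ hQQ hv⟩
  rintro _ ⟨f, rfl⟩
  exact hrange f

/-- An idempotent in the weak operator closure of the powers of `T` whose range is spanned by
unimodular eigenvectors yields the Jacobs–de Leeuw–Glicksberg decomposition. -/
theorem isJdLGDecomposition_of_idempotent {T Q : E →L[ℂ] E}
    (hQ : ContinuousLinearMapWOT.ofCLM Q ∈ wotSemigroup T) (hQQ : Q * Q = Q)
    (hrange : ∀ f, Q f ∈ unimodularSpan T) :
    IsJdLGDecomposition T (LinearMap.range (Q : E →ₗ[ℂ] E)) (LinearMap.ker (Q : E →ₗ[ℂ] E)) := by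
  have hQT : ∀ f, Q (T f) = T (Q f) := fun f =>
    congrArg (fun S : E →L[ℂ] E => S f) (commute_of_mem_wotSemigroup hQ (Commute.refl T)).eq
  have habs : ∀ P : E →L[ℂ] E, ContinuousLinearMapWOT.ofCLM P ∈ wotSemigroup T → P * P = P →
      P * Q = Q ∧ Q * P = Q := by
    intro P hP hPP
    have h1 : P * Q = Q := ContinuousLinearMap.ext fun f =>
      idempotent_apply_of_mem_unimodularSpan hP hPP (hrange f)
    have hTQ : Commute T Q := (commute_of_mem_wotSemigroup hQ (Commute.refl T)).symm
    exact ⟨h1, by rw [← (commute_of_mem_wotSemigroup hP hTQ).eq, h1]⟩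
  refine ⟨?_, ?_, ?_, Q, ⟨hQ, congrArg _ hQQ, ?_⟩, ?_, rfl, rfl⟩
  · exact LinearMap.IsIdempotentElem.isCompl
      (congrArg (fun S : E →L[ℂ] E => (S : E →ₗ[ℂ] E)) hQQ)
  · rintro _ ⟨f, rfl⟩
    exact ⟨T f, hQT f⟩
  · intro f hf
    have hf' : Q f = 0 := hf
    change Q (T f) = 0
    rw [hQT, hf', map_zero]
  · intro P hP hPP hPQ _
    have hPP' : P.toCLM * P.toCLM = P.toCLM := congrArg ContinuousLinearMapWOT.toCLM hPP
    have := (habs P.toCLM hP hPP').1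
    rw [← hPQ]
    exact congrArg ContinuousLinearMapWOT.ofCLM this
  · rintro P ⟨hP, hPP, hmin⟩
    have hPP' : P.toCLM * P.toCLM = P.toCLM := congrArg ContinuousLinearMapWOT.toCLM hPP
    obtain ⟨h1, h2⟩ := habs P.toCLM hP hPP'
    exact (hmin _ hQ (congrArg _ hQQ) (congrArg ContinuousLinearMapWOT.ofCLM h2)
      (congrArg ContinuousLinearMapWOT.ofCLM h1)).symm

lemma mapsTo_unimodularSpan (T : E →L[ℂ] E) :
    MapsTo T (unimodularSpan T) (unimodularSpan T) := by
  have : unimodularSpan T ≤ (unimodularSpan T).comap (T : E →ₗ[ℂ] E) :=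
    Submodule.topologicalClosure_minimal _
      (Submodule.span_le.2 fun v ⟨c, hc, hv⟩ => by
        change T v ∈ unimodularSpan T
        rw [hv]
        exact Submodule.smul_mem _ _ (mem_unimodularSpan hc hv))
      ((isClosed_unimodularSpan T).preimage T.continuous)
  exact this

lemma hasDiscreteSpectrumOn_unimodularSpan (T : E →L[ℂ] E) :
    HasDiscreteSpectrumOn T (unimodularSpan T) := by
  refine ⟨mapsTo_unimodularSpan T, ?_⟩
  rw [HasDiscreteSpectrum, Submodule.eq_top_iff']
  intro x
  set S' : Set (unimodularSpan T) :=
    {v | ∃ l : ℂ, ‖l‖ = 1 ∧ (T.restrict (mapsTo_unimodularSpan T)) v = l • v} with hS'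
  have himg : (Subtype.val '' S') = {v : E | ∃ l : ℂ, ‖l‖ = 1 ∧ T v = l • v} := by
    ext v
    constructor
    · rintro ⟨w, ⟨l, hl, hw⟩, rfl⟩
      exact ⟨l, hl, congrArg Subtype.val hw⟩
    · rintro ⟨l, hl, hv⟩
      exact ⟨⟨v, mem_unimodularSpan hl hv⟩, ⟨l, hl, Subtype.ext hv⟩, rfl⟩
  change x ∈ closure (Submodule.span ℂ S' : Set (unimodularSpan T))
  rw [closure_subtype]
  have hspan : Subtype.val '' (Submodule.span ℂ S' : Set (unimodularSpan T)) =
      (Submodule.span ℂ {v : E | ∃ l : ℂ, ‖l‖ = 1 ∧ T v = l • v} : Set E) := by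
    rw [← himg]
    exact congrArg SetLike.coe (Submodule.map_span (unimodularSpan T).subtype S')
  rw [hspan]
  exact x.2

/-- The orbit of `f` is totally bounded. -/
def HasPrecompactOrbit (T : E →L[ℂ] E) (f : E) : Prop :=
  TotallyBounded (range fun n : ℕ => (T ^ n) f)

lemma HasPrecompactOrbit.add {T : E →L[ℂ] E} {f g : E} (hf : HasPrecompactOrbit T f)
    (hg : HasPrecompactOrbit T g) : HasPrecompactOrbit T (f + g) := by
  refine Metric.totallyBounded_iff.2 fun ε hε => ?_
  obtain ⟨s, hs, hs'⟩ := Metric.totallyBounded_iff.1 hf (ε / 2) (by positivity)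
  obtain ⟨t, ht, ht'⟩ := Metric.totallyBounded_iff.1 hg (ε / 2) (by positivity)
  refine ⟨image2 (· + ·) s t, hs.image2 _ ht, ?_⟩
  rintro _ ⟨n, rfl⟩
  obtain ⟨y, hy, hy'⟩ := mem_iUnion₂.1 (hs' (mem_range_self n))
  obtain ⟨z, hz, hz'⟩ := mem_iUnion₂.1 (ht' (mem_range_self n))
  refine mem_iUnion₂.2 ⟨y + z, mem_image2_of_mem hy hz, ?_⟩
  rw [Metric.mem_ball] at hy' hz' ⊢
  simp only [map_add]
  linarith [dist_add_add_le ((T ^ n) f) ((T ^ n) g) y z]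

lemma HasPrecompactOrbit.smul {T : E →L[ℂ] E} {f : E} (hf : HasPrecompactOrbit T f) (c : ℂ) :
    HasPrecompactOrbit T (c • f) := by
  have h := TotallyBounded.image hf (uniformContinuous_const_smul (X := E) c)
  refine h.subset ?_
  rintro _ ⟨n, rfl⟩
  exact ⟨(T ^ n) f, mem_range_self n, (map_smul _ _ _).symm⟩

lemma hasPrecompactOrbit_of_tendsto_zero {T : E →L[ℂ] E} {f : E}
    (h : Tendsto (fun n : ℕ => ‖(T ^ n) f‖) atTop (𝓝 0)) : HasPrecompactOrbit T f :=
  (tendsto_zero_iff_norm_tendsto_zero.2 h).cauchySeq.totallyBounded_range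

lemma hasPrecompactOrbit_of_apply_eq_smul {T : E →L[ℂ] E} {v : E} {c : ℂ} (hc : ‖c‖ = 1)
    (hv : T v = c • v) : HasPrecompactOrbit T v := by
  have h : TotallyBounded ((fun a : ℂ => a • v) '' Metric.closedBall 0 1) :=
    ((isCompact_closedBall (0 : ℂ) 1).image (by fun_prop)).totallyBounded
  refine h.subset ?_
  rintro _ ⟨n, rfl⟩
  exact ⟨c ^ n, by simp [hc], (pow_apply_of_apply_eq_smul hv n).symm⟩

/-- The closed subspace of the vectors with totally bounded orbit under a contraction. -/
def precompactOrbits {T : E →L[ℂ] E} (hT : ‖T‖ ≤ 1) : ClosedSubmodule ℂ E where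
  carrier := {f | HasPrecompactOrbit T f}
  add_mem' := HasPrecompactOrbit.add
  zero_mem' := hasPrecompactOrbit_of_tendsto_zero (by simp)
  smul_mem' c _ hf := hf.smul c
  isClosed' := by
    refine isClosed_of_closure_subset fun f hf => ?_
    refine Metric.totallyBounded_iff.2 fun ε hε => ?_
    obtain ⟨g, hg, hfg⟩ := Metric.mem_closure_iff.1 hf (ε / 2) (by positivity)
    obtain ⟨t, ht, hsub⟩ := Metric.totallyBounded_iff.1 hg (ε / 2) (by positivity)
    refine ⟨t, ht, ?_⟩
    rintro _ ⟨n, rfl⟩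
    obtain ⟨y, hy, hy'⟩ := mem_iUnion₂.1 (hsub (mem_range_self n))
    refine mem_iUnion₂.2 ⟨y, hy, ?_⟩
    rw [Metric.mem_ball] at hy' ⊢
    have h1 : dist ((T ^ n) f) ((T ^ n) g) ≤ dist f g := by
      rw [dist_eq_norm, dist_eq_norm, ← map_sub]
      exact norm_pow_apply_le hT n _
    linarith [dist_triangle ((T ^ n) f) ((T ^ n) g) y]

lemma hasPrecompactOrbit_of_splitsDiscreteStable {T : E →L[ℂ] E} (hT : ‖T‖ ≤ 1)
    (h : SplitsDiscreteStable T) (f : E) : HasPrecompactOrbit T f := by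
  obtain ⟨V, W, hVW, -, -, -, ⟨hTV, hV⟩, hW⟩ := h
  have hVle : ∀ v : V, (v : E) ∈ precompactOrbits hT := by
    have hle : (⊤ : Submodule ℂ V) ≤
        (precompactOrbits hT).toSubmodule.comap V.subtype := by
      rw [← hV]
      refine Submodule.topologicalClosure_minimal _ (Submodule.span_le.2 ?_)
        ((precompactOrbits hT).isClosed.preimage continuous_subtype_val)
      rintro v ⟨c, hc, hv⟩
      exact hasPrecompactOrbit_of_apply_eq_smul hc (congrArg Subtype.val hv)
    exact fun v => hle trivial
  obtain ⟨v, hv, w, hw, rfl⟩ := Submodule.mem_sup.1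
    (hVW.sup_eq_top ▸ Submodule.mem_top : f ∈ V ⊔ W)
  exact (hVle ⟨v, hv⟩).add (hasPrecompactOrbit_of_tendsto_zero (hW w hw))

lemma HasPrecompactOrbit.tendsto_zero [CompleteSpace E] {T Q : E →L[ℂ] E} (hT : ‖T‖ ≤ 1)
    (hQ : ContinuousLinearMapWOT.ofCLM Q ∈ wotSemigroup T) {f : E} (hf : HasPrecompactOrbit T f)
    (hQf : Q f = 0) : Tendsto (fun n : ℕ => ‖(T ^ n) f‖) atTop (𝓝 0) := by
  obtain ⟨l, hl, h⟩ := mem_wotSemigroup_iff.1 hQ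
  have hcomp : IsCompact (closure (range fun n : ℕ => (T ^ n) f)) :=
    hf.closure.isCompact_of_isClosed isClosed_closure
  obtain ⟨y, -, hy⟩ := hcomp.ultrafilter_le_nhds ((Ultrafilter.of l).map fun n => (T ^ n) f)
    (le_principal_iff.2 (mem_map.2 (Eventually.of_forall fun n =>
      subset_closure (mem_range_self n))))
  have hy' : Tendsto (fun n => (T ^ n) f) (Ultrafilter.of l : Filter ℕ) (𝓝 y) := hy
  have hy0 : y = 0 := by
    refine eq_of_forall_dual_apply_eq fun φ => ?_
    rw [map_zero, ← map_zero φ, ← hQf]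
    exact tendsto_nhds_unique ((φ.continuous.tendsto y).comp hy')
      ((h f φ).mono_left (Ultrafilter.of_le l))
  rw [hy0] at hy'
  rw [Metric.tendsto_atTop]
  intro ε hε
  obtain ⟨N, hN⟩ := (Metric.tendsto_nhds.1 hy' ε hε).exists
  refine ⟨N, fun n hn => ?_⟩
  obtain ⟨k, rfl⟩ := Nat.exists_eq_add_of_le' hn
  rw [dist_zero_right] at hN
  rw [pow_add, mul_apply_eq_comp, dist_zero_right, norm_norm]
  exact (norm_pow_apply_le hT k _).trans_lt hN

lemma stableOnJdLG_of_hasPrecompactOrbit [CompleteSpace E] {T : E →L[ℂ] E} (hT : ‖T‖ ≤ 1)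
    (h : ∀ f, HasPrecompactOrbit T f) : StableOnJdLG T := by
  rintro V W ⟨-, -, -, Q, hQ, -, -, rfl⟩ f hf
  exact (h f).tendsto_zero hT hQ.1 hf

/-- Stability on the almost weakly stable part implies the splitting, as soon as the weak operator
closure of the powers contains an idempotent with range spanned by unimodular eigenvectors. -/
lemma splitsDiscreteStable_of_stableOnJdLG {T Q : E →L[ℂ] E}
    (hQ : ContinuousLinearMapWOT.ofCLM Q ∈ wotSemigroup T) (hQQ : Q * Q = Q)
    (hrange : ∀ f, Q f ∈ unimodularSpan T) (h : StableOnJdLG T) : SplitsDiscreteStable T := by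
  have hdec := isJdLGDecomposition_of_idempotent hQ hQQ hrange
  have heq := range_eq_unimodularSpan hQ hQQ hrange
  refine ⟨_, _, hdec.isCompl, ?_, ?_, hdec.mapsTo_aws, ?_, h _ _ hdec⟩
  · rw [heq]
    exact isClosed_unimodularSpan T
  · exact Q.isClosed_ker
  · rw [heq]
    exact hasDiscreteSpectrumOn_unimodularSpan T

end Banach

section NagyFoias

variable {H : Type*} [NormedAddCommGroup H] [InnerProductSpace ℂ H] [CompleteSpace H]

/-- For a contraction `R`, a vector keeps its norm if and only if it is fixed by `R* R`. -/
lemma adjoint_apply_apply_eq_iff {R : H →L[ℂ] H} (hR : ‖R‖ ≤ 1) (f : H) :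
    R.adjoint (R f) = f ↔ ‖R f‖ = ‖f‖ := by
  have h1 : RCLike.re ⟪R.adjoint (R f), f⟫_ℂ = ‖R f‖ ^ 2 := by
    rw [ContinuousLinearMap.adjoint_inner_left, inner_self_eq_norm_sq_to_K]
    simp [← Complex.ofReal_pow]
  constructor
  · intro h
    rw [h, inner_self_eq_norm_sq_to_K] at h1
    have h2 : ‖f‖ ^ 2 = ‖R f‖ ^ 2 := by simpa [← Complex.ofReal_pow] using h1
    exact ((pow_left_inj₀ (norm_nonneg _) (norm_nonneg _) two_ne_zero).1 h2).symm
  · intro h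
    have hle : ‖R.adjoint (R f)‖ ≤ ‖f‖ := by
      have : ‖R.adjoint‖ ≤ 1 := by rwa [LinearIsometryEquiv.norm_map]
      rw [← h]
      simpa using (R.adjoint).le_of_opNorm_le this (R f)
    have h3 : ‖R.adjoint (R f) - f‖ ^ 2 ≤ 0 := by
      rw [@norm_sub_sq ℂ, h1, h]
      nlinarith [norm_nonneg (R.adjoint (R f))]
    have h4 : ‖R.adjoint (R f) - f‖ = 0 :=
      pow_eq_zero_iff two_ne_zero |>.1 (le_antisymm h3 (sq_nonneg _))
    exact sub_eq_zero.1 (norm_eq_zero.1 h4)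

omit [CompleteSpace H] in
lemma norm_pow_le_one {T : H →L[ℂ] H} (hT : ‖T‖ ≤ 1) (n : ℕ) : ‖T ^ n‖ ≤ 1 :=
  ContinuousLinearMap.opNorm_le_bound _ zero_le_one fun f => by
    simpa using norm_pow_apply_le hT n f

lemma norm_adjoint_le_one {T : H →L[ℂ] H} (hT : ‖T‖ ≤ 1) : ‖T.adjoint‖ ≤ 1 := by
  rwa [LinearIsometryEquiv.norm_map]

/-- The vectors that keep their norm under all powers of a contraction. -/
noncomputable def isometricPart (T : H →L[ℂ] H) : Submodule ℂ H :=
  ⨅ n : ℕ, LinearMap.ker (((T ^ n).adjoint * T ^ n - 1 : H →L[ℂ] H) : H →ₗ[ℂ] H)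

lemma mem_isometricPart {T : H →L[ℂ] H} (hT : ‖T‖ ≤ 1) {f : H} :
    f ∈ isometricPart T ↔ ∀ n : ℕ, ‖(T ^ n) f‖ = ‖f‖ := by
  rw [isometricPart, Submodule.mem_iInf]
  refine forall_congr' fun n => ?_
  rw [← adjoint_apply_apply_eq_iff (norm_pow_le_one hT n)]
  exact sub_eq_zero

lemma isClosed_isometricPart (T : H →L[ℂ] H) : IsClosed (isometricPart T : Set H) := by
  rw [isometricPart, Submodule.coe_iInf]
  exact isClosed_iInter fun n => ContinuousLinearMap.isClosed_ker _

/-- The unitary part of a contraction. -/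
noncomputable def unitaryPart (T : H →L[ℂ] H) : Submodule ℂ H := isometricPart T ⊓ isometricPart T.adjoint

lemma mem_unitaryPart {T : H →L[ℂ] H} (hT : ‖T‖ ≤ 1) {f : H} : f ∈ unitaryPart T ↔
    (∀ n : ℕ, ‖(T ^ n) f‖ = ‖f‖) ∧ ∀ n : ℕ, ‖(T.adjoint ^ n) f‖ = ‖f‖ := by
  rw [unitaryPart, Submodule.mem_inf, mem_isometricPart hT,
    mem_isometricPart (norm_adjoint_le_one hT)]

lemma isClosed_unitaryPart (T : H →L[ℂ] H) : IsClosed (unitaryPart T : Set H) :=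
  (isClosed_isometricPart T).inter (isClosed_isometricPart T.adjoint)

lemma apply_mem_unitaryPart {T : H →L[ℂ] H} (hT : ‖T‖ ≤ 1) {f : H} (hf : f ∈ unitaryPart T) :
    T f ∈ unitaryPart T := by
  rw [mem_unitaryPart hT] at hf ⊢
  have h1 : ‖T f‖ = ‖f‖ := by simpa using hf.1 1
  refine ⟨fun n => ?_, fun n => ?_⟩
  · rw [← mul_apply_eq_comp, ← pow_succ, hf.1, h1]
  · cases n with
    | zero => simp
    | succ n =>
      rw [pow_succ, mul_apply_eq_comp, (adjoint_apply_apply_eq_iff hT f).2 h1, hf.2, h1]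

lemma unitaryPart_adjoint (T : H →L[ℂ] H) : unitaryPart T.adjoint = unitaryPart T := by
  rw [unitaryPart, unitaryPart, ContinuousLinearMap.adjoint_adjoint, inf_comm]

lemma adjoint_apply_mem_unitaryPart {T : H →L[ℂ] H} (hT : ‖T‖ ≤ 1) {f : H}
    (hf : f ∈ unitaryPart T) : T.adjoint f ∈ unitaryPart T := by
  rw [← unitaryPart_adjoint] at hf ⊢
  exact apply_mem_unitaryPart (norm_adjoint_le_one hT) hf

omit [CompleteSpace H] in
lemma coe_restrict_pow_apply {T : H →L[ℂ] H} {U : Submodule ℂ H} (h : MapsTo T U U) (n : ℕ)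
    (f : U) : (((T.restrict h) ^ n) f : H) = (T ^ n) f := by
  induction n with
  | zero => simp
  | succ n ih =>
    rw [pow_succ', pow_succ', mul_apply_eq_comp, mul_apply_eq_comp, ← ih]
    rfl

/-- A vector of an invariant subspace on which a contraction is unitary belongs to the unitary
part. -/
lemma mem_unitaryPart_of_isUnitaryOperator {T : H →L[ℂ] H} (hT : ‖T‖ ≤ 1) {W : Submodule ℂ H}
    (hiso : ∀ f ∈ W, ‖T f‖ = ‖f‖) (hsurj : ∀ f ∈ W, ∃ g ∈ W, T g = f) (hmaps : MapsTo T W W)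
    {f : H} (hf : f ∈ W) : f ∈ unitaryPart T := by
  rw [mem_unitaryPart hT]
  constructor
  · intro n
    have : (T ^ n) f ∈ W ∧ ‖(T ^ n) f‖ = ‖f‖ := by
      induction n with
      | zero => simpa using hf
      | succ n ih =>
        rw [pow_succ', mul_apply_eq_comp]
        exact ⟨hmaps ih.1, (hiso _ ih.1).trans ih.2⟩
    exact this.2
  · intro n
    have : (T.adjoint ^ n) f ∈ W ∧ ‖(T.adjoint ^ n) f‖ = ‖f‖ := by
      induction n with
      | zero => simpa using hf
      | succ n ih =>
        obtain ⟨g, hg, hg'⟩ := hsurj _ ih.1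
        rw [pow_succ', mul_apply_eq_comp, ← hg',
          (adjoint_apply_apply_eq_iff hT g).2 (hiso g hg)]
        exact ⟨hg, by rw [← hiso g hg, hg', ih.2]⟩
    exact this.2

lemma IsUnitaryOperator.norm_apply {H' : Type*} [NormedAddCommGroup H'] [InnerProductSpace ℂ H']
    {S : H' →L[ℂ] H'} (hS : IsUnitaryOperator S) (f : H') : ‖S f‖ = ‖f‖ := by
  simpa using hS.1.dist_eq f 0

/-- The Nagy–Foiaş decomposition of a contraction. -/
theorem isNFDecomposition_unitaryPart {T : H →L[ℂ] H} (hT : ‖T‖ ≤ 1) :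
    IsNFDecomposition T (unitaryPart T) (unitaryPart T)ᗮ := by
  have hcomplete : CompleteSpace (unitaryPart T) := (isClosed_unitaryPart T).completeSpace_coe
  have hmaps : MapsTo T (unitaryPart T) (unitaryPart T) := fun f hf => apply_mem_unitaryPart hT hf
  have hmaps' : MapsTo T (unitaryPart T)ᗮ (unitaryPart T)ᗮ := by
    intro f hf
    refine (Submodule.mem_orthogonal _ _).2 fun g hg => ?_
    rw [← ContinuousLinearMap.adjoint_inner_left]
    exact (Submodule.mem_orthogonal _ _).1 hf _ (adjoint_apply_mem_unitaryPart hT hg)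
  refine ⟨Submodule.isCompl_orthogonal _,
    Submodule.isOrtho_orthogonal_right _, ⟨isClosed_unitaryPart T, hmaps, hmaps'⟩,
    ⟨Submodule.isClosed_orthogonal _, hmaps', ?_⟩, ⟨?_, ?_⟩, ?_⟩
  · rwa [Submodule.orthogonal_orthogonal]
  · refine AddMonoidHomClass.isometry_of_norm _ fun f => ?_
    have := ((mem_unitaryPart hT).1 f.2).1 1
    rwa [pow_one] at this
  · intro f
    refine ⟨⟨T.adjoint f, adjoint_apply_mem_unitaryPart hT f.2⟩, Subtype.ext ?_⟩
    have h := (adjoint_apply_apply_eq_iff (norm_adjoint_le_one hT) (f : H)).2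
      (by simpa using ((mem_unitaryPart hT).1 f.2).2 1)
    rwa [ContinuousLinearMap.adjoint_adjoint] at h
  · intro W hW hWu
    rw [Submodule.eq_bot_iff]
    intro f hf
    have hmem : (f : H) ∈ unitaryPart T := by
      refine mem_unitaryPart_of_isUnitaryOperator hT
        (W := W.map (unitaryPart T)ᗮ.subtype) ?_ ?_ ?_ ⟨f, hf, rfl⟩
      · rintro _ ⟨g, hg, rfl⟩
        exact hWu.norm_apply ⟨g, hg⟩
      · rintro _ ⟨g, hg, rfl⟩
        obtain ⟨k, hk⟩ := hWu.2 ⟨g, hg⟩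
        exact ⟨k.1, ⟨k.1, k.2, rfl⟩, congrArg (fun z : W => ((z : (unitaryPart T)ᗮ) : H)) hk⟩
      · rintro _ ⟨g, hg, rfl⟩
        exact ⟨_, hW.mapsTo hg, rfl⟩
    have h0 : (f : H) ∈ unitaryPart T ⊓ (unitaryPart T)ᗮ := ⟨hmem, f.2⟩
    rw [Submodule.inf_orthogonal_eq_bot] at h0
    exact Subtype.ext h0

lemma splitsDiscreteStable_of_discreteStableOnNF {T : H →L[ℂ] H} (hT : ‖T‖ ≤ 1)
    (h : DiscreteStableOnNF T) : SplitsDiscreteStable T := by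
  have hdec := isNFDecomposition_unitaryPart hT
  exact ⟨_, _, hdec.isCompl, hdec.reduces_unitary.isClosed, hdec.reduces_cnu.isClosed,
    hdec.reduces_cnu.mapsTo, h _ _ hdec⟩

/-- The completely non-unitary part contains no unimodular eigenvector. -/
lemma IsNFDecomposition.eq_zero_of_apply_eq_smul {T : H →L[ℂ] H} (hT : ‖T‖ ≤ 1)
    {U C : Submodule ℂ H} (h : IsNFDecomposition T U C) {e : H} (he : e ∈ C) {c : ℂ}
    (hc : ‖c‖ = 1) (hTe : T e = c • e) : e = 0 := by
  have hc0 : c ≠ 0 := norm_ne_zero_iff.1 (by rw [hc]; exact one_ne_zero)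
  set S := T.restrict h.reduces_cnu.mapsTo
  set v : C := ⟨e, he⟩
  have hSv : S v = c • v := Subtype.ext hTe
  have hadj : T.adjoint e = starRingEnd ℂ c • e :=
    apply_eq_of_adjoint_apply_eq (norm_adjoint_le_one hT) hc
      (by rw [ContinuousLinearMap.adjoint_adjoint, hTe])
  have hred : Reduces S (Submodule.span ℂ {v}) := by
    refine ⟨Submodule.closed_of_finiteDimensional _, ?_, ?_⟩
    · intro w hw
      obtain ⟨a, rfl⟩ := Submodule.mem_span_singleton.1 hw
      refine Submodule.mem_span_singleton.2 ⟨a * c, ?_⟩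
      rw [map_smul, hSv, smul_smul]
    · intro w hw
      have hw' := Submodule.mem_orthogonal_singleton_iff_inner_right.1 hw
      refine Submodule.mem_orthogonal_singleton_iff_inner_right.2 ?_
      change ⟪e, T w⟫_ℂ = 0
      rw [← ContinuousLinearMap.adjoint_inner_left, hadj, inner_smul_left]
      rw [show ⟪e, (w : H)⟫_ℂ = 0 from hw', mul_zero]
  have hbot := h.completelyNonUnitary _ hred ⟨?_, ?_⟩
  · have : v ∈ (Submodule.span ℂ {v}) := Submodule.mem_span_singleton_self v
    rw [hbot] at this
    exact congrArg Subtype.val ((Submodule.mem_bot ℂ).1 this)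
  · refine AddMonoidHomClass.isometry_of_norm _ fun w => ?_
    obtain ⟨a, ha⟩ := Submodule.mem_span_singleton.1 w.2
    change ‖S w‖ = ‖(w : C)‖
    rw [← ha, map_smul, hSv, norm_smul, norm_smul, norm_smul, hc, one_mul]
  · intro w
    obtain ⟨a, ha⟩ := Submodule.mem_span_singleton.1 w.2
    refine ⟨⟨(a * c⁻¹) • v, Submodule.mem_span_singleton.2 ⟨_, rfl⟩⟩, Subtype.ext ?_⟩
    change S ((a * c⁻¹) • v) = w
    rw [map_smul, hSv, smul_smul, mul_assoc, inv_mul_cancel₀ hc0, mul_one, ha]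

lemma starProjection_mem_wotSemigroup {T : H →L[ℂ] H} (hT : ‖T‖ ≤ 1) :
    ContinuousLinearMapWOT.ofCLM (unimodularSpan T).starProjection ∈ wotSemigroup T := by
  obtain ⟨l, hl, h⟩ := exists_filter_tendsto_starProjection hT
  refine mem_wotSemigroup_iff.2 ⟨l, hl, fun f φ => ?_⟩
  obtain ⟨g, rfl⟩ := (InnerProductSpace.toDual ℂ H).surjective φ
  simp only [InnerProductSpace.toDual_apply_apply]
  have h1 := (Complex.continuous_conj.tendsto _).comp (h f g)
  rw [inner_conj_symm] at h1
  refine h1.congr fun n => ?_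
  simp only [Function.comp_apply, inner_conj_symm]

lemma discreteStableOnNF_of_hasPrecompactOrbit {T : H →L[ℂ] H} (hT : ‖T‖ ≤ 1)
    (h : ∀ f, HasPrecompactOrbit T f) : DiscreteStableOnNF T := by
  intro U C hUC
  have hQ := starProjection_mem_wotSemigroup hT
  set K := unimodularSpan T
  have hzero : ∀ f, K.starProjection f = 0 → Tendsto (fun n : ℕ => ‖(T ^ n) f‖) atTop (𝓝 0) :=
    fun f hf => (h f).tendsto_zero hT hQ hf
  have hKU : K ≤ U := by
    refine Submodule.topologicalClosure_minimal _ (Submodule.span_le.2 ?_)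
      hUC.reduces_unitary.isClosed
    rintro e ⟨c, hc, he⟩
    obtain ⟨u, hu, w, hw, rfl⟩ := Submodule.mem_sup.1
      (hUC.isCompl.sup_eq_top ▸ Submodule.mem_top : e ∈ U ⊔ C)
    have hw0 : T w - c • w = 0 := by
      have h1 : T w - c • w ∈ C := C.sub_mem (hUC.reduces_cnu.mapsTo hw) (C.smul_mem c hw)
      have h2 : T w - c • w ∈ U := by
        have : T w - c • w = c • u - T u := by
          rw [map_add, smul_add] at he
          rw [sub_eq_sub_iff_add_eq_add, add_comm (T w), he]
        rw [this]
        exact U.sub_mem (U.smul_mem c hu) (hUC.reduces_unitary.mapsTo hu)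
      exact (Submodule.disjoint_def.1 hUC.isCompl.disjoint) _ h2 h1
    rw [hUC.eq_zero_of_apply_eq_smul hT hw hc (sub_eq_zero.1 hw0), add_zero]
    exact hu
  have hUK : U ≤ K := by
    intro f hf
    have hQf : K.starProjection f ∈ K := K.starProjection_apply_mem f
    have h1 : f - K.starProjection f ∈ U := U.sub_mem hf (hKU hQf)
    have h2 := hzero (f - K.starProjection f) (by
      rw [map_sub, (Submodule.starProjection_eq_self_iff).2 hQf, sub_self])
    have h3 : ∀ n : ℕ, ‖(T ^ n) (f - K.starProjection f)‖ = ‖f - K.starProjection f‖ := by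
      intro n
      rw [← coe_restrict_pow_apply hUC.reduces_unitary.mapsTo n ⟨_, h1⟩]
      induction n with
      | zero => simp
      | succ n ih =>
        rw [pow_succ', mul_apply_eq_comp]
        exact (hUC.unitary.norm_apply _).trans ih
    simp only [h3] at h2
    have h4 := tendsto_nhds_unique h2 tendsto_const_nhds
    rw [sub_eq_zero.1 (norm_eq_zero.1 h4.symm)]
    exact hQf
  refine ⟨?_, fun f hf => hzero f ?_⟩
  · rw [le_antisymm hUK hKU]
    exact hasDiscreteSpectrumOn_unimodularSpan T
  · refine (Submodule.starProjection_apply_eq_zero_iff _).2 ?_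
    refine (Submodule.mem_orthogonal _ _).2 fun g hg => ?_
    exact Submodule.isOrtho_iff_inner_eq.1 hUC.isOrtho g (hKU hg) f hf

end NagyFoias

section DoublyStochastic

variable {X : Type*} [MeasurableSpace X] {μ : Measure X} [IsProbabilityMeasure μ]

lemma coeFn_finset_sum {ι : Type*} {p : ℝ≥0∞} (s : Finset ι) (f : ι → Lp ℂ p μ) :
    ((∑ i ∈ s, f i : Lp ℂ p μ) : X → ℂ) =ᵐ[μ] fun x => ∑ i ∈ s, f i x := by
  classical
  induction s using Finset.induction_on with
  | empty =>
    filter_upwards with x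
    simp
  | insert a s ha ih =>
    rw [Finset.sum_insert ha]
    filter_upwards [Lp.coeFn_add (f a) (∑ i ∈ s, f i), ih] with x h1 h2
    rw [h1, Pi.add_apply, h2, Finset.sum_insert ha]

variable (μ) in
/-- The class of a simple function in `L^p(μ)`, as a linear map. -/
noncomputable def simpleToLp (p : ℝ≥0∞) : SimpleFunc X ℂ →ₗ[ℂ] Lp ℂ p μ where
  toFun s := (s.memLp_of_isFiniteMeasure p μ).toLp s
  map_add' _ _ := rfl
  map_smul' _ _ := rfl

lemma coeFn_simpleToLp (p : ℝ≥0∞) (s : SimpleFunc X ℂ) : simpleToLp μ p s =ᵐ[μ] s :=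
  MemLp.coeFn_toLp (s.memLp_of_isFiniteMeasure p μ)

lemma denseRange_simpleToLp {p : ℝ≥0∞} [Fact (1 ≤ p)] (hp : p ≠ ∞) :
    DenseRange (simpleToLp μ p : SimpleFunc X ℂ → Lp ℂ p μ) := by
  refine (Lp.simpleFunc.denseRange (E := ℂ) (μ := μ) hp).mono ?_
  rintro _ ⟨f, rfl⟩
  refine ⟨Lp.simpleFunc.toSimpleFunc f, ?_⟩
  rw [← Lp.simpleFunc.toLp_toSimpleFunc f]
  exact Lp.ext ((coeFn_simpleToLp p _).trans (by
    rw [Lp.simpleFunc.toLp_toSimpleFunc]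
    exact Lp.simpleFunc.toSimpleFunc_eq_toFun f))

variable {p : ℝ≥0∞} [Fact (1 ≤ p)] {T : Lp ℂ p μ →L[ℂ] Lp ℂ p μ}

lemma IsDoublyStochastic.pow (hT : IsDoublyStochastic T) (n : ℕ) : IsDoublyStochastic (T ^ n) := by
  induction n with
  | zero => exact ⟨fun f hf => hf, rfl, fun f => rfl⟩
  | succ n ih =>
    rw [pow_succ']
    exact ⟨fun f hf => hT.positive _ (ih.positive f hf), by
      rw [mul_apply_eq_comp, ih.map_one, hT.map_one], fun f => by
      rw [mul_apply_eq_comp, hT.integral_map, ih.integral_map]⟩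

/-- The class of the indicator function of a measurable set. -/
noncomputable abbrev indicatorLp (μ : Measure X) [IsProbabilityMeasure μ] (p : ℝ≥0∞) {A : Set X}
    (hA : MeasurableSet A) : Lp ℂ p μ :=
  indicatorConstLp p hA (measure_ne_top μ A) (1 : ℂ)

lemma IsDoublyStochastic.indicator_nonneg (hT : IsDoublyStochastic T) {A : Set X}
    (hA : MeasurableSet A) : ∀ᵐ x ∂μ, 0 ≤ (T (indicatorLp μ p hA) x).re ∧
      (T (indicatorLp μ p hA) x).im = 0 := by
  refine hT.positive _ ?_
  filter_upwards [indicatorConstLp_coeFn (p := p) (hs := hA) (hμs := measure_ne_top μ A)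
    (c := (1 : ℂ))] with x hx
  rw [hx]
  by_cases h : x ∈ A <;> simp [h]

lemma IsDoublyStochastic.enorm_indicator (hT : IsDoublyStochastic T) {A : Set X}
    (hA : MeasurableSet A) : ∀ᵐ x ∂μ, (T (indicatorLp μ p hA) x) =
      (‖T (indicatorLp μ p hA) x‖ : ℂ) := by
  filter_upwards [hT.indicator_nonneg hA] with x hx
  set z := T (indicatorLp μ p hA) x
  have hz : z = (z.re : ℂ) := Complex.ext (by simp) (by simp [hx.2])
  rw [hz, Complex.norm_real, Real.norm_eq_abs, abs_of_nonneg hx.1]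

lemma integrable_coeFn (f : Lp ℂ p μ) : Integrable f μ :=
  (Lp.memLp f).integrable Fact.out

lemma IsDoublyStochastic.lintegral_enorm_indicator (hT : IsDoublyStochastic T) {A : Set X}
    (hA : MeasurableSet A) : ∫⁻ x, ‖T (indicatorLp μ p hA) x‖ₑ ∂μ = μ A := by
  have hint := integrable_coeFn (T (indicatorLp μ p hA))
  have h1 : (∫ x, ‖T (indicatorLp μ p hA) x‖ ∂μ : ℂ) = (μ.real A : ℂ) := by
    have h2 : ∫ x, T (indicatorLp μ p hA) x ∂μ = (μ.real A : ℂ) := by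
      rw [hT.integral_map, integral_congr_ae indicatorConstLp_coeFn, integral_indicator hA]
      simp
    rw [← h2, integral_congr_ae (hT.enorm_indicator hA)]
  have h3 : ∫ x, ‖T (indicatorLp μ p hA) x‖ ∂μ = μ.real A := by
    rw [integral_complex_ofReal] at h1
    exact_mod_cast h1
  rw [← ofReal_integral_norm_eq_lintegral_enorm hint, h3, ofReal_measureReal]

lemma simpleToLp_eq_sum (p : ℝ≥0∞) (s : SimpleFunc X ℂ) :
    simpleToLp μ p s = ∑ c ∈ s.range, c • indicatorLp μ p (s.measurableSet_fiber c) := by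
  refine Lp.ext ?_
  have hind : ∀ c ∈ s.range, ∀ᵐ x ∂μ, (c • indicatorLp μ p (s.measurableSet_fiber c)) x =
      c * (s ⁻¹' {c}).indicator (fun _ => (1 : ℂ)) x := by
    intro c _
    filter_upwards [Lp.coeFn_smul c (indicatorLp μ p (s.measurableSet_fiber c)),
      indicatorConstLp_coeFn (p := p) (hs := s.measurableSet_fiber c)
        (hμs := measure_ne_top μ _) (c := (1 : ℂ))] with x h1 h2
    rw [h1, Pi.smul_apply, h2, smul_eq_mul]
  filter_upwards [coeFn_simpleToLp p s, coeFn_finset_sum s.range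
    (fun c => c • indicatorLp μ p (s.measurableSet_fiber c)),
    (Finset.eventually_all s.range).2 hind] with x h1 h2 h3
  rw [h1, h2, Finset.sum_congr rfl fun c hc => h3 c hc,
    Finset.sum_eq_single (s x) (fun c _ hc => ?_) (fun h => absurd (s.mem_range_self x) h)]
  · simp
  · rw [Set.indicator_of_notMem (s := s ⁻¹' {c}) (fun h => hc (mem_singleton_iff.1 h).symm), mul_zero]

lemma sum_indicatorLp_fiber (p : ℝ≥0∞) (s : SimpleFunc X ℂ) :
    ∑ c ∈ s.range, indicatorLp μ p (s.measurableSet_fiber c) = Lp.const p μ (1 : ℂ) := by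
  refine Lp.ext ?_
  have hind : ∀ c ∈ s.range, ∀ᵐ x ∂μ, (indicatorLp μ p (s.measurableSet_fiber c)) x =
      (s ⁻¹' {c}).indicator (fun _ => (1 : ℂ)) x := by
    intro c _
    exact indicatorConstLp_coeFn
  filter_upwards [Lp.coeFn_const p μ (1 : ℂ), coeFn_finset_sum s.range
    (fun c => indicatorLp μ p (s.measurableSet_fiber c)),
    (Finset.eventually_all s.range).2 hind] with x h1 h2 h3
  rw [h1, h2, Finset.sum_congr rfl fun c hc => h3 c hc,
    Finset.sum_eq_single (s x) (fun c _ hc => ?_) (fun h => absurd (s.mem_range_self x) h)]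
  · simp
  · rw [Set.indicator_of_notMem (s := s ⁻¹' {c}) (fun h => hc (mem_singleton_iff.1 h).symm)]

/-- The image of a simple function is pointwise an average of its values. -/
lemma IsDoublyStochastic.apply_simpleToLp (hT : IsDoublyStochastic T) (s : SimpleFunc X ℂ) :
    ∀ᵐ x ∂μ, (∑ c ∈ s.range, ‖T (indicatorLp μ p (s.measurableSet_fiber c)) x‖ₑ = 1) ∧
      ‖T (simpleToLp μ p s) x‖ₑ ≤
        ∑ c ∈ s.range, ‖T (indicatorLp μ p (s.measurableSet_fiber c)) x‖ₑ * ‖c‖ₑ := by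
  have hsum : T (simpleToLp μ p s) =
      ∑ c ∈ s.range, c • T (indicatorLp μ p (s.measurableSet_fiber c)) := by
    rw [simpleToLp_eq_sum, map_sum]
    simp_rw [map_smul]
  have hone : ∑ c ∈ s.range, T (indicatorLp μ p (s.measurableSet_fiber c)) =
      Lp.const p μ (1 : ℂ) := by
    rw [← map_sum, sum_indicatorLp_fiber, hT.map_one]
  have h3 := (Finset.eventually_all s.range).2 fun c _ =>
    Lp.coeFn_smul c (T (indicatorLp μ p (s.measurableSet_fiber c)))
  have h4 := (Finset.eventually_all s.range).2 fun c _ =>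
    hT.enorm_indicator (s.measurableSet_fiber c)
  filter_upwards [coeFn_finset_sum s.range
      (fun c => c • T (indicatorLp μ p (s.measurableSet_fiber c))),
    coeFn_finset_sum s.range (fun c => T (indicatorLp μ p (s.measurableSet_fiber c))),
    h3, h4, Lp.coeFn_const p μ (1 : ℂ)] with x h1 h2 h3 h4 h5
  constructor
  · rw [hone, h5, Finset.sum_congr rfl h4] at h2
    have h6 : ∑ c ∈ s.range, ‖T (indicatorLp μ p (s.measurableSet_fiber c)) x‖ = 1 := by
      have h7 : (1 : ℂ) = ∑ c ∈ s.range,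
        ((‖T (indicatorLp μ p (s.measurableSet_fiber c)) x‖ : ℝ) : ℂ) := h2
      exact_mod_cast h7.symm
    rw [← ENNReal.ofReal_one, ← h6, ENNReal.ofReal_sum_of_nonneg fun _ _ => norm_nonneg _]
    simp_rw [ofReal_norm]
  · rw [hsum, h1]
    refine (enorm_sum_le _ _).trans (Finset.sum_le_sum fun c hc => ?_)
    rw [h3 c hc, Pi.smul_apply, smul_eq_mul, enorm_mul, mul_comm]

lemma IsDoublyStochastic.norm_apply_simpleToLp_le (hT : IsDoublyStochastic T)
    {s : SimpleFunc X ℂ} {C : ℝ} (hs : ∀ x, ‖s x‖ ≤ C) :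
    ∀ᵐ x ∂μ, ‖T (simpleToLp μ p s) x‖ ≤ C := by
  filter_upwards [hT.apply_simpleToLp s] with x ⟨h1, h2⟩
  have hC : 0 ≤ C := (norm_nonneg _).trans (hs x)
  have h3 : ‖T (simpleToLp μ p s) x‖ₑ ≤ ENNReal.ofReal C := by
    refine h2.trans ?_
    calc _ ≤ ∑ c ∈ s.range, ‖T (indicatorLp μ p (s.measurableSet_fiber c)) x‖ₑ *
          ENNReal.ofReal C := by
          refine Finset.sum_le_sum fun c hc => ?_
          gcongr
          obtain ⟨y, rfl⟩ := SimpleFunc.mem_range.1 hc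
          rw [← ofReal_norm]
          exact ENNReal.ofReal_le_ofReal (hs y)
      _ = ENNReal.ofReal C := by rw [← Finset.sum_mul, h1, one_mul]
  rw [← ofReal_norm] at h3
  exact (ENNReal.ofReal_le_ofReal_iff hC).1 h3

/-- A doubly stochastic operator contracts every `L^q` norm on simple functions. -/
lemma IsDoublyStochastic.eLpNorm_apply_simpleToLp_le (hT : IsDoublyStochastic T)
    (s : SimpleFunc X ℂ) {q : ℝ≥0∞} (hq1 : 1 ≤ q) (hq : q ≠ ∞) :
    eLpNorm (T (simpleToLp μ p s)) q μ ≤ eLpNorm s q μ := by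
  have hq0 : q ≠ 0 := (zero_lt_one.trans_le hq1).ne'
  have hr : 1 ≤ q.toReal := by
    rw [← ENNReal.toReal_one]
    exact ENNReal.toReal_mono hq hq1
  rw [eLpNorm_eq_lintegral_rpow_enorm_toReal hq0 hq, eLpNorm_eq_lintegral_rpow_enorm_toReal hq0 hq]
  refine ENNReal.rpow_le_rpow ?_ (by positivity)
  have hmeas : ∀ c, AEMeasurable (fun x =>
      ‖T (indicatorLp μ p (s.measurableSet_fiber c)) x‖ₑ) μ := fun c =>
    (Lp.stronglyMeasurable _).enorm.aemeasurable
  calc ∫⁻ x, ‖T (simpleToLp μ p s) x‖ₑ ^ q.toReal ∂μ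
      ≤ ∫⁻ x, ∑ c ∈ s.range, ‖T (indicatorLp μ p (s.measurableSet_fiber c)) x‖ₑ *
          ‖c‖ₑ ^ q.toReal ∂μ := by
        refine lintegral_mono_ae ?_
        filter_upwards [hT.apply_simpleToLp s] with x ⟨h1, h2⟩
        exact (ENNReal.rpow_le_rpow h2 (by positivity)).trans
          (ENNReal.rpow_arith_mean_le_arith_mean_rpow _ _ _ h1 hr)
    _ = ∑ c ∈ s.range, ‖c‖ₑ ^ q.toReal * μ (s ⁻¹' {c}) := by
        rw [lintegral_finsetSum' _ fun c _ => (hmeas c).mul_const _]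
        refine Finset.sum_congr rfl fun c _ => ?_
        rw [lintegral_mul_const'' _ (hmeas c), hT.lintegral_enorm_indicator, mul_comm]
    _ = ∫⁻ x, ‖s x‖ₑ ^ q.toReal ∂μ := by
        have := SimpleFunc.map_lintegral (fun c : ℂ => ‖c‖ₑ ^ q.toReal) s (μ := μ)
        rw [← this, ← SimpleFunc.lintegral_eq_lintegral]
        rfl

omit [Fact (1 ≤ p)] in
lemma norm_simpleToLp (s : SimpleFunc X ℂ) : ‖simpleToLp μ p s‖ = (eLpNorm s p μ).toReal :=
  Lp.norm_toLp _ (s.memLp_of_isFiniteMeasure p μ)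

lemma IsDoublyStochastic.norm_le_one (hT : IsDoublyStochastic T) (hp : p ≠ ∞) : ‖T‖ ≤ 1 := by
  refine ContinuousLinearMap.opNorm_le_bound _ zero_le_one fun f => ?_
  refine (denseRange_simpleToLp hp).induction_on f (isClosed_le (by fun_prop) (by fun_prop))
    fun s => ?_
  rw [one_mul, norm_simpleToLp, Lp.norm_def]
  exact ENNReal.toReal_mono (s.memLp_of_isFiniteMeasure p μ).2.ne
    (hT.eLpNorm_apply_simpleToLp_le s Fact.out hp)

end DoublyStochastic

section Transfer

variable {X : Type*} [MeasurableSpace X] {μ : Measure X} [IsProbabilityMeasure μ]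

omit [IsProbabilityMeasure μ] in
lemma ae_eq_of_tendsto_Lp {p q : ℝ≥0∞} [Fact (1 ≤ p)] [Fact (1 ≤ q)] {u : ℕ → Lp ℂ p μ}
    {v : ℕ → Lp ℂ q μ} {a : Lp ℂ p μ} {b : Lp ℂ q μ} (hu : Tendsto u atTop (𝓝 a))
    (hv : Tendsto v atTop (𝓝 b)) (huv : ∀ n, u n =ᵐ[μ] v n) : a =ᵐ[μ] b := by
  have h1 := tendstoInMeasure_of_tendsto_Lp hu
  have h2 := tendstoInMeasure_of_tendsto_Lp hv
  exact tendstoInMeasure_ae_unique h1 (h2.congr (fun n => (huv n).symm) EventuallyEq.rfl)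

/-- Every class in `L^p` is a limit of simple functions, simultaneously in all the other spaces
`L^q` to which it belongs. -/
lemma exists_simpleFunc_tendsto {p q : ℝ≥0∞} [Fact (1 ≤ p)] [Fact (1 ≤ q)] (hp : p ≠ ∞)
    (hq : q ≠ ∞) {u : Lp ℂ p μ} {v : Lp ℂ q μ} (huv : u =ᵐ[μ] v) :
    ∃ s : ℕ → SimpleFunc X ℂ, Tendsto (fun n => simpleToLp μ p (s n)) atTop (𝓝 u) ∧
      Tendsto (fun n => simpleToLp μ q (s n)) atTop (𝓝 v) := by
  have hmeas : Measurable u := (Lp.stronglyMeasurable u).measurable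
  have hu : MemLp u q μ := (memLp_congr_ae huv).2 (Lp.memLp v)
  refine ⟨fun n => SimpleFunc.approxOn u hmeas (range u ∪ {0}) 0 (by simp) n, ?_, ?_⟩
  · have h := SimpleFunc.tendsto_approxOn_range_Lp hp hmeas (Lp.memLp u)
    rw [Lp.toLp_coeFn] at h
    exact h
  · have h := SimpleFunc.tendsto_approxOn_range_Lp hq hmeas hu
    rw [show hu.toLp u = v from Lp.ext (hu.coeFn_toLp.trans huv)] at h
    exact h

/-- Operators on `L^p` and on `L^q` that coincide on the common part of the two spaces. -/
def Agree {p q : ℝ≥0∞} [Fact (1 ≤ p)] [Fact (1 ≤ q)] (T : Lp ℂ p μ →L[ℂ] Lp ℂ p μ)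
    (S : Lp ℂ q μ →L[ℂ] Lp ℂ q μ) : Prop :=
  ∀ (u : Lp ℂ p μ) (v : Lp ℂ q μ), u =ᵐ[μ] v → T u =ᵐ[μ] S v

omit [IsProbabilityMeasure μ] in
lemma Agree.pow {p q : ℝ≥0∞} [Fact (1 ≤ p)] [Fact (1 ≤ q)] {T : Lp ℂ p μ →L[ℂ] Lp ℂ p μ}
    {S : Lp ℂ q μ →L[ℂ] Lp ℂ q μ} (h : Agree T S) (n : ℕ) : Agree (T ^ n) (S ^ n) := by
  induction n with
  | zero => exact fun u v huv => huv
  | succ n ih =>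
    intro u v huv
    rw [pow_succ', pow_succ', mul_apply_eq_comp, mul_apply_eq_comp]
    exact h _ _ (ih u v huv)

lemma agree_of_simple {p q : ℝ≥0∞} [Fact (1 ≤ p)] [Fact (1 ≤ q)] (hp : p ≠ ∞) (hq : q ≠ ∞)
    {T : Lp ℂ p μ →L[ℂ] Lp ℂ p μ} {S : Lp ℂ q μ →L[ℂ] Lp ℂ q μ}
    (h : ∀ s : SimpleFunc X ℂ, T (simpleToLp μ p s) =ᵐ[μ] S (simpleToLp μ q s)) : Agree T S := by
  intro u v huv
  obtain ⟨s, hs, hs'⟩ := exists_simpleFunc_tendsto hp hq huv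
  exact ae_eq_of_tendsto_Lp ((T.continuous.tendsto u).comp hs) ((S.continuous.tendsto v).comp hs')
    fun n => h (s n)

omit [IsProbabilityMeasure μ] in
/-- The linear map sending a simple function to the class of its image in another space `L^q`. -/
lemma exists_linearMap_toLp {p q : ℝ≥0∞} (T : SimpleFunc X ℂ →ₗ[ℂ] Lp ℂ p μ)
    (hmem : ∀ s, MemLp (T s) q μ) : ∃ f : SimpleFunc X ℂ →ₗ[ℂ] Lp ℂ q μ, ∀ s, f s =ᵐ[μ] T s := by
  refine ⟨{ toFun := fun s => (hmem s).toLp (T s)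
            map_add' := fun s t => ?_
            map_smul' := fun c s => ?_ }, fun s => (hmem s).coeFn_toLp⟩
  · rw [← MemLp.toLp_add]
    refine MemLp.toLp_congr _ _ ?_
    rw [map_add]
    exact Lp.coeFn_add _ _
  · rw [RingHom.id_apply, ← MemLp.toLp_const_smul]
    refine MemLp.toLp_congr _ _ ?_
    rw [map_smul]
    exact Lp.coeFn_smul _ _

/-- Extension of a linear map that is bounded with respect to a dense linear map. -/
lemma exists_extension_of_denseRange {D E F : Type*} [AddCommGroup D] [Module ℂ D]
    [NormedAddCommGroup E] [NormedSpace ℂ E] [NormedAddCommGroup F] [NormedSpace ℂ F]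
    [CompleteSpace F] (e : D →ₗ[ℂ] E) (he : DenseRange e) (f : D →ₗ[ℂ] F)
    (hf : ∀ d, ‖f d‖ ≤ ‖e d‖) : ∃ S : E →L[ℂ] F, ‖S‖ ≤ 1 ∧ ∀ d, S (e d) = f d := by
  have hbd : ∀ d, ‖f d‖ ≤ 1 * ‖e d‖ := fun d => by rw [one_mul]; exact hf d
  exact ⟨f.extendOfNorm e, LinearMap.opNorm_extendOfNorm_le he zero_le_one hbd,
    LinearMap.extendOfNorm_eq he ⟨1, hbd⟩⟩

/-- An operator on `L^p` that contracts the `L^q` norm of simple functions extends to `L^q`. -/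
lemma exists_agree {p q : ℝ≥0∞} [Fact (1 ≤ p)] [Fact (1 ≤ q)] (hp : p ≠ ∞) (hq : q ≠ ∞)
    (T : Lp ℂ p μ →L[ℂ] Lp ℂ p μ)
    (h : ∀ s : SimpleFunc X ℂ, eLpNorm (T (simpleToLp μ p s)) q μ ≤ eLpNorm s q μ) :
    ∃ S : Lp ℂ q μ →L[ℂ] Lp ℂ q μ, ‖S‖ ≤ 1 ∧ Agree T S := by
  obtain ⟨f, hf⟩ := exists_linearMap_toLp (q := q) (T.toLinearMap ∘ₗ simpleToLp μ p) fun s =>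
    ⟨Lp.aestronglyMeasurable _, (h s).trans_lt (s.memLp_of_isFiniteMeasure q μ).2⟩
  obtain ⟨S, hS, hS'⟩ := exists_extension_of_denseRange (simpleToLp μ q)
    (denseRange_simpleToLp hq) f fun s => by
      rw [norm_simpleToLp, Lp.norm_def, eLpNorm_congr_ae (hf s)]
      exact ENNReal.toReal_mono (s.memLp_of_isFiniteMeasure q μ).2.ne (h s)
  refine ⟨S, hS, agree_of_simple hp hq fun s => ?_⟩
  rw [hS']
  exact (hf s).symm

omit [IsProbabilityMeasure μ] in
/-- On uniformly bounded functions smallness in `L^1` implies smallness in `L^p`. -/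
lemma exists_eLpNorm_le_of_bound {p : ℝ≥0∞} (hp1 : 1 ≤ p) (hp : p ≠ ∞) {C η : ℝ} (hC : 0 < C)
    (hη : 0 < η) : ∃ δ : ℝ, 0 < δ ∧ ∀ f : X → ℂ, (∀ᵐ x ∂μ, ‖f x‖ ≤ C) →
      eLpNorm f 1 μ ≤ ENNReal.ofReal δ → eLpNorm f p μ ≤ ENNReal.ofReal η := by
  have hp0 : p ≠ 0 := (zero_lt_one.trans_le hp1).ne'
  have hr : 1 ≤ p.toReal := by
    rw [← ENNReal.toReal_one]
    exact ENNReal.toReal_mono hp hp1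
  set r := p.toReal
  refine ⟨η ^ r / C ^ (r - 1), by positivity, fun f hf h1 => ?_⟩
  rw [eLpNorm_eq_lintegral_rpow_enorm_toReal hp0 hp, one_div, ENNReal.rpow_inv_le_iff
    (by positivity), ENNReal.ofReal_rpow_of_pos hη]
  rw [eLpNorm_one_eq_lintegral_enorm] at h1
  calc ∫⁻ x, ‖f x‖ₑ ^ r ∂μ ≤ ∫⁻ x, ENNReal.ofReal (C ^ (r - 1)) * ‖f x‖ₑ ∂μ := by
        refine lintegral_mono_ae ?_
        filter_upwards [hf] with x hx
        have h2 : ‖f x‖ ^ r ≤ C ^ (r - 1) * ‖f x‖ := by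
          rcases (norm_nonneg (f x)).eq_or_lt with h0 | h0
          · rw [← h0, Real.zero_rpow (by positivity), mul_zero]
          · calc ‖f x‖ ^ r = ‖f x‖ ^ (r - 1) * ‖f x‖ := by
                  rw [Real.rpow_sub_one h0.ne', div_mul_cancel₀ _ h0.ne']
              _ ≤ C ^ (r - 1) * ‖f x‖ := by gcongr
        rw [← ofReal_norm, ENNReal.ofReal_rpow_of_nonneg (norm_nonneg _) (by positivity),
          ← ENNReal.ofReal_mul (by positivity)]
        exact ENNReal.ofReal_le_ofReal h2
    _ = ENNReal.ofReal (C ^ (r - 1)) * ∫⁻ x, ‖f x‖ₑ ∂μ :=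
        lintegral_const_mul' _ _ ENNReal.ofReal_ne_top
    _ ≤ ENNReal.ofReal (C ^ (r - 1)) * ENNReal.ofReal (η ^ r / C ^ (r - 1)) := by gcongr
    _ = ENNReal.ofReal (η ^ r) := by
        rw [← ENNReal.ofReal_mul (by positivity), mul_div_cancel₀ _ (by positivity)]

lemma exists_norm_le_of_bound {p : ℝ≥0∞} [Fact (1 ≤ p)] (hp : p ≠ ∞) {C η : ℝ} (hC : 0 < C)
    (hη : 0 < η) : ∃ δ : ℝ, 0 < δ ∧ ∀ (u : Lp ℂ p μ) (v : Lp ℂ 2 μ), u =ᵐ[μ] v →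
      (∀ᵐ x ∂μ, ‖u x‖ ≤ C) → ‖v‖ ≤ δ → ‖u‖ ≤ η := by
  obtain ⟨δ, hδ, h⟩ := exists_eLpNorm_le_of_bound (μ := μ) (Fact.out : 1 ≤ p) hp hC hη
  refine ⟨δ, hδ, fun u v huv hu hv => ?_⟩
  have h1 : eLpNorm u 1 μ ≤ ENNReal.ofReal δ := by
    rw [eLpNorm_congr_ae huv]
    refine (eLpNorm_le_eLpNorm_of_exponent_le one_le_two (Lp.aestronglyMeasurable v)).trans ?_
    rw [← ENNReal.ofReal_toReal (Lp.eLpNorm_ne_top v), ← Lp.norm_def]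
    exact ENNReal.ofReal_le_ofReal hv
  have h2 := h u hu h1
  rw [Lp.norm_def]
  exact ENNReal.toReal_le_of_le_ofReal hη.le h2

/-- On uniformly bounded functions, functionals on `L^p` are uniformly approximated by functionals
on `L^2`. -/
lemma exists_dual_approx {p : ℝ≥0∞} [Fact (1 ≤ p)] (hp : p ≠ ∞) (φ : StrongDual ℂ (Lp ℂ p μ))
    {C ε : ℝ} (hC : 0 < C) (hε : 0 < ε) : ∃ g : StrongDual ℂ (Lp ℂ 2 μ),
      ∀ (u : Lp ℂ p μ) (v : Lp ℂ 2 μ), u =ᵐ[μ] v → (∀ᵐ x ∂μ, ‖u x‖ ≤ C) → ‖φ u - g v‖ ≤ ε := by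
  obtain ⟨δ, hδ, h⟩ := exists_norm_le_of_bound (μ := μ) hp hC
    (by positivity : 0 < ε / (‖φ‖ + 1))
  have hmem : ∀ (q : ℝ≥0∞) (u : Lp ℂ ∞ μ), MemLp u q μ := fun q u =>
    (Lp.memLp u).mono_exponent le_top
  obtain ⟨i, hi⟩ : ∃ i : Lp ℂ ∞ μ →ₗ[ℂ] Lp ℂ p μ, ∀ u, i u = (hmem p u).toLp u :=
    ⟨{ toFun := fun u => (hmem p u).toLp u
       map_add' := fun u v => by
        rw [← MemLp.toLp_add]
        exact MemLp.toLp_congr _ _ (Lp.coeFn_add _ _)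
       map_smul' := fun c u => by
        rw [RingHom.id_apply, ← MemLp.toLp_const_smul]
        exact MemLp.toLp_congr _ _ (Lp.coeFn_smul _ _) }, fun u => rfl⟩
  obtain ⟨k, hk⟩ : ∃ k : Lp ℂ ∞ μ →ₗ[ℂ] Lp ℂ 2 μ, ∀ u, k u = (hmem 2 u).toLp u :=
    ⟨{ toFun := fun u => (hmem 2 u).toLp u
       map_add' := fun u v => by
        rw [← MemLp.toLp_add]
        exact MemLp.toLp_congr _ _ (Lp.coeFn_add _ _)
       map_smul' := fun c u => by
        rw [RingHom.id_apply, ← MemLp.toLp_const_smul]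
        exact MemLp.toLp_congr _ _ (Lp.coeFn_smul _ _) }, fun u => rfl⟩
  have hik : ∀ u, i u =ᵐ[μ] k u := fun u => by
    rw [hi, hk]
    exact (hmem p u).coeFn_toLp.trans (hmem 2 u).coeFn_toLp.symm
  have hinf : ∀ u : Lp ℂ ∞ μ, ∀ᵐ x ∂μ, ‖i u x‖ ≤ ‖u‖ := fun u => by
    rw [hi]
    filter_upwards [(hmem p u).coeFn_toLp, ae_le_eLpNormEssSup (f := u) (μ := μ)] with x h1 h2
    rw [h1, Lp.norm_def, eLpNorm_exponent_top, ← toReal_enorm]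
    refine ENNReal.toReal_mono ?_ h2
    rw [← eLpNorm_exponent_top]
    exact Lp.eLpNorm_ne_top u
  obtain ⟨j, hjdef⟩ : ∃ j : Lp ℂ ∞ μ →ₗ[ℂ] Lp ℂ ∞ μ × Lp ℂ 2 μ,
      ∀ u, j u = (((C⁻¹ : ℝ) : ℂ) • u, ((δ⁻¹ : ℝ) : ℂ) • k u) :=
    ⟨LinearMap.prod (((C⁻¹ : ℝ) : ℂ) • LinearMap.id) (((δ⁻¹ : ℝ) : ℂ) • k), fun u => rfl⟩
  have hj : ∀ u, ‖j u‖ = max (C⁻¹ * ‖u‖) (δ⁻¹ * ‖k u‖) := fun u => by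
    rw [hjdef, Prod.norm_def, norm_smul, norm_smul, Complex.norm_real, Complex.norm_real,
      Real.norm_eq_abs, Real.norm_eq_abs, abs_of_pos (inv_pos.2 hC), abs_of_pos (inv_pos.2 hδ)]
  have hbd : ∀ u, ‖(φ.toLinearMap ∘ₗ i) u‖ ≤ ε * ‖j u‖ := by
    intro u
    rcases eq_or_ne u 0 with rfl | hu
    · simp
    have ht : 0 < ‖j u‖ := by
      rw [hj]
      exact lt_max_of_lt_left (mul_pos (inv_pos.2 hC) (norm_pos_iff.2 hu))
    set t := ‖j u‖
    set w : Lp ℂ ∞ μ := ((t⁻¹ : ℝ) : ℂ) • u with hw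
    have hnw : ‖w‖ ≤ C := by
      rw [hw, norm_smul, Complex.norm_real, Real.norm_eq_abs, abs_of_pos (inv_pos.2 ht),
        inv_mul_le_iff₀ ht, mul_comm, ← inv_mul_le_iff₀ hC]
      exact (le_max_left _ _).trans_eq (hj u).symm
    have hkw : ‖k w‖ ≤ δ := by
      rw [hw, map_smul, norm_smul, Complex.norm_real, Real.norm_eq_abs, abs_of_pos (inv_pos.2 ht),
        inv_mul_le_iff₀ ht, mul_comm, ← inv_mul_le_iff₀ hδ]
      exact (le_max_right _ _).trans_eq (hj u).symm
    have h1 := h (i w) (k w) (hik w) ((hinf w).mono fun x hx => hx.trans hnw) hkw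
    have h2 : ‖φ (i w)‖ ≤ ε := by
      refine (φ.le_opNorm _).trans ?_
      calc ‖φ‖ * ‖i w‖ ≤ (‖φ‖ + 1) * (ε / (‖φ‖ + 1)) := by gcongr; linarith
        _ = ε := mul_div_cancel₀ _ (by positivity)
    rw [hw, map_smul, map_smul, norm_smul, Complex.norm_real, Real.norm_eq_abs,
      abs_of_pos (inv_pos.2 ht), inv_mul_le_iff₀ ht, mul_comm] at h2
    exact h2
  obtain ⟨Ψ, hΨ, hΨn⟩ := exists_extension_norm_eq (LinearMap.range j)
    ((φ.toLinearMap ∘ₗ i).compLeftInverse j)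
  have hΨj : ∀ u, Ψ (j u) = φ (i u) := fun u => by
    have h1 := hΨ ⟨j u, u, rfl⟩
    rw [LinearMap.compLeftInverse_apply_of_bdd _ _ ⟨ε, hbd⟩ u (j u) rfl] at h1
    exact h1
  have hΨε : ‖Ψ‖ ≤ ε := by
    rw [hΨn]
    refine ContinuousLinearMap.opNorm_le_bound _ hε.le ?_
    rintro ⟨_, u, rfl⟩
    rw [LinearMap.compLeftInverse_apply_of_bdd _ _ ⟨ε, hbd⟩ u (j u) rfl]
    exact hbd u
  refine ⟨((δ⁻¹ : ℝ) : ℂ) • (Ψ ∘L ContinuousLinearMap.inr ℂ _ _), fun u v huv hu => ?_⟩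
  have hmu : MemLp u ∞ μ := memLp_top_of_bound (Lp.aestronglyMeasurable u) C hu
  set w : Lp ℂ ∞ μ := hmu.toLp u
  have hiw : i w = u := Lp.ext (by
    rw [hi]
    exact (hmem p w).coeFn_toLp.trans hmu.coeFn_toLp)
  have hkw : k w = v := Lp.ext (by
    rw [hk]
    exact (hmem 2 w).coeFn_toLp.trans (hmu.coeFn_toLp.trans huv))
  have hnw : ‖w‖ ≤ C := by
    rw [Lp.norm_toLp, eLpNorm_exponent_top]
    refine ENNReal.toReal_le_of_le_ofReal hC.le (eLpNormEssSup_le_of_ae_bound hu)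
  have hdec : φ u - (((δ⁻¹ : ℝ) : ℂ) • (Ψ ∘L ContinuousLinearMap.inr ℂ _ _)) v =
      Ψ (((C⁻¹ : ℝ) : ℂ) • w, 0) := by
    rw [← hiw, ← hΨj, ← hkw, smul_apply, ContinuousLinearMap.comp_apply,
      ContinuousLinearMap.inr_apply, ← map_smul, ← map_sub]
    simp [hjdef]
  rw [hdec]
  refine (Ψ.le_of_opNorm_le hΨε _).trans (mul_le_of_le_one_right hε.le ?_)
  rw [Prod.norm_def, norm_zero, max_eq_left (norm_nonneg _), norm_smul, Complex.norm_real,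
    Real.norm_eq_abs, abs_of_pos (inv_pos.2 hC), inv_mul_le_iff₀ hC, mul_one]
  exact hnw

end Transfer

section TrigPoly

/-- Trigonometric polynomials on `ℕ`: the linear span of the sequences `n ↦ cⁿ` with `|c| = 1`. -/
def trigPoly : Submodule ℂ (ℕ → ℂ) :=
  Submodule.span ℂ {a | ∃ c : ℂ, ‖c‖ = 1 ∧ a = fun n => c ^ n}

lemma conj_mem_trigPoly {t : ℕ → ℂ} (ht : t ∈ trigPoly) :
    (fun n => starRingEnd ℂ (t n)) ∈ trigPoly := by
  induction ht using Submodule.span_induction with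
  | mem a ha =>
    obtain ⟨c, hc, rfl⟩ := ha
    exact Submodule.subset_span ⟨starRingEnd ℂ c, by rwa [RCLike.norm_conj], by simp⟩
  | zero =>
    simp only [Pi.zero_apply, map_zero]
    exact trigPoly.zero_mem
  | add s t _ _ hs ht =>
    simp only [Pi.add_apply, map_add]
    exact trigPoly.add_mem hs ht
  | smul a t _ ht =>
    simp only [Pi.smul_apply, smul_eq_mul, map_mul]
    exact trigPoly.smul_mem (starRingEnd ℂ a) ht

lemma tendsto_of_mem_trigPoly {l : Filter ℕ}
    (hl : ∀ c : ℂ, ‖c‖ = 1 → Tendsto (fun n => c ^ n) l (𝓝 1)) {t : ℕ → ℂ} (ht : t ∈ trigPoly) :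
    Tendsto t l (𝓝 (t 0)) := by
  induction ht using Submodule.span_induction with
  | mem a ha =>
    obtain ⟨c, hc, rfl⟩ := ha
    simpa using hl c hc
  | zero => exact tendsto_const_nhds
  | add s t _ _ hs ht => exact hs.add ht
  | smul a t _ ht => exact ht.const_smul a

lemma tendsto_cesaro_mul_of_mem_trigPoly {a : ℕ → ℂ}
    (ha : ∀ c : ℂ, ‖c‖ = 1 → Tendsto
      (fun N : ℕ => (N : ℂ)⁻¹ * ∑ n ∈ Finset.range N, c ^ n * a n) atTop (𝓝 0))
    {t : ℕ → ℂ} (ht : t ∈ trigPoly) :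
    Tendsto (fun N : ℕ => (N : ℂ)⁻¹ * ∑ n ∈ Finset.range N, t n * a n) atTop (𝓝 0) := by
  induction ht using Submodule.span_induction with
  | mem b hb =>
    obtain ⟨c, hc, rfl⟩ := hb
    exact ha c hc
  | zero => simp
  | add s t _ _ hs ht => simpa [add_mul, Finset.sum_add_distrib, mul_add] using hs.add ht
  | smul b t _ ht =>
    have := ht.const_mul b
    rw [mul_zero] at this
    refine this.congr fun N => ?_
    simp only [Pi.smul_apply, smul_eq_mul, mul_assoc, ← Finset.mul_sum]
    ring

/-- An almost periodic sequence whose Fourier coefficients all vanish is zero at the origin. -/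
lemma eq_zero_of_fourier_eq_zero {a : ℕ → ℂ} {B : ℝ} (hB : ∀ n, ‖a n‖ ≤ B)
    (happ : ∀ ε > 0, ∃ t ∈ trigPoly, ∀ n, ‖a n - t n‖ ≤ ε)
    (ha : ∀ c : ℂ, ‖c‖ = 1 → Tendsto
      (fun N : ℕ => (N : ℂ)⁻¹ * ∑ n ∈ Finset.range N, c ^ n * a n) atTop (𝓝 0)) : a 0 = 0 := by
  have hB0 : 0 ≤ B := (norm_nonneg _).trans (hB 0)
  have hmean : Tendsto (fun N : ℕ => (N : ℝ)⁻¹ * ∑ n ∈ Finset.range N, ‖a n‖ ^ 2) atTop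
      (𝓝 0) := by
    rw [Metric.tendsto_nhds]
    intro ε hε
    set η := ε / (2 * (B + 1)) with hη
    have hη0 : 0 < η := by positivity
    obtain ⟨t, ht, hat⟩ := happ η hη0
    have h1 := tendsto_cesaro_mul_of_mem_trigPoly ha (conj_mem_trigPoly ht)
    filter_upwards [Metric.tendsto_nhds.1 h1 (ε / 2) (by positivity), eventually_gt_atTop 0]
      with N hN hN0
    have hN0' : (0 : ℝ) < N := by exact_mod_cast hN0
    rw [dist_zero_right] at hN ⊢
    have h2 : (((N : ℝ)⁻¹ * ∑ n ∈ Finset.range N, ‖a n‖ ^ 2 : ℝ) : ℂ) =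
        (N : ℂ)⁻¹ * ∑ n ∈ Finset.range N, starRingEnd ℂ (t n) * a n +
        (N : ℂ)⁻¹ * ∑ n ∈ Finset.range N, starRingEnd ℂ (a n - t n) * a n := by
      rw [← mul_add, ← Finset.sum_add_distrib]
      push_cast
      congr 1
      refine Finset.sum_congr rfl fun n _ => ?_
      rw [← add_mul, ← map_add, add_sub_cancel, Complex.conj_mul']
    have h3 : ‖(N : ℂ)⁻¹ * ∑ n ∈ Finset.range N, starRingEnd ℂ (a n - t n) * a n‖ ≤ η * B := by
      rw [norm_mul, norm_inv, Complex.norm_natCast, inv_mul_le_iff₀ hN0']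
      refine (norm_sum_le_of_le _ fun n _ => ?_).trans
        (by simp : ∑ n ∈ Finset.range N, η * B ≤ N * (η * B))
      rw [norm_mul, RCLike.norm_conj]
      exact mul_le_mul (hat n) (hB n) (norm_nonneg _) hη0.le
    have h4 : η * B ≤ ε / 2 := by
      rw [hη, div_mul_eq_mul_div, div_le_div_iff₀ (by positivity) (by positivity)]
      nlinarith
    rw [← Complex.norm_real, h2]
    exact (norm_add_le _ _).trans_lt (by linarith)
  obtain ⟨l, hl, hl1, hl2⟩ := exists_filter_return
  have h1 := hl2 _ (fun n => sq_nonneg ‖a n‖) hmean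
  have h2 : Tendsto a l (𝓝 (a 0)) := by
    rw [Metric.tendsto_nhds]
    intro ε hε
    obtain ⟨t, ht, hat⟩ := happ (ε / 3) (by positivity)
    filter_upwards [Metric.tendsto_nhds.1 (tendsto_of_mem_trigPoly hl1 ht) (ε / 3)
      (by positivity)] with n hn
    have h3 := hat n
    have h4 := hat 0
    rw [← dist_eq_norm] at h3 h4
    rw [dist_comm] at h4
    linarith [dist_triangle4 (a n) (t n) (t 0) (a 0)]
  have h3 := tendsto_nhds_unique h1 (h2.norm.pow 2)
  exact norm_eq_zero.1 (pow_eq_zero_iff two_ne_zero |>.1 h3.symm)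

end TrigPoly

section WeakLimits

variable {E : Type*} [NormedAddCommGroup E] [NormedSpace ℂ E]

lemma mem_of_weak_limit {K : Set E} (hK : Convex ℝ K) (hK' : IsClosed K) {l : Filter ℕ} [l.NeBot]
    {u : ℕ → E} {w : E} (hu : ∀ n, u n ∈ K)
    (hw : ∀ g : StrongDual ℂ E, Tendsto (fun n => g (u n)) l (𝓝 (g w))) : w ∈ K := by
  by_contra h
  obtain ⟨f, r, h1, h2⟩ := RCLike.geometric_hahn_banach_closed_point (𝕜 := ℂ) hK hK' h
  have h3 := (Complex.continuous_re.tendsto _).comp (hw f)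
  exact absurd (le_of_tendsto' h3 fun n => (h1 _ (hu n)).le) (not_le.2 h2)

lemma mem_of_forall_dual_eq_zero {Z : Submodule ℂ E} (hZ : IsClosed (Z : Set E)) {w : E}
    (h : ∀ g : StrongDual ℂ E, (∀ z ∈ Z, g z = 0) → g w = 0) : w ∈ Z := by
  by_contra hw
  obtain ⟨f, r, h1, h2⟩ := RCLike.geometric_hahn_banach_closed_point (𝕜 := ℂ)
    ((Z.restrictScalars ℝ).convex) hZ hw
  have hr : 0 < r := by simpa using h1 0 Z.zero_mem
  refine absurd (h f fun z hz => ?_) (fun h0 => by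
    rw [h0, map_zero] at h2
    exact absurd h2 (not_lt.2 hr.le))
  by_contra hfz
  have h3 := h1 _ (Z.smul_mem ((r : ℂ) * (f z)⁻¹) hz)
  rw [map_smul, smul_eq_mul, mul_assoc, inv_mul_cancel₀ hfz, mul_one] at h3
  simp at h3

lemma mem_trigPoly_of_mem_span {T : E →L[ℂ] E} (g : StrongDual ℂ E) {y : E}
    (hy : y ∈ Submodule.span ℂ {v : E | ∃ l : ℂ, ‖l‖ = 1 ∧ T v = l • v}) :
    (fun n => g ((T ^ n) y)) ∈ trigPoly := by
  induction hy using Submodule.span_induction with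
  | mem v hv =>
    obtain ⟨c, hc, hv⟩ := hv
    simp_rw [pow_apply_of_apply_eq_smul hv, map_smul, smul_eq_mul, mul_comm _ (g v)]
    exact trigPoly.smul_mem (g v) (Submodule.subset_span ⟨c, hc, rfl⟩)
  | zero =>
    simp only [map_zero]
    exact trigPoly.zero_mem
  | add v w _ _ hv hw =>
    simp only [map_add]
    exact trigPoly.add_mem hv hw
  | smul a v _ hv =>
    simp only [map_smul]
    exact trigPoly.smul_mem a hv

lemma exists_trigPoly_approx {T : E →L[ℂ] E} (hT : ‖T‖ ≤ 1) (g : StrongDual ℂ E) {x : E}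
    (hx : x ∈ unimodularSpan T) {ε : ℝ} (hε : 0 < ε) :
    ∃ t ∈ trigPoly, ∀ n, ‖g ((T ^ n) x) - t n‖ ≤ ε := by
  obtain ⟨y, hy, hxy⟩ := Metric.mem_closure_iff.1 hx (ε / (‖g‖ + 1)) (by positivity)
  refine ⟨_, mem_trigPoly_of_mem_span g hy, fun n => ?_⟩
  rw [← map_sub, ← map_sub]
  rw [dist_eq_norm] at hxy
  calc ‖g ((T ^ n) (x - y))‖ ≤ ‖g‖ * ‖(T ^ n) (x - y)‖ := g.le_opNorm _
    _ ≤ (‖g‖ + 1) * (ε / (‖g‖ + 1)) := by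
        gcongr
        · linarith
        · exact (norm_pow_apply_le hT n _).trans hxy.le
    _ = ε := mul_div_cancel₀ _ (by positivity)

end WeakLimits

section Transfer

variable {X : Type*} [MeasurableSpace X] {μ : Measure X} [IsProbabilityMeasure μ]

variable (μ) in
/-- The classes in `L^2` of the functions bounded by `C`. -/
def boundedBall (C : ℝ) : Set (Lp ℂ 2 μ) := {u | ∀ᵐ x ∂μ, ‖u x‖ ≤ C}

omit [IsProbabilityMeasure μ] in
lemma isClosed_boundedBall (C : ℝ) : IsClosed (boundedBall μ C) := by
  refine IsSeqClosed.isClosed fun u a hu ha => ?_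
  obtain ⟨ns, -, hns⟩ := (tendstoInMeasure_of_tendsto_Lp ha).exists_seq_tendsto_ae
  filter_upwards [hns, ae_all_iff.2 hu] with x h1 h2
  exact le_of_tendsto' h1.norm fun n => h2 (ns n)

omit [IsProbabilityMeasure μ] in
lemma convex_boundedBall (C : ℝ) : Convex ℝ (boundedBall μ C) := by
  intro u hu v hv a b ha hb hab
  filter_upwards [hu, hv, Lp.coeFn_add (a • u) (b • v), Lp.coeFn_smul a u, Lp.coeFn_smul b v]
    with x h1 h2 h3 h4 h5
  rw [h3, Pi.add_apply, h4, h5, Pi.smul_apply, Pi.smul_apply]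
  refine (norm_add_le _ _).trans ?_
  rw [norm_smul, norm_smul, Real.norm_of_nonneg ha, Real.norm_of_nonneg hb]
  calc a * ‖u x‖ + b * ‖v x‖ ≤ a * C + b * C := by gcongr
    _ = C := by rw [← add_mul, hab, one_mul]

/-- Weak convergence in `L^2` of uniformly bounded functions implies weak convergence in `L^p`. -/
lemma tendsto_dual_of_bounded {p : ℝ≥0∞} [Fact (1 ≤ p)] (hp : p ≠ ∞) {C : ℝ} (hC : 0 < C)
    {l : Filter ℕ} {u : ℕ → Lp ℂ p μ} {v : ℕ → Lp ℂ 2 μ} {z : Lp ℂ p μ} {w : Lp ℂ 2 μ}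
    (huv : ∀ n, u n =ᵐ[μ] v n) (hzw : z =ᵐ[μ] w) (hv : ∀ n, v n ∈ boundedBall μ C)
    (hw : w ∈ boundedBall μ C)
    (h : ∀ g : StrongDual ℂ (Lp ℂ 2 μ), Tendsto (fun n => g (v n)) l (𝓝 (g w)))
    (φ : StrongDual ℂ (Lp ℂ p μ)) : Tendsto (fun n => φ (u n)) l (𝓝 (φ z)) := by
  have hbd : ∀ {a : Lp ℂ p μ} {b : Lp ℂ 2 μ}, a =ᵐ[μ] b → b ∈ boundedBall μ C →
      ∀ᵐ x ∂μ, ‖a x‖ ≤ C := fun hab hb => by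
    filter_upwards [hab, hb] with x h1 h2
    rwa [h1]
  rw [Metric.tendsto_nhds]
  intro ε hε
  obtain ⟨g, hg⟩ := exists_dual_approx (μ := μ) hp φ hC (by positivity : 0 < ε / 3)
  filter_upwards [Metric.tendsto_nhds.1 (h g) (ε / 3) (by positivity)] with n hn
  have h1 := hg _ _ (huv n) (hbd (huv n) (hv n))
  have h2 := hg _ _ hzw (hbd hzw hw)
  rw [← dist_eq_norm] at h1 h2
  rw [dist_comm] at h2
  linarith [dist_triangle4 (φ (u n)) (g (v n)) (g w) (φ z)]

end Transfer

lemma exists_tendsto_cesaro_twist {H : Type*} [NormedAddCommGroup H] [InnerProductSpace ℂ H]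
    [CompleteSpace H] {S : H →L[ℂ] H} (hS : ‖S‖ ≤ 1) {c : ℂ} (hc : ‖c‖ = 1) (x : H) :
    ∃ y, S y = c⁻¹ • y ∧ Tendsto
      (fun N : ℕ => (N : ℂ)⁻¹ • ∑ n ∈ Finset.range N, c ^ n • (S ^ n) x) atTop (𝓝 y) := by
  have hc0 : c ≠ 0 := norm_ne_zero_iff.1 (by rw [hc]; exact one_ne_zero)
  have hcS : ‖c • S‖ ≤ 1 := by rwa [norm_smul, hc, one_mul]
  have h := (c • S).tendsto_birkhoffAverage_orthogonalProjection (𝕜 := ℂ) hcS x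
  set y := (((c • S).eqLocus (1 : H →L[ℂ] H)).orthogonalProjectionOnto x)
  have hy : (c • S) (y : H) = (y : H) := y.2
  refine ⟨y, ?_, h.congr fun N => ?_⟩
  · nth_rewrite 2 [← hy]
    rw [smul_apply, inv_smul_smul₀ hc0]
  · rw [birkhoffAverage, birkhoffSum]
    congr 1
    refine Finset.sum_congr rfl fun n _ => ?_
    rw [id, ← FunLike.coe_pow_eq_iterate, smul_pow, smul_apply]

section Transfer

variable {X : Type*} [MeasurableSpace X] {μ : Measure X} [IsProbabilityMeasure μ]
variable {p : ℝ≥0∞} [Fact (1 ≤ p)]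

omit [Fact (1 ≤ p)] in
lemma exists_ae_eq_of_mem_boundedBall {C : ℝ} {x : Lp ℂ 2 μ} (hx : x ∈ boundedBall μ C) :
    ∃ z : Lp ℂ p μ, z =ᵐ[μ] x :=
  ⟨(MemLp.of_bound (Lp.aestronglyMeasurable x) C hx).toLp, MemLp.coeFn_toLp _⟩

/-- Bounded elements of the closed span of the unimodular eigenvectors of an operator on `L^2` belong
to the corresponding subspace of `L^p`. -/
lemma mem_unimodularSpan_of_agree (hp : p ≠ ∞) {T : Lp ℂ p μ →L[ℂ] Lp ℂ p μ} (hT : ‖T‖ ≤ 1)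
    {S : Lp ℂ 2 μ →L[ℂ] Lp ℂ 2 μ} (hS : ‖S‖ ≤ 1) (hTS : Agree T S) {C : ℝ} (hC : 0 < C)
    {x : Lp ℂ 2 μ} (hx : x ∈ unimodularSpan S) (hxC : ∀ n, (S ^ n) x ∈ boundedBall μ C)
    {z : Lp ℂ p μ} (hz : z =ᵐ[μ] x) : z ∈ unimodularSpan T := by
  refine mem_of_forall_dual_eq_zero (isClosed_unimodularSpan T) fun φ hφ => ?_
  have hagree : ∀ n, (T ^ n) z =ᵐ[μ] (S ^ n) x := fun n => hTS.pow n z x hz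
  have hbd : ∀ n, ∀ᵐ a ∂μ, ‖(T ^ n) z a‖ ≤ C := fun n => by
    filter_upwards [hagree n, hxC n] with a h1 h2
    rwa [h1]
  refine eq_zero_of_fourier_eq_zero (a := fun n => φ ((T ^ n) z)) (B := ‖φ‖ * ‖z‖)
    (fun n => (φ.le_opNorm _).trans (by gcongr; exact norm_pow_apply_le hT n z)) ?_ ?_
  · intro ε hε
    obtain ⟨g, hg⟩ := exists_dual_approx (μ := μ) hp φ hC (by positivity : 0 < ε / 2)
    obtain ⟨t, ht, hgt⟩ := exists_trigPoly_approx hS g hx (by positivity : 0 < ε / 2)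
    refine ⟨t, ht, fun n => ?_⟩
    have h1 := hg _ _ (hagree n) (hbd n)
    have h2 := hgt n
    linarith [norm_sub_le_norm_sub_add_norm_sub (φ ((T ^ n) z)) (g ((S ^ n) x)) (t n)]
  · intro c hc
    obtain ⟨y, hy, hlim⟩ := exists_tendsto_cesaro_twist hS hc x
    have havg : ∀ N : ℕ, ((N : ℂ)⁻¹ • ∑ n ∈ Finset.range N, c ^ n • (S ^ n) x) ∈
        boundedBall μ C := by
      intro N
      rcases Nat.eq_zero_or_pos N with rfl | hN
      · simp only [Finset.range_zero, Finset.sum_empty, smul_zero]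
        filter_upwards [Lp.coeFn_zero ℂ 2 μ] with a ha
        rw [ha, Pi.zero_apply, norm_zero]
        exact hC.le
      · have hN' : (N : ℝ) ≠ 0 := by positivity
        have h1 : ((N : ℂ)⁻¹ • ∑ n ∈ Finset.range N, c ^ n • (S ^ n) x) =
            ∑ n ∈ Finset.range N, (N : ℝ)⁻¹ • (c ^ n • (S ^ n) x) := by
          rw [← Finset.smul_sum, RCLike.real_smul_eq_coe_smul (K := ℂ)]
          simp
        rw [h1]
        refine (convex_boundedBall C).sum_mem (fun _ _ => by positivity) (by simp [hN']) ?_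
        intro n _
        filter_upwards [hxC n, Lp.coeFn_smul (c ^ n) ((S ^ n) x)] with a h2 h3
        rwa [h3, Pi.smul_apply, norm_smul, norm_pow, hc, one_pow, one_mul]
    have hyC : y ∈ boundedBall μ C :=
      (isClosed_boundedBall C).mem_of_tendsto hlim (Eventually.of_forall havg)
    obtain ⟨w, hw⟩ := exists_ae_eq_of_mem_boundedBall (p := p) hyC
    have hTw : T w = c⁻¹ • w := by
      refine Lp.ext ?_
      have h1 := hTS w y hw
      rw [hy] at h1
      filter_upwards [h1, Lp.coeFn_smul c⁻¹ y, Lp.coeFn_smul c⁻¹ w, hw] with a h1 h2 h3 h4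
      rw [h1, h2, h3, Pi.smul_apply, Pi.smul_apply, h4]
    have hφw : φ w = 0 := hφ w (mem_unimodularSpan (by rw [norm_inv, hc, inv_one]) hTw)
    have huv : ∀ N : ℕ, ((N : ℂ)⁻¹ • ∑ n ∈ Finset.range N, c ^ n • (T ^ n) z : Lp ℂ p μ) =ᵐ[μ]
        ((N : ℂ)⁻¹ • ∑ n ∈ Finset.range N, c ^ n • (S ^ n) x : Lp ℂ 2 μ) := by
      intro N
      refine (Lp.coeFn_smul _ _).trans (EventuallyEq.trans ?_ (Lp.coeFn_smul _ _).symm)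
      refine EventuallyEq.const_smul ?_ _
      refine (coeFn_finset_sum _ _).trans (EventuallyEq.trans ?_ (coeFn_finset_sum _ _).symm)
      filter_upwards [ae_all_iff.2 hagree, ae_all_iff.2 fun n => Lp.coeFn_smul (c ^ n) ((T ^ n) z),
        ae_all_iff.2 fun n => Lp.coeFn_smul (c ^ n) ((S ^ n) x)] with a h1 h2 h3
      refine Finset.sum_congr rfl fun n _ => ?_
      rw [h2, h3, Pi.smul_apply, Pi.smul_apply, h1]
    have h := tendsto_dual_of_bounded hp hC huv hw havg hyC
      (fun g => (g.continuous.tendsto y).comp hlim) φ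
    rw [hφw] at h
    refine h.congr fun N => ?_
    simp only [map_smul, map_sum, smul_eq_mul]

/-- The projection onto the reversible part of a doubly stochastic operator. -/
theorem exists_idempotent_mem_wotSemigroup (hp : p ≠ ∞) {T : Lp ℂ p μ →L[ℂ] Lp ℂ p μ}
    (hT : IsDoublyStochastic T) :
    ∃ Q : Lp ℂ p μ →L[ℂ] Lp ℂ p μ, ContinuousLinearMapWOT.ofCLM Q ∈ wotSemigroup T ∧
      Q * Q = Q ∧ ∀ f, Q f ∈ unimodularSpan T := by
  obtain ⟨S, hS, hTS⟩ := exists_agree (q := 2) hp ENNReal.ofNat_ne_top T fun s =>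
    hT.eLpNorm_apply_simpleToLp_le s one_le_two ENNReal.ofNat_ne_top
  obtain ⟨l, hl, hwot⟩ := mem_wotSemigroup_iff.1 (starProjection_mem_wotSemigroup hS)
  have hPmem : ∀ v, (unimodularSpan S).starProjection v ∈ unimodularSpan S := fun v =>
    Submodule.starProjection_apply_mem _ v
  have hPP : ∀ v, (unimodularSpan S).starProjection ((unimodularSpan S).starProjection v) =
    (unimodularSpan S).starProjection v := fun v => Submodule.starProjection_eq_self_iff.2 (hPmem v)
  generalize (unimodularSpan S).starProjection = P at hwot hPmem hPP
  have hsimple : ∀ s : SimpleFunc X ℂ, simpleToLp μ p s =ᵐ[μ] simpleToLp μ 2 s := fun s =>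
    (coeFn_simpleToLp p s).trans (coeFn_simpleToLp 2 s).symm
  have hbound : ∀ s : SimpleFunc X ℂ, ∃ C : ℝ, 0 < C ∧
      (∀ n, (S ^ n) (simpleToLp μ 2 s) ∈ boundedBall μ C) ∧
      ∀ n, (S ^ n) (P (simpleToLp μ 2 s)) ∈ boundedBall μ C := by
    intro s
    obtain ⟨C, hC⟩ := s.exists_forall_norm_le
    have h1 : ∀ n, (S ^ n) (simpleToLp μ 2 s) ∈ boundedBall μ (max C 1) := fun n => by
      filter_upwards [hTS.pow n _ _ (hsimple s), (hT.pow n).norm_apply_simpleToLp_le hC]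
        with a h2 h3
      rw [← h2]
      exact h3.trans (le_max_left _ _)
    refine ⟨max C 1, by positivity, h1, fun n => ?_⟩
    refine mem_of_weak_limit (convex_boundedBall _) (isClosed_boundedBall _) (l := l)
      (u := fun k => (S ^ n) ((S ^ k) (simpleToLp μ 2 s))) (fun k => ?_)
      (fun g => hwot (simpleToLp μ 2 s) (g ∘L (S ^ n)))
    rw [← mul_apply_eq_comp, ← pow_add]
    exact h1 _
  have hweak : ∀ (s : SimpleFunc X ℂ) (z : Lp ℂ p μ), z =ᵐ[μ] P (simpleToLp μ 2 s) →
      ∀ φ : StrongDual ℂ (Lp ℂ p μ),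
        Tendsto (fun n => φ ((T ^ n) (simpleToLp μ p s))) l (𝓝 (φ z)) := by
    intro s z hz φ
    obtain ⟨C, hC, h1, h2⟩ := hbound s
    exact tendsto_dual_of_bounded hp hC (fun n => hTS.pow n _ _ (hsimple s)) hz h1 (h2 0)
      (fun g => hwot _ g) φ
  have hT1 := hT.norm_le_one hp
  have hcontr : ∀ s : SimpleFunc X ℂ, eLpNorm (P (simpleToLp μ 2 s)) p μ ≤ eLpNorm s p μ := by
    intro s
    obtain ⟨C, hC, h1, h2⟩ := hbound s
    obtain ⟨z, hz⟩ := exists_ae_eq_of_mem_boundedBall (p := p) (h2 0)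
    have h3 : ‖z‖ ≤ ‖simpleToLp μ p s‖ := by
      refine NormedSpace.norm_le_dual_bound ℂ z (norm_nonneg _) fun φ => ?_
      refine le_of_tendsto' (hweak s z hz φ).norm fun n => (φ.le_opNorm _).trans ?_
      rw [mul_comm]
      gcongr
      exact norm_pow_apply_le hT1 n _
    rw [norm_simpleToLp, Lp.norm_def, ENNReal.toReal_le_toReal (Lp.eLpNorm_ne_top z)
      (s.memLp_of_isFiniteMeasure p μ).2.ne, eLpNorm_congr_ae hz] at h3
    exact h3
  obtain ⟨Q, hQ, hPQ⟩ := exists_agree (q := p) ENNReal.ofNat_ne_top hp P hcontr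
  have hQs : ∀ s : SimpleFunc X ℂ, Q (simpleToLp μ p s) =ᵐ[μ] P (simpleToLp μ 2 s) := fun s =>
    (hPQ _ _ (hsimple s).symm).symm
  have hQ1 : ∀ v, ‖Q v‖ ≤ ‖v‖ := fun v => (Q.le_of_opNorm_le hQ v).trans_eq (one_mul _)
  refine ⟨Q, mem_wotSemigroup_iff.2 ⟨l, hl, fun f φ => ?_⟩, ?_, fun f => ?_⟩
  · rw [Metric.tendsto_nhds]
    intro ε hε
    obtain ⟨s, hs⟩ := (denseRange_simpleToLp (μ := μ) hp).exists_dist_lt f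
      (by positivity : 0 < ε / (3 * (‖φ‖ + 1)))
    have hsmall : ∀ y : Lp ℂ p μ, ‖y‖ ≤ ‖f - simpleToLp μ p s‖ → ‖φ y‖ ≤ ε / 3 := fun y hy => by
      rw [dist_eq_norm] at hs
      calc ‖φ y‖ ≤ ‖φ‖ * ‖y‖ := φ.le_opNorm y
        _ ≤ (‖φ‖ + 1) * (ε / (3 * (‖φ‖ + 1))) := by
            gcongr
            · linarith
            · exact hy.trans hs.le
        _ = ε / 3 := by field_simp
    filter_upwards [Metric.tendsto_nhds.1 (hweak s _ (hQs s) φ) (ε / 3) (by positivity)] with n hn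
    have h1 := hsmall ((T ^ n) (f - simpleToLp μ p s)) (norm_pow_apply_le hT1 n _)
    have h2 := hsmall (Q (f - simpleToLp μ p s)) (hQ1 _)
    rw [map_sub, map_sub, ← dist_eq_norm] at h1 h2
    rw [dist_comm] at h2
    linarith [dist_triangle4 (φ ((T ^ n) f)) (φ ((T ^ n) (simpleToLp μ p s)))
      (φ (Q (simpleToLp μ p s))) (φ (Q f))]
  · refine ContinuousLinearMap.ext fun f => ?_
    rw [mul_apply_eq_comp]
    have hclosed : IsClosed {f | Q (Q f) = Q f} :=
      isClosed_eq (Q.continuous.comp Q.continuous) Q.continuous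
    refine (denseRange_simpleToLp (μ := μ) hp).induction_on f hclosed fun s => ?_
    have h1 := hPQ _ _ (hQs s).symm
    rw [hPP] at h1
    exact Lp.ext (h1.symm.trans (hQs s).symm)
  · have hclosed : IsClosed {f | Q f ∈ unimodularSpan T} :=
      (isClosed_unimodularSpan T).preimage Q.continuous
    refine (denseRange_simpleToLp (μ := μ) hp).induction_on f hclosed fun s => ?_
    obtain ⟨C, hC, h1, h2⟩ := hbound s
    exact mem_unimodularSpan_of_agree hp hT1 hS hTS hC
      (hPmem _) h2 (hQs s)

end Transfer

section FiniteEntropy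

open Real

lemma negMulLog_sum_le {α : Type*} (s : Finset α) {x : α → ℝ} (hx : ∀ a ∈ s, 0 ≤ x a) :
    negMulLog (∑ a ∈ s, x a) ≤ ∑ a ∈ s, negMulLog (x a) := by
  rw [negMulLog, ← Finset.sum_neg_distrib, Finset.sum_mul]
  refine Finset.sum_le_sum fun a ha => ?_
  rcases (hx a ha).eq_or_lt with h | h
  · simp [← h]
  · have h1 : log (x a) ≤ log (∑ a ∈ s, x a) := log_le_log h (Finset.single_le_sum hx ha)
    rw [negMulLog]
    nlinarith

/-- Gibbs' inequality. -/
lemma sum_negMulLog_le {α : Type*} (s : Finset α) {x y : α → ℝ} (hx : ∀ a ∈ s, 0 ≤ x a)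
    (hy : ∀ a ∈ s, 0 ≤ y a) (hxy : ∀ a ∈ s, y a = 0 → x a = 0)
    (hsum : ∑ a ∈ s, y a ≤ ∑ a ∈ s, x a) :
    ∑ a ∈ s, negMulLog (x a) ≤ -∑ a ∈ s, x a * log (y a) := by
  have h : ∀ a ∈ s, negMulLog (x a) + x a * log (y a) ≤ y a - x a := by
    intro a ha
    rcases (hx a ha).eq_or_lt with h0 | h0
    · simpa [← h0] using hy a ha
    · have hy0 : 0 < y a := (hy a ha).lt_of_ne fun h => h0.ne' (hxy a ha h.symm)
      have h1 := log_le_sub_one_of_pos (div_pos hy0 h0)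
      rw [log_div hy0.ne' h0.ne'] at h1
      have h2 := mul_le_mul_of_nonneg_left h1 h0.le
      rw [mul_sub, mul_sub, mul_div_cancel₀ _ h0.ne'] at h2
      rw [negMulLog]
      linarith
  have := Finset.sum_le_sum h
  rw [Finset.sum_add_distrib, Finset.sum_sub_distrib] at this
  linarith

lemma min_mul_log_two_le {x y : ℝ} (hx : 0 ≤ x) (hy : 0 ≤ y) :
    negMulLog (x + y) + min x y * log 2 ≤ negMulLog x + negMulLog y := by
  wlog h : x ≤ y generalizing x y
  · rw [add_comm x, min_comm, add_comm (negMulLog x)]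
    exact this hy hx (le_of_not_ge h)
  rw [min_eq_left h]
  rcases hx.eq_or_lt with rfl | hx0
  · simp
  have h1 : log 2 + log x ≤ log (x + y) := by
    rw [← log_mul two_ne_zero hx0.ne']
    exact log_le_log (by positivity) (by linarith)
  have h2 : log y ≤ log (x + y) := log_le_log (by linarith) (by linarith)
  simp only [negMulLog]
  nlinarith

end FiniteEntropy

section RandomVariables

open Real

variable {Ω : Type*} [MeasurableSpace Ω] {ν : Measure Ω} [IsProbabilityMeasure ν]
variable {α β : Type*} [Fintype α] [Fintype β]

/-- All preimages under `Y` are measurable. -/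
def IsDiscreteMeasurable {α : Type*} (Y : Ω → α) : Prop := ∀ S : Set α, MeasurableSet (Y ⁻¹' S)

lemma isDiscreteMeasurable_of_singleton {α : Type*} [Finite α] {Y : Ω → α}
    (h : ∀ a, MeasurableSet (Y ⁻¹' {a})) : IsDiscreteMeasurable Y := fun S => by
  rw [← biUnion_of_singleton S, preimage_iUnion₂]
  exact S.toFinite.measurableSet_biUnion fun a _ => h a

omit [Fintype α] [Fintype β] in
lemma IsDiscreteMeasurable.prodMk [Finite α] [Finite β] {Y : Ω → α} {Z : Ω → β}
    (hY : IsDiscreteMeasurable Y) (hZ : IsDiscreteMeasurable Z) :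
    IsDiscreteMeasurable fun ω => (Y ω, Z ω) :=
  isDiscreteMeasurable_of_singleton fun ⟨a, b⟩ => by
    rw [← singleton_prod_singleton, mk_preimage_prod]
    exact (hY _).inter (hZ _)

/-- The Shannon entropy of a finitely valued random variable. -/
noncomputable def shannonEntropy (ν : Measure Ω) (Y : Ω → α) : ℝ :=
  ∑ a, negMulLog (ν.real (Y ⁻¹' {a}))

lemma shannonEntropy_nonneg (Y : Ω → α) : 0 ≤ shannonEntropy ν Y :=
  Finset.sum_nonneg fun _ _ => negMulLog_nonneg measureReal_nonneg measureReal_le_one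

omit [IsProbabilityMeasure ν] [Fintype α] in
lemma measureReal_preimage_eq_sum [IsFiniteMeasure ν] {Y : Ω → α} (hY : IsDiscreteMeasurable Y)
    (B : Set Ω) (s : Finset α) :
    ν.real (B ∩ Y ⁻¹' s) = ∑ a ∈ s, ν.real (B ∩ Y ⁻¹' {a}) := by
  have h := sum_measureReal_preimage_singleton (μ := ν.restrict B) s (f := Y)
    (fun a _ => hY {a})
  rw [measureReal_restrict_apply (hY _), inter_comm] at h
  rw [← h]
  refine Finset.sum_congr rfl fun a _ => ?_
  rw [measureReal_restrict_apply (hY _), inter_comm]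

omit [IsProbabilityMeasure ν] [Fintype α] in
lemma measureReal_preimage_eq_sum' [IsFiniteMeasure ν] {Y : Ω → α} (hY : IsDiscreteMeasurable Y)
    (s : Finset α) : ν.real (Y ⁻¹' s) = ∑ a ∈ s, ν.real (Y ⁻¹' {a}) := by
  simpa using measureReal_preimage_eq_sum hY univ s

lemma sum_measureReal_preimage {Y : Ω → α} (hY : IsDiscreteMeasurable Y) :
    ∑ a, ν.real (Y ⁻¹' {a}) = 1 := by
  rw [← measureReal_preimage_eq_sum' hY, Finset.coe_univ, preimage_univ, probReal_univ]

lemma shannonEntropy_comp_le {Y : Ω → α} (hY : IsDiscreteMeasurable Y) (g : α → β) :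
    shannonEntropy ν (g ∘ Y) ≤ shannonEntropy ν Y := by
  classical
  rw [shannonEntropy, shannonEntropy, ← Finset.sum_fiberwise Finset.univ g]
  refine Finset.sum_le_sum fun b _ => ?_
  have h : (g ∘ Y) ⁻¹' {b} = Y ⁻¹' (Finset.univ.filter fun a => g a = b : Finset α) := by
    ext ω
    simp
  rw [h, measureReal_preimage_eq_sum' hY]
  exact negMulLog_sum_le _ fun a _ => measureReal_nonneg

lemma shannonEntropy_le_log_card (Y : Ω → α) (hY : IsDiscreteMeasurable Y) :
    shannonEntropy ν Y ≤ log (Fintype.card α) := by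
  have hsum := sum_measureReal_preimage (ν := ν) hY
  have : Nonempty α := by
    by_contra h
    rw [not_nonempty_iff] at h
    simp at hsum
  have hc : (0 : ℝ) < Fintype.card α := by exact_mod_cast Fintype.card_pos
  refine (sum_negMulLog_le Finset.univ (y := fun _ => (Fintype.card α : ℝ)⁻¹)
    (fun a _ => measureReal_nonneg) (fun a _ => by positivity)
    (fun a _ h => absurd h (by positivity)) ?_).trans ?_
  · rw [hsum]
    simp [hc.ne']
  · rw [← Finset.sum_mul, hsum, log_inv, one_mul, neg_neg]

lemma shannonEntropy_prodMk_le {Y : Ω → α} {Z : Ω → β} (hY : IsDiscreteMeasurable Y)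
    (hZ : IsDiscreteMeasurable Z) :
    shannonEntropy ν (fun ω => (Y ω, Z ω)) ≤ shannonEntropy ν Y + shannonEntropy ν Z := by
  have hpre : ∀ c : α × β, (fun ω => (Y ω, Z ω)) ⁻¹' {c} = Y ⁻¹' {c.1} ∩ Z ⁻¹' {c.2} := by
    rintro ⟨a, b⟩
    rw [← singleton_prod_singleton, mk_preimage_prod]
  have hle1 : ∀ c : α × β, ν.real (Y ⁻¹' {c.1} ∩ Z ⁻¹' {c.2}) ≤ ν.real (Y ⁻¹' {c.1}) :=
    fun c => measureReal_mono inter_subset_left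
  have hle2 : ∀ c : α × β, ν.real (Y ⁻¹' {c.1} ∩ Z ⁻¹' {c.2}) ≤ ν.real (Z ⁻¹' {c.2}) :=
    fun c => measureReal_mono inter_subset_right
  have hm1 : ∀ a, ∑ b, ν.real (Y ⁻¹' {a} ∩ Z ⁻¹' {b}) = ν.real (Y ⁻¹' {a}) := fun a => by
    rw [← measureReal_preimage_eq_sum hZ, Finset.coe_univ, preimage_univ, inter_univ]
  have hm2 : ∀ b, ∑ a, ν.real (Y ⁻¹' {a} ∩ Z ⁻¹' {b}) = ν.real (Z ⁻¹' {b}) := fun b => by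
    simp_rw [inter_comm (Y ⁻¹' _)]
    rw [← measureReal_preimage_eq_sum hY, Finset.coe_univ, preimage_univ, inter_univ]
  have hsum1 := sum_measureReal_preimage (ν := ν) hY
  have hsum2 := sum_measureReal_preimage (ν := ν) hZ
  rw [shannonEntropy]
  simp_rw [hpre]
  refine (sum_negMulLog_le Finset.univ
    (y := fun c : α × β => ν.real (Y ⁻¹' {c.1}) * ν.real (Z ⁻¹' {c.2}))
    (fun c _ => measureReal_nonneg) (fun c _ => by positivity) (fun c _ h => ?_) ?_).trans_eq ?_
  · rcases mul_eq_zero.1 h with h | h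
    · exact le_antisymm ((hle1 c).trans_eq h) measureReal_nonneg
    · exact le_antisymm ((hle2 c).trans_eq h) measureReal_nonneg
  · rw [Fintype.sum_prod_type, Fintype.sum_prod_type]
    simp_rw [← Finset.mul_sum, hsum2, mul_one, hm1]
    exact le_rfl
  · have hlog : ∀ c : α × β, ν.real (Y ⁻¹' {c.1} ∩ Z ⁻¹' {c.2}) *
        log (ν.real (Y ⁻¹' {c.1}) * ν.real (Z ⁻¹' {c.2})) =
        ν.real (Y ⁻¹' {c.1} ∩ Z ⁻¹' {c.2}) * log (ν.real (Y ⁻¹' {c.1})) +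
        ν.real (Y ⁻¹' {c.1} ∩ Z ⁻¹' {c.2}) * log (ν.real (Z ⁻¹' {c.2})) := by
      intro c
      rcases (measureReal_nonneg (μ := ν) (s := Y ⁻¹' {c.1} ∩ Z ⁻¹' {c.2})).eq_or_lt with h | h
      · simp [← h]
      · rw [log_mul (h.trans_le (hle1 c)).ne' (h.trans_le (hle2 c)).ne', mul_add]
    simp_rw [hlog]
    rw [Finset.sum_add_distrib, Fintype.sum_prod_type, Fintype.sum_prod_type_right]
    simp_rw [← Finset.sum_mul, hm1, hm2]
    simp only [shannonEntropy, negMulLog, neg_mul, Finset.sum_neg_distrib]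
    ring

open Classical in
/-- The indicator of a set as a random variable. -/
noncomputable def boolIndicatorOf (B : Set Ω) (ω : Ω) : Bool := decide (ω ∈ B)

omit [MeasurableSpace Ω] in
lemma preimage_boolIndicatorOf_true (B : Set Ω) : boolIndicatorOf B ⁻¹' {true} = B := by
  ext ω
  simp [boolIndicatorOf]

omit [MeasurableSpace Ω] in
lemma preimage_boolIndicatorOf_false (B : Set Ω) : boolIndicatorOf B ⁻¹' {false} = Bᶜ := by
  ext ω
  simp [boolIndicatorOf]

lemma isDiscreteMeasurable_boolIndicatorOf {B : Set Ω} (hB : MeasurableSet B) :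
    IsDiscreteMeasurable (boolIndicatorOf B) :=
  isDiscreteMeasurable_of_singleton fun b => by
    cases b
    · rw [preimage_boolIndicatorOf_false]
      exact hB.compl
    · rwa [preimage_boolIndicatorOf_true]

lemma shannonEntropy_boolIndicatorOf {B : Set Ω} (hB : MeasurableSet B) :
    shannonEntropy ν (boolIndicatorOf B) = binEntropy (ν.real B) := by
  rw [shannonEntropy, Fintype.sum_bool, preimage_boolIndicatorOf_true,
    preimage_boolIndicatorOf_false, probReal_compl_eq_one_sub hB,
    binEntropy_eq_negMulLog_add_negMulLog_one_sub]

/-- Adjoining a set that is far from every union of atoms increases the entropy. -/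
lemma add_log_two_mul_le_shannonEntropy {Y : Ω → α} (hY : IsDiscreteMeasurable Y) {B : Set Ω}
    (hB : MeasurableSet B) {e : ℝ} (he : ∀ S : Set α, e ≤ ν.real (symmDiff B (Y ⁻¹' S))) :
    shannonEntropy ν Y + e * log 2 ≤ shannonEntropy ν fun ω => (Y ω, boolIndicatorOf B ω) := by
  classical
  have hsplit : ∀ a, ν.real (B ∩ Y ⁻¹' {a}) + ν.real (Bᶜ ∩ Y ⁻¹' {a}) = ν.real (Y ⁻¹' {a}) := by
    intro a
    rw [inter_comm, inter_comm Bᶜ, ← sdiff_eq, measureReal_inter_add_sdiff hB]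
  have hmin : e ≤ ∑ a, min (ν.real (B ∩ Y ⁻¹' {a})) (ν.real (Bᶜ ∩ Y ⁻¹' {a})) := by
    set s : Finset α := Finset.univ.filter fun a =>
      ν.real (Bᶜ ∩ Y ⁻¹' {a}) ≤ ν.real (B ∩ Y ⁻¹' {a}) with hs
    have h1 : symmDiff B (Y ⁻¹' s) ⊆ (Bᶜ ∩ Y ⁻¹' s) ∪ (B ∩ Y ⁻¹' (sᶜ : Finset α)) := by
      rintro ω (h | h)
      · right
        simpa using h
      · left
        simpa [and_comm] using h
    refine (he s).trans ((measureReal_mono h1).trans ((measureReal_union_le _ _).trans ?_))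
    rw [measureReal_preimage_eq_sum hY, measureReal_preimage_eq_sum hY,
      ← Finset.sum_add_sum_compl s fun a =>
        min (ν.real (B ∩ Y ⁻¹' {a})) (ν.real (Bᶜ ∩ Y ⁻¹' {a}))]
    refine add_le_add (Finset.sum_le_sum fun a ha => ?_) (Finset.sum_le_sum fun a ha => ?_)
    · simp only [hs, Finset.mem_filter, Finset.mem_univ, true_and] at ha
      exact le_min ha le_rfl
    · simp only [hs, Finset.mem_compl, Finset.mem_filter, Finset.mem_univ, true_and, not_le] at ha
      exact le_min le_rfl ha.le
  calc shannonEntropy ν Y + e * log 2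
      ≤ shannonEntropy ν Y +
        (∑ a, min (ν.real (B ∩ Y ⁻¹' {a})) (ν.real (Bᶜ ∩ Y ⁻¹' {a}))) * log 2 := by
        gcongr
    _ = ∑ a, (negMulLog (ν.real (B ∩ Y ⁻¹' {a}) + ν.real (Bᶜ ∩ Y ⁻¹' {a})) +
        min (ν.real (B ∩ Y ⁻¹' {a})) (ν.real (Bᶜ ∩ Y ⁻¹' {a})) * log 2) := by
        rw [Finset.sum_add_distrib, Finset.sum_mul, shannonEntropy]
        simp_rw [hsplit]
    _ ≤ ∑ a, (negMulLog (ν.real (B ∩ Y ⁻¹' {a})) + negMulLog (ν.real (Bᶜ ∩ Y ⁻¹' {a}))) :=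
        Finset.sum_le_sum fun a _ => min_mul_log_two_le measureReal_nonneg measureReal_nonneg
    _ = _ := by
        rw [shannonEntropy, Fintype.sum_prod_type]
        refine Finset.sum_congr rfl fun a _ => ?_
        rw [Fintype.sum_bool]
        have h : ∀ b, (fun ω => (Y ω, boolIndicatorOf B ω)) ⁻¹' {(a, b)} =
            boolIndicatorOf B ⁻¹' {b} ∩ Y ⁻¹' {a} := fun b => by
          rw [← singleton_prod_singleton, mk_preimage_prod, inter_comm]
        rw [h, h, preimage_boolIndicatorOf_true, preimage_boolIndicatorOf_false]

open Classical in
/-- The set of the indices in `K` of those members of the family that contain `ω`. -/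
noncomputable def pattern {ι : Type*} (B : ι → Set Ω) (K : Finset ι) (ω : Ω) : Finset ι :=
  K.filter fun k => ω ∈ B k

omit [MeasurableSpace Ω] in
@[simp] lemma mem_pattern {ι : Type*} {B : ι → Set Ω} {K : Finset ι} {ω : Ω} {k : ι} :
    k ∈ pattern B K ω ↔ k ∈ K ∧ ω ∈ B k := by
  simp [pattern]

lemma isDiscreteMeasurable_pattern {ι : Type*} [Finite ι] {B : ι → Set Ω}
    (hB : ∀ i, MeasurableSet (B i)) (K : Finset ι) : IsDiscreteMeasurable (pattern B K) :=
  isDiscreteMeasurable_of_singleton fun s => by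
    have h : pattern B K ⁻¹' {s} = ⋂ i, {ω | i ∈ K ∧ ω ∈ B i ↔ i ∈ s} := by
      ext ω
      simp [Finset.ext_iff]
    rw [h]
    exact MeasurableSet.iInter fun i =>
      ((MeasurableSet.const _).inter (hB i)).iff (MeasurableSet.const _)

lemma shannonEntropy_pattern_le {ι : Type*} [Fintype ι] {B : ι → Set Ω}
    (hB : ∀ i, MeasurableSet (B i)) (K : Finset ι) :
    shannonEntropy ν (pattern B K) ≤ ∑ i ∈ K, binEntropy (ν.real (B i)) := by
  classical
  induction K using Finset.induction_on with
  | empty =>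
    have h : pattern B ∅ = fun _ => ∅ := by
      ext ω
      simp
    rw [Finset.sum_empty, h]
    refine (Finset.sum_eq_zero fun s _ => ?_).le
    by_cases hs : s = ∅
    · simp [hs]
    · rw [preimage_const_of_notMem fun h => hs (mem_singleton_iff.1 h).symm]
      simp
  | insert k K hk ih =>
    have h : pattern B (insert k K) = (fun c : Finset ι × Bool =>
        if c.2 then insert k c.1 else c.1) ∘ fun ω => (pattern B K ω, boolIndicatorOf (B k) ω) := by
      ext ω i
      by_cases hω : ω ∈ B k
      · simp only [mem_pattern, Finset.mem_insert, Function.comp_apply, boolIndicatorOf, hω,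
          decide_true, if_true]
        constructor
        · rintro ⟨rfl | h, h'⟩
          · exact Or.inl rfl
          · exact Or.inr ⟨h, h'⟩
        · rintro (rfl | h)
          · exact ⟨Or.inl rfl, hω⟩
          · exact ⟨Or.inr h.1, h.2⟩
      · simp only [mem_pattern, Finset.mem_insert, Function.comp_apply, boolIndicatorOf, hω,
          decide_false, Bool.false_eq_true, if_false]
        constructor
        · rintro ⟨rfl | h, h'⟩
          · exact absurd h' hω
          · exact ⟨h, h'⟩
        · exact fun h => ⟨Or.inr h.1, h.2⟩
    rw [h, Finset.sum_insert hk, ← shannonEntropy_boolIndicatorOf (hB k)]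
    have h1 := isDiscreteMeasurable_pattern hB K
    have h2 := isDiscreteMeasurable_boolIndicatorOf (hB k)
    refine (shannonEntropy_comp_le (h1.prodMk h2) _).trans ?_
    refine (shannonEntropy_prodMk_le h1 h2).trans ?_
    linarith

/-- If every member of the family `B` is close to some member of the finite family `C`, then the
entropy of `B` is essentially that of `C`. -/
lemma shannonEntropy_pattern_le_of_approx {ι κ : Type*} [Fintype ι] [Fintype κ]
    {B : ι → Set Ω} {C : κ → Set Ω} (hB : ∀ i, MeasurableSet (B i))
    (hC : ∀ k, MeasurableSet (C k)) (m : ι → κ) :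
    shannonEntropy ν (pattern B Finset.univ) ≤ log (Fintype.card (Finset κ)) +
      ∑ i, binEntropy (ν.real (symmDiff (B i) (C (m i)))) := by
  classical
  have h : pattern B Finset.univ = (fun c : Finset κ × Finset ι =>
      Finset.univ.filter fun i => ¬ (i ∈ c.2 ↔ m i ∈ c.1)) ∘ fun ω =>
      (pattern C Finset.univ ω,
        pattern (fun i => symmDiff (B i) (C (m i))) Finset.univ ω) := by
    ext ω i
    simp only [mem_pattern, Finset.mem_univ, true_and, Function.comp_apply, Finset.mem_filter,
      mem_symmDiff]
    tauto
  have hD : ∀ i, MeasurableSet (symmDiff (B i) (C (m i))) := fun i => (hB i).symmDiff (hC _)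
  have h1 := isDiscreteMeasurable_pattern hC Finset.univ
  have h2 := isDiscreteMeasurable_pattern hD Finset.univ
  rw [h]
  refine (shannonEntropy_comp_le (h1.prodMk h2) _).trans ?_
  refine (shannonEntropy_prodMk_le h1 h2).trans ?_
  exact add_le_add (shannonEntropy_le_log_card _ h1) (shannonEntropy_pattern_le hD _)

end RandomVariables

lemma volume_symmDiff_Iic (a b : unitInterval) :
    volume (symmDiff (Iic a) (Iic b)) = ENNReal.ofReal |(a : ℝ) - b| := by
  wlog h : a ≤ b generalizing a b
  · rw [symmDiff_comm, abs_sub_comm]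
    exact this b a (le_of_not_ge h)
  have hset : symmDiff (Iic a) (Iic b) = Ioc a b := by
    ext t
    simp only [mem_symmDiff, mem_Iic, mem_Ioc, not_le]
    constructor
    · rintro (⟨h1, h2⟩ | ⟨h1, h2⟩)
      · exact absurd (h1.trans h) (not_le.2 h2)
      · exact ⟨h2, h1⟩
    · exact fun h => Or.inr ⟨h.2, h.1⟩
  rw [hset, unitInterval.volume_Ioc, abs_sub_comm, abs_of_nonneg (sub_nonneg.2 (show (a : ℝ) ≤ b from h))]

section Subgraph

variable {X : Type*} [MeasurableSpace X]

lemma measurableSet_subgraph {f : X → ℝ} (hf : Measurable f) : MeasurableSet (subgraph f) :=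
  measurableSet_le (measurable_subtype_coe.comp measurable_snd) (hf.comp measurable_fst)

variable {μ : Measure X} [IsProbabilityMeasure μ] {p : ℝ≥0∞}

omit [IsProbabilityMeasure μ] in
lemma collectionEntropy_eq_shannonEntropy {ι : Type*} [Fintype ι] (F : ι → X → ℝ) :
    collectionEntropy μ F =
      shannonEntropy (μ.prod volume) (pattern (fun i => subgraph (F i)) Finset.univ) := by
  refine Finset.sum_congr rfl fun s _ => ?_
  have h : cell F s = pattern (fun i => subgraph (F i)) Finset.univ ⁻¹' {s} := by
    ext ω
    simp [cell, Finset.ext_iff]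
  rw [h]

/-- The class is represented by a function with values in `[0,1]`. -/
def IsUnitValued (u : Lp ℂ p μ) : Prop := ∀ᵐ x ∂μ, (u x).re ∈ Icc (0 : ℝ) 1 ∧ (u x).im = 0

/-- The points below the graph of the real part of a class. -/
def subgraphLp (u : Lp ℂ p μ) : Set (X × unitInterval) := subgraph fun x => (u x).re

omit [IsProbabilityMeasure μ] in
lemma measurableSet_subgraphLp (u : Lp ℂ p μ) : MeasurableSet (subgraphLp u) :=
  measurableSet_subgraph (Complex.measurable_re.comp (Lp.stronglyMeasurable u).measurable)

omit [IsProbabilityMeasure μ] in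
lemma measure_symmDiff_subgraphLp {u v : Lp ℂ p μ} (hu : IsUnitValued u) (hv : IsUnitValued v) :
    (μ.prod volume) (symmDiff (subgraphLp u) (subgraphLp v)) = eLpNorm (u - v : Lp ℂ p μ) 1 μ := by
  rw [Measure.prod_apply ((measurableSet_subgraphLp u).symmDiff (measurableSet_subgraphLp v)),
    eLpNorm_one_eq_lintegral_enorm]
  refine lintegral_congr_ae ?_
  filter_upwards [hu, hv, Lp.coeFn_sub u v] with x ⟨h1, h2⟩ ⟨h3, h4⟩ h5
  have hset : Prod.mk x ⁻¹' symmDiff (subgraphLp u) (subgraphLp v) =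
      symmDiff (Iic ⟨(u x).re, h1⟩) (Iic ⟨(v x).re, h3⟩) := rfl
  have hre : u x - v x = (((u x).re - (v x).re : ℝ) : ℂ) := Complex.ext (by simp) (by simp [h2, h4])
  rw [hset, volume_symmDiff_Iic, h5, Pi.sub_apply, hre, ← ofReal_norm, Complex.norm_real,
    Real.norm_eq_abs]

variable [Fact (1 ≤ p)]

lemma measureReal_symmDiff_subgraphLp_le {u v : Lp ℂ p μ} (hu : IsUnitValued u)
    (hv : IsUnitValued v) :
    (μ.prod volume).real (symmDiff (subgraphLp u) (subgraphLp v)) ≤ dist u v := by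
  rw [dist_eq_norm, Measure.real, measure_symmDiff_subgraphLp hu hv, Lp.norm_def]
  exact ENNReal.toReal_mono (Lp.eLpNorm_ne_top _)
    (eLpNorm_le_eLpNorm_of_exponent_le Fact.out (Lp.aestronglyMeasurable _))

lemma exists_dist_le_of_symmDiff (hp : p ≠ ∞) {η : ℝ} (hη : 0 < η) :
    ∃ δ : ℝ, 0 < δ ∧ ∀ u v : Lp ℂ p μ, IsUnitValued u → IsUnitValued v →
      (μ.prod volume).real (symmDiff (subgraphLp u) (subgraphLp v)) ≤ δ → dist u v ≤ η := by
  obtain ⟨δ, hδ, h⟩ := exists_eLpNorm_le_of_bound (μ := μ) (Fact.out : 1 ≤ p) hp one_pos hη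
  refine ⟨δ, hδ, fun u v hu hv huv => ?_⟩
  rw [dist_eq_norm, Lp.norm_def]
  refine ENNReal.toReal_le_of_le_ofReal hη.le (h _ ?_ ?_)
  · filter_upwards [hu, hv, Lp.coeFn_sub u v] with x ⟨h1, h2⟩ ⟨h3, h4⟩ h5
    have hre : u x - v x = (((u x).re - (v x).re : ℝ) : ℂ) :=
      Complex.ext (by simp) (by simp [h2, h4])
    rw [h5, Pi.sub_apply, hre, Complex.norm_real, Real.norm_eq_abs, abs_le]
    exact ⟨by linarith [h1.1, h3.2], by linarith [h1.2, h3.1]⟩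
  · rw [← measure_symmDiff_subgraphLp hu hv]
    exact (ENNReal.le_ofReal_iff_toReal_le (measure_ne_top _ _) hδ.le).2 huv

omit [Fact (1 ≤ p)] in
lemma UnitFun.isUnitValued (f : UnitFun X) : IsUnitValued (f.toLp μ p) := by
  filter_upwards [(f.memLp μ p).coeFn_toLp] with x hx
  rw [UnitFun.toLp, hx]
  exact ⟨by simp, by simp⟩

lemma IsDoublyStochastic.isUnitValued {T : Lp ℂ p μ →L[ℂ] Lp ℂ p μ} (hT : IsDoublyStochastic T)
    {u : Lp ℂ p μ} (hu : IsUnitValued u) : IsUnitValued (T u) := by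
  have h1 := hT.positive u (hu.mono fun x hx => ⟨hx.1.1, hx.2⟩)
  have h2 := hT.positive (Lp.const p μ (1 : ℂ) - u) (by
    filter_upwards [hu, Lp.coeFn_sub (Lp.const p μ (1 : ℂ)) u, Lp.coeFn_const p μ (1 : ℂ)]
      with x ⟨h1, h2⟩ h3 h4
    rw [h3, Pi.sub_apply, h4]
    simpa [h2] using h1.2)
  rw [map_sub, hT.map_one] at h2
  filter_upwards [h1, h2, Lp.coeFn_sub (Lp.const p μ (1 : ℂ)) (T u), Lp.coeFn_const p μ (1 : ℂ)]
    with x h1 h2 h3 h4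
  rw [h3, Pi.sub_apply, h4] at h2
  exact ⟨⟨h1.1, by simpa using h2.1⟩, h1.2⟩

end Subgraph

section Null

variable {X : Type*} [MeasurableSpace X] {μ : Measure X} [IsProbabilityMeasure μ]
variable {p : ℝ≥0∞} [Fact (1 ≤ p)] {T : Lp ℂ p μ →L[ℂ] Lp ℂ p μ}

lemma HasPrecompactOrbit.exists_dist_lt {E : Type*} [NormedAddCommGroup E] [NormedSpace ℂ E]
    {T : E →L[ℂ] E} {f : E} (hf : HasPrecompactOrbit T f) {ε : ℝ} (hε : 0 < ε) :
    ∃ N : ℕ, ∀ n, ∃ m : Fin N, dist ((T ^ n) f) ((T ^ (m : ℕ)) f) < ε := by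
  obtain ⟨t, hts, ht, hcov⟩ := Metric.finite_approx_of_totallyBounded hf ε hε
  have hex : ∀ y ∈ t, ∃ n, (T ^ n) f = y := fun y hy => hts hy
  choose! i hi using hex
  obtain ⟨N, hN⟩ := (ht.image i).bddAbove
  refine ⟨N + 1, fun n => ?_⟩
  obtain ⟨y, hy, hny⟩ := mem_iUnion₂.1 (hcov (mem_range_self n))
  refine ⟨⟨i y, Nat.lt_succ_of_le (hN (mem_image_of_mem i hy))⟩, ?_⟩
  rw [← hi y hy] at hny
  exact hny

lemma collectionEntropy_iterateCollection (a : ℕ → ℕ) {r : ℕ} (F : Fin r → UnitFun X) (n : ℕ) :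
    collectionEntropy μ (iterateCollection T a F n) = shannonEntropy (μ.prod volume)
      (pattern (fun k : Fin n × Fin r => subgraphLp ((T ^ a k.1) ((F k.2).toLp μ p)))
        Finset.univ) :=
  collectionEntropy_eq_shannonEntropy _

lemma collectionEntropy_iterateCollection_nonneg (a : ℕ → ℕ) {r : ℕ} (F : Fin r → UnitFun X)
    (n : ℕ) : 0 ≤ collectionEntropy μ (iterateCollection T a F n) := by
  rw [collectionEntropy_iterateCollection]
  exact shannonEntropy_nonneg _

/-- Along precompact orbits the entropy of the iterates of a collection grows sublinearly. -/
lemma exists_collectionEntropy_le (hT : IsDoublyStochastic T) (h : ∀ f, HasPrecompactOrbit T f)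
    {r : ℕ} (F : Fin r → UnitFun X) {η : ℝ} (hη : 0 < η) :
    ∃ c : ℝ, ∀ (a : ℕ → ℕ) (n : ℕ),
      collectionEntropy μ (iterateCollection T a F n) ≤ c + n * (r * η) := by
  have hcont := Real.binEntropy_continuous.tendsto 0
  rw [Real.binEntropy_zero, Metric.tendsto_nhds_nhds] at hcont
  obtain ⟨δ, hδ, hbin⟩ := hcont η hη
  choose N hN using fun j => (h ((F j).toLp μ p)).exists_dist_lt hδ
  choose m hm using hN
  have hunit : ∀ (n : ℕ) (j : Fin r), IsUnitValued ((T ^ n) ((F j).toLp μ p)) := fun n j =>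
    (hT.pow n).isUnitValued (F j).isUnitValued
  refine ⟨Real.log (Fintype.card (Finset (Σ j : Fin r, Fin (N j)))), fun a n => ?_⟩
  have happrox := shannonEntropy_pattern_le_of_approx (ν := μ.prod volume)
    (B := fun k : Fin n × Fin r => subgraphLp ((T ^ a k.1) ((F k.2).toLp μ p)))
    (C := fun k : Σ j : Fin r, Fin (N j) => subgraphLp ((T ^ (k.2 : ℕ)) ((F k.1).toLp μ p)))
    (fun k => measurableSet_subgraphLp _) (fun k => measurableSet_subgraphLp _)
    fun k => ⟨k.2, m k.2 (a k.1)⟩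
  rw [collectionEntropy_iterateCollection]
  refine happrox.trans ?_
  gcongr
  refine (Finset.sum_le_card_nsmul _ _ η fun k _ => ?_).trans_eq ?_
  · have h1 := (measureReal_symmDiff_subgraphLp_le (hunit (a k.1) k.2)
      (hunit (m k.2 (a k.1)) k.2)).trans_lt (hm k.2 (a k.1))
    refine ((le_abs_self _).trans_lt ?_).le
    rw [← Real.norm_eq_abs, ← dist_zero_right]
    refine hbin ?_
    rwa [dist_zero_right, Real.norm_of_nonneg measureReal_nonneg]
  · rw [Finset.card_univ, Fintype.card_prod, Fintype.card_fin, Fintype.card_fin, nsmul_eq_mul]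
    push_cast
    ring

theorem isNull_of_hasPrecompactOrbit (hT : IsDoublyStochastic T)
    (h : ∀ f, HasPrecompactOrbit T f) : IsNull T := by
  intro a _ _
  have hseq : ∀ (r : ℕ) (F : Fin r → UnitFun X), seqEntropyOf T a F = 0 := by
    intro r F
    refine Tendsto.limsup_eq ?_
    rw [← EReal.coe_zero, EReal.tendsto_coe, Metric.tendsto_nhds]
    intro ε hε
    obtain ⟨c, hbound⟩ := exists_collectionEntropy_le hT h F
      (by positivity : 0 < ε / (2 * ((r : ℝ) + 1)))
    filter_upwards [Metric.tendsto_nhds.1 (tendsto_const_div_atTop_nhds_zero_nat c) (ε / 2)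
      (by positivity), eventually_gt_atTop 0] with n hn hn0
    have hn' : (0 : ℝ) < n := by exact_mod_cast hn0
    have h0 := collectionEntropy_iterateCollection_nonneg (T := T) a F n
    rw [dist_zero_right, Real.norm_eq_abs] at hn ⊢
    rw [abs_of_nonneg (by positivity)]
    calc 1 / (n : ℝ) * collectionEntropy μ (iterateCollection T a F n)
        ≤ 1 / (n : ℝ) * (c + n * (r * (ε / (2 * (r + 1))))) := by
          gcongr
          exact hbound a n
      _ = c / n + r / (r + 1) * (ε / 2) := by field_simp
      _ < ε / 2 + 1 * (ε / 2) := by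
          have h1 : (r : ℝ) / (r + 1) ≤ 1 := (div_le_one (by positivity)).2 (by linarith)
          have h2 := (le_abs_self _).trans_lt hn
          exact add_lt_add_of_lt_of_le h2 (by gcongr)
      _ = ε := by ring
  simp only [seqEntropy, hseq]
  exact le_antisymm (iSup₂_le fun _ _ => le_rfl) (le_iSup₂_of_le 0 Fin.elim0 le_rfl)

/-- If the sets `A n` cannot be covered by finitely many small balls, then beyond every index there
is a member of the sequence that is far from the algebra generated by the preceding ones. -/
lemma exists_far_from_algebra {Ω : Type*} [MeasurableSpace Ω] {ν : Measure Ω} [IsFiniteMeasure ν]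
    {A : ℕ → Set Ω} {e : ℝ} (h : ∀ t : Set ℕ, t.Finite → ∃ n, ∀ m ∈ t,
      e ≤ ν.real (symmDiff (A n) (A m))) (N : ℕ) :
    ∃ n > N, ∀ S : Set (Finset ℕ),
      e / 2 ≤ ν.real (symmDiff (A n) (pattern A (Finset.range (N + 1)) ⁻¹' S)) := by
  by_contra! hcon
  choose! S hS using hcon
  set W := pattern A (Finset.range (N + 1))
  set P : Set (Finset ℕ) := {s | s ⊆ Finset.range (N + 1)}
  have hP : P.Finite := by
    refine (Finset.finite_toSet (Finset.range (N + 1)).powerset).subset fun s hs => ?_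
    exact Finset.mem_coe.2 (Finset.mem_powerset.2 hs)
  have hW : ∀ n, W ⁻¹' (S n ∩ P) = W ⁻¹' S n := fun n => by
    ext ω
    have : W ω ∈ P := fun k hk => (mem_pattern.1 hk).1
    simp [this]
  obtain ⟨t, ht, hbij⟩ := Set.exists_subset_bijOn (Ioi N) fun n => S n ∩ P
  have htfin : t.Finite := by
    refine hbij.finite_iff_finite.2 (hP.finite_subsets.subset ?_)
    rintro _ ⟨n, -, rfl⟩
    exact inter_subset_right
  have he : 0 < e := by
    have h1 := (hS (N + 1) (Nat.lt_succ_self N))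
    linarith [measureReal_nonneg.trans_lt h1]
  obtain ⟨n, hn⟩ := h (t ∪ Iic N) (htfin.union (finite_Iic N))
  have hnN : N < n := by
    by_contra hle
    have h1 := hn n (Or.inr (not_lt.1 hle))
    rw [symmDiff_self] at h1
    simp only [bot_eq_empty, measureReal_empty] at h1
    linarith
  obtain ⟨m, hm, hmn⟩ := hbij.surjOn ⟨n, hnN, rfl⟩
  have h1 := hn m (Or.inl hm)
  have h2 := hS n hnN
  have h3 := hS m (ht hm)
  rw [← hW] at h2 h3
  simp only at hmn
  rw [hmn, symmDiff_comm] at h3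
  have h4 := measureReal_symmDiff_le (μ := ν) (s := A n) (t := W ⁻¹' (S n ∩ P)) (A m)
  linarith

lemma mul_log_two_le_collectionEntropy {f : UnitFun X} {e : ℝ} {a : ℕ → ℕ}
    (ha : ∀ n, ∀ S : Set (Finset (Fin n × Fin 1)),
      e ≤ (μ.prod volume).real (symmDiff (subgraphLp ((T ^ a n) (f.toLp μ p)))
        (pattern (fun k : Fin n × Fin 1 => subgraphLp ((T ^ a k.1) (f.toLp μ p)))
          Finset.univ ⁻¹' S))) (n : ℕ) :
    n * (e * Real.log 2) ≤ collectionEntropy μ (iterateCollection T a (fun _ : Fin 1 => f) n) := by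
  classical
  induction n with
  | zero =>
    rw [Nat.cast_zero, zero_mul]
    exact collectionEntropy_iterateCollection_nonneg _ _ _
  | succ n ih =>
    rw [collectionEntropy_iterateCollection] at ih ⊢
    have hmeas := fun n => isDiscreteMeasurable_pattern
      (fun k : Fin n × Fin 1 => measurableSet_subgraphLp ((T ^ a k.1) (f.toLp μ p))) Finset.univ
    have h1 := add_log_two_mul_le_shannonEntropy (hmeas n)
      (measurableSet_subgraphLp ((T ^ a n) (f.toLp μ p))) (ha n)
    have h2 := shannonEntropy_comp_le (ν := μ.prod volume) (hmeas (n + 1))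
      fun s => (Finset.univ.filter fun k : Fin n × Fin 1 => (k.1.castSucc, k.2) ∈ s,
        decide ((Fin.last n, 0) ∈ s))
    have h3 : (fun ω => (pattern (fun k : Fin n × Fin 1 =>
          subgraphLp ((T ^ a k.1) (f.toLp μ p))) Finset.univ ω,
        boolIndicatorOf (subgraphLp ((T ^ a n) (f.toLp μ p))) ω)) =
        (fun s => (Finset.univ.filter fun k : Fin n × Fin 1 => (k.1.castSucc, k.2) ∈ s,
          decide ((Fin.last n, 0) ∈ s))) ∘ pattern (fun k : Fin (n + 1) × Fin 1 =>
            subgraphLp ((T ^ a k.1) (f.toLp μ p))) Finset.univ := by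
      ext ω : 1
      refine Prod.ext ?_ ?_
      · ext k
        simp
      · simp [boolIndicatorOf]
    rw [h3] at h1
    rw [Nat.cast_succ, add_one_mul]
    exact (add_le_add_left ih (e * Real.log 2)).trans (h1.trans h2)

lemma IsNull.hasPrecompactOrbit_unitFun (hp : p ≠ ∞) (hT : IsDoublyStochastic T) (h : IsNull T)
    (f : UnitFun X) : HasPrecompactOrbit T (f.toLp μ p) := by
  have hunit : ∀ n : ℕ, IsUnitValued ((T ^ n) (f.toLp μ p)) := fun n =>
    (hT.pow n).isUnitValued f.isUnitValued
  set A : ℕ → Set (X × unitInterval) := fun n => subgraphLp ((T ^ n) (f.toLp μ p)) with hA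
  have key : ∀ e > 0, ∃ t : Set ℕ, t.Finite ∧ ∀ n, ∃ m ∈ t,
      (μ.prod volume).real (symmDiff (A n) (A m)) < e := by
    intro e he
    by_contra! hcon
    choose g hg1 hg2 using exists_far_from_algebra hcon
    set a : ℕ → ℕ := fun n => g^[n + 1] 0 with ha
    have hsucc : ∀ n, a (n + 1) = g (a n) := fun n => Function.iterate_succ_apply' g (n + 1) 0
    have hmono : StrictMono a := strictMono_nat_of_lt_succ fun n => by
      rw [hsucc]
      exact hg1 _
    have hpos : ∀ n, 0 < a n := fun n =>
      (show 0 < a 0 from hg1 0).trans_le (hmono.monotone (Nat.zero_le n))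
    have hfar : ∀ n, ∀ S : Set (Finset (Fin n × Fin 1)),
        e / 2 ≤ (μ.prod volume).real (symmDiff (subgraphLp ((T ^ a n) (f.toLp μ p)))
          (pattern (fun k : Fin n × Fin 1 => subgraphLp ((T ^ a k.1) (f.toLp μ p)))
            Finset.univ ⁻¹' S)) := by
      classical
      intro n S
      have hlt : ∀ k : Fin n, a k < g^[n] 0 + 1 := fun k => by
        cases n with
        | zero => exact k.elim0
        | succ n => exact Nat.lt_succ_of_le (hmono.monotone (Nat.le_of_lt_succ k.2))
      have hpat : pattern (fun k : Fin n × Fin 1 => subgraphLp ((T ^ a k.1) (f.toLp μ p)))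
          Finset.univ ⁻¹' S = pattern A (Finset.range (g^[n] 0 + 1)) ⁻¹'
            ((fun s => Finset.univ.filter fun k : Fin n × Fin 1 => a k.1 ∈ s) ⁻¹' S) := by
        rw [← preimage_comp]
        congr 1
        ext ω k
        simp [hlt, hA]
      rw [hpat, show a n = g (g^[n] 0) from Function.iterate_succ_apply' g n 0]
      exact hg2 _ _
    have hent := mul_log_two_le_collectionEntropy hfar
    have hzero := h a hmono hpos
    have h1 : ((e / 2 * Real.log 2 : ℝ) : EReal) ≤ seqEntropyOf T a fun _ : Fin 1 => f := by
      rw [seqEntropyOf]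
      refine le_limsup_of_frequently_le (Eventually.frequently ?_)
      filter_upwards [eventually_gt_atTop 0] with n hn
      have hn' : (0 : ℝ) < n := by exact_mod_cast hn
      rw [EReal.coe_le_coe_iff, one_div, le_inv_mul_iff₀ hn']
      exact hent n
    have h2 : seqEntropyOf T a (fun _ : Fin 1 => f) ≤ seqEntropy T a :=
      le_iSup₂_of_le 1 (fun _ : Fin 1 => f) le_rfl
    have h3 := h1.trans (h2.trans_eq hzero)
    rw [← EReal.coe_zero, EReal.coe_le_coe_iff] at h3
    exact absurd h3 (not_le.2 (by positivity))
  refine Metric.totallyBounded_iff.2 fun ε hε => ?_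
  obtain ⟨δ, hδ, hdist⟩ := exists_dist_le_of_symmDiff (μ := μ) hp (by positivity : 0 < ε / 2)
  obtain ⟨t, ht, hcov⟩ := key δ hδ
  refine ⟨(fun n => (T ^ n) (f.toLp μ p)) '' t, ht.image _, ?_⟩
  rintro _ ⟨n, rfl⟩
  obtain ⟨m, hm, hnm⟩ := hcov n
  refine mem_iUnion₂.2 ⟨_, mem_image_of_mem _ hm, ?_⟩
  rw [Metric.mem_ball]
  exact (hdist _ _ (hunit n) (hunit m) hnm.le).trans_lt (by linarith)

open Classical in
/-- The indicator function of a measurable set. -/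
noncomputable def UnitFun.indicator {A : Set X} (hA : MeasurableSet A) : UnitFun X :=
  ⟨fun x => if x ∈ A then 1 else 0, Measurable.ite hA measurable_const measurable_const⟩

omit [Fact (1 ≤ p)] in
lemma UnitFun.toLp_indicator {A : Set X} (hA : MeasurableSet A) :
    (UnitFun.indicator hA).toLp μ p = indicatorLp μ p hA := by
  refine Lp.ext ?_
  filter_upwards [((UnitFun.indicator hA).memLp μ p).coeFn_toLp, indicatorConstLp_coeFn (p := p)
    (hs := hA) (hμs := measure_ne_top μ A) (c := (1 : ℂ))] with x h1 h2
  rw [UnitFun.toLp, h1, h2]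
  by_cases hx : x ∈ A <;> simp [UnitFun.indicator, hx]

theorem IsNull.hasPrecompactOrbit (hp : p ≠ ∞) (hT : IsDoublyStochastic T) (h : IsNull T)
    (f : Lp ℂ p μ) : HasPrecompactOrbit T f := by
  have hT1 := hT.norm_le_one hp
  refine (denseRange_simpleToLp (μ := μ) hp).induction_on (p := fun f => f ∈ precompactOrbits hT1)
    f (precompactOrbits hT1).isClosed fun s => ?_
  rw [simpleToLp_eq_sum]
  refine Submodule.sum_mem (precompactOrbits hT1).toSubmodule fun c _ => Submodule.smul_mem _ c ?_
  rw [← UnitFun.toLp_indicator]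
  exact h.hasPrecompactOrbit_unitFun hp hT _

theorem isNull_of_splitsDiscreteStable (hp : p ≠ ∞) (hT : IsDoublyStochastic T)
    (h : SplitsDiscreteStable T) : IsNull T :=
  isNull_of_hasPrecompactOrbit hT (hasPrecompactOrbit_of_splitsDiscreteStable (hT.norm_le_one hp) h)

theorem IsNull.stableOnJdLG (hp : p ≠ ∞) (hT : IsDoublyStochastic T) (h : IsNull T) :
    StableOnJdLG T :=
  stableOnJdLG_of_hasPrecompactOrbit (hT.norm_le_one hp) (h.hasPrecompactOrbit hp hT)

theorem StableOnJdLG.splitsDiscreteStable (hp : p ≠ ∞) (hT : IsDoublyStochastic T)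
    (h : StableOnJdLG T) : SplitsDiscreteStable T := by
  obtain ⟨Q, hQ, hQQ, hrange⟩ := exists_idempotent_mem_wotSemigroup hp hT
  exact splitsDiscreteStable_of_stableOnJdLG hQ hQQ hrange h

end Null
end NullOperators

theorem mainTheorem1 {X : Type*} [MeasurableSpace X] (μ : Measure X) [IsProbabilityMeasure μ] :
    (∀ (p : ℝ≥0∞) [Fact (1 ≤ p)], p ≠ ∞ →
      ∀ T : Lp ℂ p μ →L[ℂ] Lp ℂ p μ, NullOperators.IsDoublyStochastic T →
        List.TFAE
          [NullOperators.IsNull T,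
           NullOperators.SplitsDiscreteStable T,
           NullOperators.StableOnJdLG T]) ∧
    (∀ T : Lp ℂ 2 μ →L[ℂ] Lp ℂ 2 μ, NullOperators.IsDoublyStochastic T →
        List.TFAE
          [NullOperators.IsNull T,
           NullOperators.SplitsDiscreteStable T,
           NullOperators.StableOnJdLG T,
           NullOperators.DiscreteStableOnNF T]) := by
  refine ⟨fun p _ hp T hT => ?_, fun T hT => ?_⟩
  · tfae_have 1 → 3 := NullOperators.IsNull.stableOnJdLG hp hT
    tfae_have 3 → 2 := NullOperators.StableOnJdLG.splitsDiscreteStable hp hT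
    tfae_have 2 → 1 := NullOperators.isNull_of_splitsDiscreteStable hp hT
    tfae_finish
  · have hp : (2 : ℝ≥0∞) ≠ ∞ := ENNReal.ofNat_ne_top
    have hT1 := hT.norm_le_one hp
    tfae_have 1 → 3 := NullOperators.IsNull.stableOnJdLG hp hT
    tfae_have 3 → 2 := NullOperators.StableOnJdLG.splitsDiscreteStable hp hT
    tfae_have 2 → 1 := NullOperators.isNull_of_splitsDiscreteStable hp hT
    tfae_have 1 → 4 := fun h => NullOperators.discreteStableOnNF_of_hasPrecompactOrbit hT1
      (h.hasPrecompactOrbit hp hT)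
    tfae_have 4 → 2 := NullOperators.splitsDiscreteStable_of_discreteStableOnNF hT1
    tfae_finish
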